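/- **Setting.** For every $n$ let $X_1,\dots,X_n$ (that is, $X_{n,1},\dots,X_{n,n}$) be independent random elements of a measurable space $\mathcal X$, not necessarily identically distributed. Fix a degree $m\ge 1$. For a sample size $N$ let $I_N^m$ be the set of $m$-tuples of pairwise distinct elements of $\{1,\dots,N\}$. For a weight function $a:I_N^m\to\mathbb R$ and a measurable kernel $h:\mathcal X^m\to\mathbb R$ (no symmetry is assumed) put $$U_N(a,h;x_1,\dots,x_N)=\frac{(N-m)!}{N!}\sum_{(i_1,\dots,i_m)\in I_N^m}a(i_1,\dots,i_m)\,h(x_{i_1},\dots,x_{i_m}).$$ Let $U_n=U_n(a_n,h_n;X_1,\dots,X_n)$ and $\sigma_n^2=\operatorname{Var}(U_n)$. Let $b=b_n$ be block lengths with $b_n\le n$ and $b_n\to\infty$. Let $a'_n$ and $h'_n$ be the weights and kernel used for blocks at stage $n$ (for instance $a_b,h_b$, or $a_n,h_n$), and put $U_{b,i}=U_b(a'_n,h'_n;X_i,\dots,X_{i+b-1})$ for $1\le i\le n-b+1$. Given the data, let $U_{b,i}^*=U_b(a'_n,h'_n;X^*_1,\dots,X^*_b)$, where $X_1^*,\dots,X_b^*$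 are independent draws with replacement from the empirical distribution of $\{X_i,\dots,X_{i+b-1}\}$, and let $\operatorname{Var}^*$ be the conditional variance given the data. With deterministic scale parameters $c_n\neq 0$ (the tuning parameters of the procedure) put $$V_n^*=\frac{1}{c_n(n-b+1)}\sum_{i=1}^{n-b+1}\operatorname{Var}^*(U_{b,i}^*).$$ **Bootstrap-variance conditions.** Consider a sequence of samples $X_1,\dots,X_N$ of independent variables with laws $P_1,\dots,P_N$, of sizes $N\to\infty$, with weights $a$ and kernel $h$, all depending on the stage. Write $\sigma^2=\operatorname{Var}(U_N(a,h;X_1,\dots,X_N))$ and $\theta(\mathbf i)=E\,h(X_{i_1},\dots,X_{i_m})$ for $\mathbf i\in I_N^m$. Let $f^{(l)}_{\mathbf i}(x)$ be the integral of $h(y_1,\dots,y_{l-1},x,y_{l+1},\dots,y_m)$ with respect to $\prod_{k\ne l}P_{i_k}(dy_k)$, and put $$h_{1,i}(x)=\frac{(N-m)!}{(N-1)!}\sum_{l=1}^m\ \sum_{\mathbf i\in I_N^m,\ i_l=i}a(\mathbf i)\{f^{(l)}_{\mathbf i}(x)-\theta(\mathbf i)\},\qquad V=\operatorname{Var}\Big\{\frac1N\sum_{i=1}^N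 h_{1,i}(X_i)\Big\}.$$ Let $A_{K,q}$ be the average of $|a(\mathbf i^{(1)})\cdots a(\mathbf i^{(K)})|$ over all $K$-tuples of elements of $I_N^m$ that have at least $q$ indices in common (and $0$ if there are none). Let $M_1=\max_{\mathbf i,\mathbf j\in I_N^m}|\theta(\mathbf i)-\theta(\mathbf j)|$. Let $$M_2=\max\big|E[E\{h(X_{\mathbf r})h(X_{\mathbf s})\mid X_{k_p}\}]-E[E\{h(X_{\mathbf k})h(X_{\mathbf s})\mid X_{k_p}\}]\big|,$$ where the maximum is over $1\le p,q\le m$ and $\mathbf r,\mathbf s,\mathbf k\in I_N^m$ such that $\mathbf r,\mathbf s$ have exactly the index $r_p=s_q$ in common and $\mathbf k,\mathbf s$ have exactly the index $k_p=s_q$ in common. The conditions are: 1. $V>0$ at all sufficiently late stages, and there are numbers $M>0$, depending only on the stage, with $E\{h(X_{i_1},\dots,X_{i_m})^4\}\le M$ for all $\mathbf i\in I_N^m$, with $N^{-2}V^{-1}A_{2,2}M^{1/2}\to0$ and $N^{-2}V^{-3/2}A_{3,1}M^{3/4}\to0$; 2. there is a constant $C$ such that, at all sufficiently late stages and for all $k_1,\dots,k_m\in\{1,\dots,N\}$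 (repetitions allowed), $E\{h(X_{k_1},\dots,X_{k_m})^2\}\le C$ and $\int h^2\,d(P_{k_1}\otimes\cdots\otimes P_{k_m})\le C$; 3. $\frac1N\sum_{i,j=1}^N\big\{\frac{h_{1,i}(X_j)}{N\sigma}\big\}^2\to1$ in probability, $\frac1{N^2}\sum_{i=1}^N\big\{\sum_{j=1}^N\frac{h_{1,i}(X_j)}{N\sigma}\big\}^2\to0$ in probability, and $N^{-1}\sigma^{-2}A_{2,1}\{M_1^2+M_2+N^{-1}\}\to0$. **Theorem.** Assume that for every choice of indices $i_n\in\{1,\dots,n-b_n+1\}$ the sequence of blocks $\{X_{i_n},\dots,X_{i_n+b_n-1}\}$, with weights $a'_n$ and kernel $h'_n$, satisfies the bootstrap-variance conditions (with $N=b_n$, as $n\to\infty$). Assume further that there are numbers $\sigma_b^2$ (depending on $n$ but not on the block) with $\operatorname{Var}(U_{b,i_n})=\sigma_b^2(1+o(1))$ for every such choice, and numbers $\zeta_{n,b}>0$ with $\sigma_b^2/\sigma_n^2=\zeta_{n,b}(1+o(1))$. Then $$\sigma_n^{-2}V_n^*-\operatorname{Var}(\sigma_n^{-1}U_n)=\frac{\zeta_{n,b}}{c_n}\,(1+o_P(1))-1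 ,$$ that is, there are random variables $R_n\to0$ in probability such that for all sufficiently large $n$ the left-hand side equals $\frac{\zeta_{n,b}}{c_n}(1+R_n)-1$. -/

import Mathlib

open MeasureTheory ProbabilityTheory Filter Topology Asymptotics
open scoped Nat ENNReal

noncomputable section

namespace WeightedU

/-! The index set `I_N^m` of `m`-tuples of pairwise distinct indices of a sample of size `N` is the
type `Fin m ↪ Fin N` (indices start at `0`). -/

section Statistic

variable {𝓧 : Type*} {m N : ℕ}

/-- The weighted U-statistic of degree `m` with weight function `a` and kernel `h`, evaluated at a
sample `x` of size `N`. Neither `a` nor `h` is assumed symmetric. -/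
def uStat (a : (Fin m → Fin N) → ℝ) (h : (Fin m → 𝓧) → ℝ) (x : Fin N → 𝓧) : ℝ :=
  ((N - m)! : ℝ) / (N ! : ℝ) * ∑ I : Fin m ↪ Fin N, a I * h (fun l => x (I l))

/-- The bootstrap variance `Var*` of the weighted U-statistic, given the data `x`: the bootstrap
sample is `x (J 0), …, x (J (N - 1))`, where `J 0, …, J (N - 1)` are independent and uniform on
`Fin N` (so that `J` is uniform on the set of all maps `Fin N → Fin N`); that is, the bootstrap
sample consists of `N` independent draws, with replacement, from the empirical distribution
of `x`. -/
def bootVar (a : (Fin m → Fin N) → ℝ) (h : (Fin m → 𝓧) → ℝ) (x : Fin N → 𝓧) : ℝ :=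
  variance (fun J : Fin N → Fin N => uStat a h (fun k => x (J k))) (uniformOn Set.univ)

/-- The indices that occur in each of the `K` index tuples. -/
def commonIndices {K : ℕ} (I : Fin K → (Fin m ↪ Fin N)) : Finset (Fin N) :=
  Finset.univ.filter fun x => ∀ k, ∃ l, I k l = x

/-- The collection `(I_N^m)_{≥ q}^{⊗ K}` of all `K`-tuples of elements of `I_N^m` with at least `q`
indices in common. -/
def sharingTuples (m N K q : ℕ) : Finset (Fin K → (Fin m ↪ Fin N)) :=
  Finset.univ.filter fun I => q ≤ (commonIndices I).card

/-- The average weight `A_{K,q}`. -/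
def avgWeight (a : (Fin m → Fin N) → ℝ) (K q : ℕ) : ℝ :=
  ((sharingTuples m N K q).card : ℝ)⁻¹ * ∑ I ∈ sharingTuples m N K q, |∏ k, a (I k)|

end Statistic

section Population

variable {𝓧 : Type*} [MeasurableSpace 𝓧] {m N : ℕ} {Ω : Type*} [MeasurableSpace Ω]

/-- `θ(i_1, …, i_m) = E h(X_{i_1}, …, X_{i_m})`. -/
def theta (P : Measure Ω) (X : Fin N → Ω → 𝓧) (h : (Fin m → 𝓧) → ℝ) (I : Fin m ↪ Fin N) : ℝ :=
  ∫ ω, h (fun l => X (I l) ω) ∂P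

/-- `f^{(l)}_{(i_1, …, i_m) \ i_l}(x)`: the `l`-th argument of `h` is `x`, and every other argument
`y_k` is integrated against the law of `X_{i_k}`. (The coordinate `y_l` is integrated too, but the
integrand does not depend on it.) -/
def proj (P : Measure Ω) (X : Fin N → Ω → 𝓧) (h : (Fin m → 𝓧) → ℝ) (I : Fin m ↪ Fin N)
    (l : Fin m) (x : 𝓧) : ℝ :=
  ∫ y, h (Function.update y l x) ∂(Measure.pi fun k => P.map (X (I k)))

/-- The first order expansion `h_{1,i}` of the kernel for `X_i`. The tuples
`π_l(i; i_1, …, i_{m-1})`, with `i_1, …, i_{m-1}` distinct and different from `i`, are exactly the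
elements `I` of `I_N^m` with `I l = i`. -/
def hOne (P : Measure Ω) (X : Fin N → Ω → 𝓧) (a : (Fin m → Fin N) → ℝ) (h : (Fin m → 𝓧) → ℝ)
    (i : Fin N) (x : 𝓧) : ℝ :=
  ((N - m)! : ℝ) / ((N - 1)! : ℝ) *
    ∑ l : Fin m, ∑ I ∈ Finset.univ.filter (fun I : Fin m ↪ Fin N => I l = i),
      a I * (proj P X h I l x - theta P X h I)

/-- `V = Var (N⁻¹ ∑ i, h_{1,i}(X_i))`. -/
def mainVar (P : Measure Ω) (X : Fin N → Ω → 𝓧) (a : (Fin m → Fin N) → ℝ)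
    (h : (Fin m → 𝓧) → ℝ) : ℝ :=
  variance (fun ω => (N : ℝ)⁻¹ * ∑ i : Fin N, hOne P X a h i (X i ω)) P

/-- The variance `σ²` of the U-statistic of the sample `X`. -/
def uVar (P : Measure Ω) (X : Fin N → Ω → 𝓧) (a : (Fin m → Fin N) → ℝ)
    (h : (Fin m → 𝓧) → ℝ) : ℝ :=
  variance (fun ω => uStat a h (fun k => X k ω)) P

/-- `M_1`, the maximal difference between two of the means `θ`. -/
def meanGap (P : Measure Ω) (X : Fin N → Ω → 𝓧) (h : (Fin m → 𝓧) → ℝ) : ℝ :=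
  ⨆ t : (Fin m ↪ Fin N) × (Fin m ↪ Fin N), |theta P X h t.1 - theta P X h t.2|

/-- The quantity `E [E {h(X_r) h(X_s) | X_i}]`. -/
def crossMoment (P : Measure Ω) (X : Fin N → Ω → 𝓧) (h : (Fin m → 𝓧) → ℝ)
    (r s : Fin m ↪ Fin N) (i : Fin N) : ℝ :=
  ∫ ω, (P[fun ω' => h (fun l => X (r l) ω') * h (fun l => X (s l) ω') |
    MeasurableSpace.comap (X i) inferInstance]) ω ∂P

/-- The configurations `(p, q, r, s, k)` over which the maximum `M_2` is taken: `r` and `s` have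
exactly the index `r_p = s_q` in common, and so do `k` and `s`, with `k_p = s_q`. -/
abbrev CrossConfig (m N : ℕ) : Type :=
  {t : (Fin m × Fin m) × ((Fin m ↪ Fin N) × (Fin m ↪ Fin N) × (Fin m ↪ Fin N)) //
    commonIndices ![t.2.1, t.2.2.1] = {t.2.2.1 t.1.2} ∧ t.2.1 t.1.1 = t.2.2.1 t.1.2 ∧
    commonIndices ![t.2.2.2, t.2.2.1] = {t.2.2.1 t.1.2} ∧ t.2.2.2 t.1.1 = t.2.2.1 t.1.2}

/-- `M_2`, the maximum of `|E [E {h(X_r) h(X_s) | X_{k_p}}] - E [E {h(X_k) h(X_s) | X_{k_p}}]|`. -/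
def crossGap (P : Measure Ω) (X : Fin N → Ω → 𝓧) (h : (Fin m → 𝓧) → ℝ) : ℝ :=
  ⨆ t : CrossConfig m N,
    |crossMoment P X h t.1.2.1 t.1.2.2.1 (t.1.2.2.2 t.1.1.1) -
      crossMoment P X h t.1.2.2.2 t.1.2.2.1 (t.1.2.2.2 t.1.1.1)|

end Population

section Asymptotic

variable {𝓧 : Type*} [MeasurableSpace 𝓧] {m : ℕ}
variable {Ω : ℕ → Type*} [∀ n, MeasurableSpace (Ω n)]

/-- Convergence in probability to a constant, where the probability space may change with `n`. -/
def TendstoInProb (P : ∀ n, Measure (Ω n)) (Y : ∀ n, Ω n → ℝ) (c : ℝ) : Prop :=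
  ∀ ε : ℝ, 0 < ε → Tendsto (fun n => P n {ω | ε ≤ |Y n ω - c|}) atTop (𝓝 0)

/-- The conditions for consistent bootstrap variance estimation, for a sequence of samples: the
`n`-th sample `X n` has size `N n`, and its U-statistic has weight function `a n` and
kernel `h n`. -/
structure BootstrapConditions (P : ∀ n, Measure (Ω n)) (N : ℕ → ℕ)
    (X : ∀ n, Fin (N n) → Ω n → 𝓧) (a : ∀ n, (Fin m → Fin (N n)) → ℝ)
    (h : ℕ → (Fin m → 𝓧) → ℝ) : Prop where
  /-- The quantities `V(n)`, by which the conditions below divide, are not zero. -/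
  mainVar_pos : ∀ᶠ n in atTop, 0 < mainVar (P n) (X n) (a n) (h n)
  /-- The conditions for asymptotic normality: fourth moments, and the two rate conditions. -/
  normality : ∃ M : ℕ → ℝ, (∀ n, 0 < M n) ∧
    (∀ n, ∀ I : Fin m ↪ Fin (N n),
      Integrable (fun ω => h n (fun l => X n (I l) ω) ^ 4) (P n) ∧
      ∫ ω, h n (fun l => X n (I l) ω) ^ 4 ∂(P n) ≤ M n) ∧
    Tendsto (fun n => (N n : ℝ) ^ (-2 : ℝ) * (mainVar (P n) (X n) (a n) (h n)) ^ (-1 : ℝ) *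
      avgWeight (a n) 2 2 * M n ^ (1 / 2 : ℝ)) atTop (𝓝 0) ∧
    Tendsto (fun n => (N n : ℝ) ^ (-2 : ℝ) * (mainVar (P n) (X n) (a n) (h n)) ^ (-3 / 2 : ℝ) *
      avgWeight (a n) 3 1 * M n ^ (3 / 4 : ℝ)) atTop (𝓝 0)
  /-- Bounded second moments `E h(X_{k_1}, …, X_{k_m})²`, where indices may repeat; a repeated index
  stands for one and the same variable, or for independent copies of it. -/
  vonMises : ∃ C : ℝ, ∀ᶠ n in atTop, ∀ k : Fin m → Fin (N n),
    (Integrable (fun ω => h n (fun l => X n (k l) ω) ^ 2) (P n) ∧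
      ∫ ω, h n (fun l => X n (k l) ω) ^ 2 ∂(P n) ≤ C) ∧
    (Integrable (fun y => h n y ^ 2) (Measure.pi fun l => (P n).map (X n (k l))) ∧
      ∫ y, h n y ^ 2 ∂(Measure.pi fun l => (P n).map (X n (k l))) ≤ C)
  /-- First homogeneity condition. -/
  homogeneity_one : TendstoInProb P (fun n ω => (N n : ℝ)⁻¹ * ∑ i, ∑ j,
    (hOne (P n) (X n) (a n) (h n) i (X n j ω) /
      ((N n : ℝ) * √(uVar (P n) (X n) (a n) (h n)))) ^ 2) 1
  /-- Second homogeneity condition. -/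
  homogeneity_two : TendstoInProb P (fun n ω => ((N n : ℝ) ^ 2)⁻¹ * ∑ i, (∑ j,
    hOne (P n) (X n) (a n) (h n) i (X n j ω) /
      ((N n : ℝ) * √(uVar (P n) (X n) (a n) (h n)))) ^ 2) 0
  /-- Third homogeneity condition. -/
  homogeneity_three : Tendsto (fun n => (N n : ℝ)⁻¹ * (uVar (P n) (X n) (a n) (h n))⁻¹ *
    avgWeight (a n) 2 1 * (meanGap (P n) (X n) (h n) ^ 2 + crossGap (P n) (X n) (h n) +
      (N n : ℝ)⁻¹)) atTop (𝓝 0)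

end Asymptotic

section Block

variable {𝓧 : Type*} {m : ℕ}

/-- The block of length `b` of the sequence `x` that starts at index `i`. -/
def block (b i : ℕ) (x : ℕ → 𝓧) : Fin b → 𝓧 := fun k => x (i + k)

/-- The moving-block resampling estimator `V*`, for the sample `x 0, …, x (n - 1)`, block length `b`
and scale parameter `c`: the average, over the `n - b + 1` blocks of length `b`, of the bootstrap
variances of the block U-statistic, divided by `c`. -/
def movingBlockVar (n b : ℕ) (c : ℝ) (a : (Fin m → Fin b) → ℝ) (h : (Fin m → 𝓧) → ℝ)
    (x : ℕ → 𝓧) : ℝ :=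
  1 / (c * ((n : ℝ) - (b : ℝ) + 1)) * ∑ i ∈ Finset.range (n - b + 1), bootVar a h (block b i x)

end Block

end WeightedU

end

/-! The proof rests on the Hájek decomposition of `h(X_I)` into its mean, its projections on single
variables, and a residual. The residual is orthogonal to every square-integrable function that
shares at most one variable with it (`integral_mul_residual`). Hence the variance of a U-statistic
is `V` plus a remainder to which only pairs of tuples with two common indices contribute
(`uVar_eq_add`, `uVar_le`). Given the data, the bootstrap statistic is again a U-statistic of an
independent sample, namely of uniform random indices. The same result therefore traps the bootstrap
variance between a quadratic form in empirical first order kernels and that form plus a small term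
(`bootVar_bounds`).

It remains to show that this quadratic form, divided by `σ²`, tends to `1`. The empirical kernels
`bootOne` are compared in `L²` with the true kernels `hOne`, for which the first homogeneity
condition gives the limit in probability. The comparison expands squares into averages over index
tuples. Tuples in general position contribute at most `M₁²` or a multiple of `M₂`, and the remaining
ones form a fraction `O(1/N)` (`average_le_of_generic`, `sum_integral_bootOne_sub_hOne_sq_le`).

Convergence in probability is not enough, because a growing number of blocks is averaged;
convergence in `L¹` is required. A third array `offOne` leaves out the tuples that contain `j` in
another position. Its kernels have fourth moments, and its sum of squares is a sum over `j` of
independent terms, whose variance vanishes by the condition on `A_{3,1}`. Concentration and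
convergence in probability together force its mean to `1`, so it converges in `L¹`, and
`L²`-closeness passes this on to the bootstrap array (`tendsto_integral_abs_sum_sq_sub_one`).

Finally, a statement that holds for every choice of one block per stage holds uniformly over blocks,
since the choice may pick the worst block (`eventually_forall_le_of_choice`). The `L¹` errors can
then be averaged, and what is left is deterministic scaling. -/

namespace WeightedU

/-! ### Freezing some coordinates of an independent sample -/

section Independence

variable {𝓧 : Type*} [MeasurableSpace 𝓧] {ι : Type*}

open Classical in
/-- The sample that agrees with `x` on `A` and with `y` off `A`. -/
noncomputable def mix (A : Set ι) (z : (ι → 𝓧) × (ι → 𝓧)) : ι → 𝓧 :=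
  fun i => if i ∈ A then z.1 i else z.2 i

theorem measurable_mix (A : Set ι) : Measurable (mix (𝓧 := 𝓧) A) := by
  classical
  refine measurable_pi_lambda _ fun i => ?_
  unfold mix
  by_cases h : i ∈ A
  · simp only [h, if_true]; fun_prop
  · simp only [h, if_false]; fun_prop

variable [Fintype ι]

/-- The preimage of a box is a product of two boxes in which each coordinate is constrained in one
factor only, so the masses multiply to that of the original box. -/
theorem map_mix_pi (A : Set ι) (μ : ι → Measure 𝓧) [∀ i, IsProbabilityMeasure (μ i)] :
    ((Measure.pi μ).prod (Measure.pi μ)).map (mix A) = Measure.pi μ := by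
  classical
  refine (Measure.pi_eq fun s hs => ?_).symm
  rw [Measure.map_apply (measurable_mix A) (MeasurableSet.univ_pi hs)]
  have : mix A ⁻¹' (Set.univ.pi s) =
      (Set.univ.pi fun i => if i ∈ A then s i else Set.univ) ×ˢ
        (Set.univ.pi fun i => if i ∈ A then Set.univ else s i) := by
    ext z
    simp only [Set.mem_preimage, Set.mem_pi, Set.mem_univ, true_imp_iff, Set.mem_prod, mix]
    constructor
    · intro hz
      refine ⟨fun i => ?_, fun i => ?_⟩ <;> by_cases h : i ∈ A <;> have := hz i <;> simp_all
    · rintro ⟨h1, h2⟩ i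
      have := h1 i; have := h2 i
      by_cases h : i ∈ A <;> simp_all
  rw [this, Measure.prod_prod, Measure.pi_pi, Measure.pi_pi, ← Finset.prod_mul_distrib]
  refine Finset.prod_congr rfl fun i _ => ?_
  by_cases h : i ∈ A <;> simp [h]

/-- The old `l`-th coordinate is integrated out with mass one, which leaves the new factor in its
place. This turns integrals over one substituted argument into integrals against a product measure.
-/
theorem map_update_pi [DecidableEq ι] (ν : ι → Measure 𝓧) [∀ i, IsProbabilityMeasure (ν i)] (l : ι)
    (μ : Measure 𝓧) [IsProbabilityMeasure μ] :
    (μ.prod (Measure.pi ν)).map (fun z => Function.update z.2 l z.1) =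
      Measure.pi (Function.update ν l μ) := by
  have hp : ∀ i, IsProbabilityMeasure (Function.update ν l μ i) := by
    intro i
    by_cases h : i = l
    · subst h; simpa
    · simpa [Function.update_of_ne h] using (inferInstance : IsProbabilityMeasure (ν i))
  have hm : Measurable fun z : 𝓧 × (ι → 𝓧) => Function.update z.2 l z.1 :=
    measurable_update'.comp measurable_swap
  refine (Measure.pi_eq fun s hs => ?_).symm
  rw [Measure.map_apply hm (MeasurableSet.univ_pi hs)]
  have : (fun z : 𝓧 × (ι → 𝓧) => Function.update z.2 l z.1) ⁻¹' (Set.univ.pi s) =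
      s l ×ˢ (Set.univ.pi (Function.update s l Set.univ)) := by
    ext z
    simp only [Set.mem_preimage, Set.mem_pi, Set.mem_univ, true_imp_iff, Set.mem_prod]
    constructor
    · intro hz
      refine ⟨by simpa using hz l, fun i => ?_⟩
      have := hz i
      by_cases h : i = l
      · subst h; simp
      · simpa [h] using this
    · rintro ⟨h1, h2⟩ i
      have := h2 i
      by_cases h : i = l
      · subst h; simpa
      · simpa [h] using this
  rw [this, Measure.prod_prod, Measure.pi_pi, ← Finset.mul_prod_erase _ _ (Finset.mem_univ l),
    ← Finset.mul_prod_erase _ _ (Finset.mem_univ l)]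
  simp only [Function.update_self, measure_univ, one_mul]
  congr 1
  refine Finset.prod_congr rfl fun i hi => ?_
  have := Finset.ne_of_mem_erase hi
  simp [this]

variable {Ω : Type*} [MeasurableSpace Ω] {P : Measure Ω} [IsProbabilityMeasure P]
  {X : ι → Ω → 𝓧}

theorem map_mix (hX : ∀ i, Measurable (X i)) (hind : iIndepFun X P) (A : Set ι) :
    (P.prod P).map (fun z => mix A (fun i => X i z.1, fun i => X i z.2)) =
      P.map (fun ω i => X i ω) := by
  classical
  have hX' : Measurable fun ω i => X i ω := measurable_pi_lambda _ hX
  have hlaw := (iIndepFun_iff_map_fun_eq_pi_map fun i => (hX i).aemeasurable).1 hind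
  have hp : ∀ i, IsProbabilityMeasure (P.map (X i)) :=
    fun i => Measure.isProbabilityMeasure_map (hX i).aemeasurable
  have := map_mix_pi A fun i => P.map (X i)
  rw [← hlaw, Measure.map_prod_map _ _ hX' hX',
    Measure.map_map (measurable_mix A) (hX'.prodMap hX')] at this
  exact this

/-- Resampling the coordinates off `A` from an independent copy preserves the law, and Fubini
separates the two copies. The inner integral plays the role of conditional expectation given the
coordinates in `A`. -/
theorem integral_mix (hX : ∀ i, Measurable (X i)) (hind : iIndepFun X P) (A : Set ι)
    {F : (ι → 𝓧) → ℝ} (hF : Measurable F) (hint : Integrable (fun ω => F fun i => X i ω) P) :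
    ∫ ω, F (fun i => X i ω) ∂P =
      ∫ ω, ∫ ω', F (mix A (fun i => X i ω, fun i => X i ω')) ∂P ∂P := by
  have hX' : Measurable fun ω i => X i ω := measurable_pi_lambda _ hX
  have hm : Measurable fun z : Ω × Ω => mix A (fun i => X i z.1, fun i => X i z.2) :=
    (measurable_mix A).comp (hX'.prodMap hX')
  have h1 : Integrable F (P.map fun ω i => X i ω) :=
    (integrable_map_measure hF.aestronglyMeasurable hX'.aemeasurable).2 hint
  have h2 : Integrable (fun z : Ω × Ω => F (mix A (fun i => X i z.1, fun i => X i z.2)))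
      (P.prod P) := by
    rw [← map_mix hX hind A] at h1
    exact (integrable_map_measure hF.aestronglyMeasurable hm.aemeasurable).1 h1
  rw [← integral_prod _ h2, ← integral_map hm.aemeasurable hF.aestronglyMeasurable,
    map_mix hX hind A, integral_map hX'.aemeasurable hF.aestronglyMeasurable]

/-- Functions of disjoint sets of coordinates are uncorrelated. -/
theorem integral_mul_of_dependsOn (hX : ∀ i, Measurable (X i)) (hind : iIndepFun X P) (A : Set ι)
    {f g : (ι → 𝓧) → ℝ} (hf : Measurable f) (hg : Measurable g) (hgA : DependsOn g A)
    (hfA : DependsOn f Aᶜ)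
    (hint : Integrable (fun ω => g (fun i => X i ω) * f (fun i => X i ω)) P) :
    ∫ ω, g (fun i => X i ω) * f (fun i => X i ω) ∂P =
      (∫ ω, g (fun i => X i ω) ∂P) * ∫ ω, f (fun i => X i ω) ∂P := by
  rw [integral_mix hX hind A (F := fun x => g x * f x) (hg.mul hf) hint, ← integral_mul_const]
  refine integral_congr_ae (.of_forall fun ω => ?_)
  simp only
  rw [← integral_const_mul]
  refine integral_congr_ae (.of_forall fun ω' => ?_)
  simp only
  congr 1
  · exact hgA fun i hi => by simp [mix, hi]
  · exact hfA fun i hi => by simp [mix, show i ∉ A from hi]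

end Independence

/-! ### Projections of the kernel on one variable -/

section Proj

variable {𝓧 : Type*} [MeasurableSpace 𝓧] {m N : ℕ} {Ω : Type*} [MeasurableSpace Ω]
  {P : Measure Ω} [IsProbabilityMeasure P] {X : Fin N → Ω → 𝓧} {h : (Fin m → 𝓧) → ℝ}

theorem map_tuple (hX : ∀ i, Measurable (X i)) (hind : iIndepFun X P) (I : Fin m ↪ Fin N) :
    P.map (fun ω l => X (I l) ω) = Measure.pi fun l => P.map (X (I l)) :=
  (iIndepFun_iff_map_fun_eq_pi_map fun l => (hX (I l)).aemeasurable).1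
    (hind.precomp I.injective)

theorem proj_eq_integral (hX : ∀ i, Measurable (X i)) (hind : iIndepFun X P) (hh : Measurable h)
    (I : Fin m ↪ Fin N) (l : Fin m) (x : 𝓧) :
    proj P X h I l x = ∫ ω, h (Function.update (fun k => X (I k) ω) l x) ∂P := by
  have hm : Measurable fun ω k => X (I k) ω := measurable_pi_lambda _ fun k => hX (I k)
  rw [proj, ← map_tuple hX hind I, integral_map hm.aemeasurable]
  exact (hh.comp measurable_update_left).aestronglyMeasurable

theorem measurable_proj (hX : ∀ i, Measurable (X i)) (hh : Measurable h)
    (I : Fin m ↪ Fin N) (l : Fin m) : Measurable (proj P X h I l) := by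
  have hp : ∀ i, IsProbabilityMeasure (P.map (X i)) :=
    fun i => Measure.isProbabilityMeasure_map (hX i).aemeasurable
  have hm : Measurable fun z : 𝓧 × (Fin m → 𝓧) => h (Function.update z.2 l z.1) :=
    hh.comp (measurable_update'.comp measurable_swap)
  exact (hm.stronglyMeasurable.integral_prod_right').measurable

/-- Substituting `x` amounts to replacing the `l`-th factor by a Dirac mass, after which the index
`I l` no longer occurs. -/
theorem proj_congr (hX : ∀ i, Measurable (X i)) (hh : Measurable h)
    {I J : Fin m ↪ Fin N} {l : Fin m} (hIJ : ∀ k, k ≠ l → I k = J k) (x : 𝓧) :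
    proj P X h I l x = proj P X h J l x := by
  have hp : ∀ i, IsProbabilityMeasure (P.map (X i)) :=
    fun i => Measure.isProbabilityMeasure_map (hX i).aemeasurable
  have key : ∀ I : Fin m ↪ Fin N, proj P X h I l x = ∫ y, h y ∂(Measure.pi
      (Function.update (fun k => P.map (X (I k))) l (Measure.dirac x))) := by
    intro I
    have hm : Measurable fun z : 𝓧 × (Fin m → 𝓧) => Function.update z.2 l z.1 :=
      measurable_update'.comp measurable_swap
    rw [← map_update_pi, integral_map hm.aemeasurable hh.aestronglyMeasurable,
      Measure.dirac_prod, integral_map (f := fun z : 𝓧 × (Fin m → 𝓧) => h (Function.update z.2 l z.1))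
        (by fun_prop) (hh.comp hm).aestronglyMeasurable]
    rfl
  rw [key, key]
  congr 2
  ext1 k
  by_cases hk : k = l
  · subst hk; simp
  · simp [hk, hIJ k hk]

/-- Integrating `h(X_s)` against a function of coordinates `A` that contain only the `p`-th index
of `s` amounts to replacing `h(X_s)` by its projection. -/
theorem integral_mul_proj (hX : ∀ i, Measurable (X i)) (hind : iIndepFun X P) (hh : Measurable h)
    {A : Set (Fin N)} {g : (Fin N → 𝓧) → ℝ} (hg : Measurable g) (hgA : DependsOn g A)
    (s : Fin m ↪ Fin N) (p : Fin m) (hs : ∀ l, s l ∈ A ↔ l = p)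
    (hint : Integrable (fun ω => g (fun i => X i ω) * h (fun l => X (s l) ω)) P) :
    ∫ ω, g (fun i => X i ω) * proj P X h s p (X (s p) ω) ∂P =
      ∫ ω, g (fun i => X i ω) * h (fun l => X (s l) ω) ∂P := by
  -- With the coordinates in `A` frozen, only the `p`-th argument of the kernel stays fixed, and the
  -- others are averaged over an independent copy: this is the projection.
  rw [integral_mix hX hind A (F := fun x => g x * h fun l => x (s l))
    (hg.mul (hh.comp (by fun_prop))) hint]
  refine integral_congr_ae (.of_forall fun ω => ?_)
  simp only
  rw [proj_eq_integral hX hind hh, ← integral_const_mul]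
  refine integral_congr_ae (.of_forall fun ω' => ?_)
  simp only
  congr 1
  · exact hgA fun i hi => by simp [mix, hi]
  · congr 1
    ext1 l
    by_cases hl : l = p
    · subst hl; simp [mix, (hs l).2 rfl]
    · simp [mix, (hs l).not.2 hl, hl]

end Proj

/-! ### Moments of projections -/

section Moments

theorem integrable_of_integrable_even_pow {α : Type*} [MeasurableSpace α] {μ : Measure α}
    [IsProbabilityMeasure μ] {f : α → ℝ} {n : ℕ} (hn : Even n) (hn0 : n ≠ 0)
    (hf : AEStronglyMeasurable f μ) (hint : Integrable (fun x => f x ^ n) μ) :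
    Integrable f μ := by
  refine Integrable.mono' ((integrable_const (1 : ℝ)).add hint) hf (.of_forall fun x => ?_)
  simp only [Pi.add_apply, Real.norm_eq_abs]
  rw [← hn.pow_abs]
  rcases le_total |f x| 1 with h | h
  · have := pow_nonneg (abs_nonneg (f x)) n
    linarith
  · have := le_self_pow₀ h hn0
    linarith

/-- Jensen for an even power; used with exponents two and four. -/
theorem pow_integral_le {α : Type*} [MeasurableSpace α] {μ : Measure α}
    [IsProbabilityMeasure μ] {f : α → ℝ} {n : ℕ} (hn : Even n) (hn0 : n ≠ 0)
    (hf : AEStronglyMeasurable f μ) (hint : Integrable (fun x => f x ^ n) μ) :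
    (∫ x, f x ∂μ) ^ n ≤ ∫ x, f x ^ n ∂μ :=
  hn.convexOn_pow.map_integral_le (continuous_pow n).continuousOn isClosed_univ
    (by simp) (integrable_of_integrable_even_pow hn hn0 hf hint) hint

variable {𝓧 : Type*} [MeasurableSpace 𝓧] {m N : ℕ} {Ω : Type*} [MeasurableSpace Ω]
  {P : Measure Ω} [IsProbabilityMeasure P] {X : Fin N → Ω → 𝓧} {h : (Fin m → 𝓧) → ℝ}

/-- Jensen in the inner integral, then Fubini. The index `j` may also occur elsewhere in `I`; the
relevant law then has independent copies of a repeated variable, which is why the moment condition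
includes product measures with repeated indices. -/
theorem proj_pow_le (hX : ∀ i, Measurable (X i)) (hh : Measurable h)
    (I : Fin m ↪ Fin N) (l : Fin m) (j : Fin N) {n : ℕ} (hn : Even n) (hn0 : n ≠ 0)
    (hint : Integrable (fun y => h y ^ n)
      (Measure.pi fun k => P.map (X (Function.update I l j k)))) :
    Integrable (fun ω => proj P X h I l (X j ω) ^ n) P ∧
      ∫ ω, proj P X h I l (X j ω) ^ n ∂P ≤
        ∫ y, h y ^ n ∂(Measure.pi fun k => P.map (X (Function.update I l j k))) := by
  have hp : ∀ i, IsProbabilityMeasure (P.map (X i)) :=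
    fun i => Measure.isProbabilityMeasure_map (hX i).aemeasurable
  have hQ : (fun k => P.map (X (Function.update I l j k))) =
      Function.update (fun k => P.map (X (I k))) l (P.map (X j)) := by
    ext1 k
    by_cases hk : k = l
    · subst hk; simp
    · simp [hk]
  have hm : Measurable fun z : 𝓧 × (Fin m → 𝓧) => Function.update z.2 l z.1 :=
    measurable_update'.comp measurable_swap
  have hmn : Measurable fun y => h y ^ n := hh.pow_const n
  rw [hQ, ← map_update_pi] at hint ⊢
  rw [integral_map hm.aemeasurable hmn.aestronglyMeasurable]
  have hint' : Integrable (fun z : 𝓧 × (Fin m → 𝓧) => h (Function.update z.2 l z.1) ^ n)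
      ((P.map (X j)).prod (Measure.pi fun k => P.map (X (I k)))) :=
    (integrable_map_measure hmn.aestronglyMeasurable hm.aemeasurable).1 hint
  rw [integral_prod _ hint']
  have hae : ∀ᵐ x ∂(P.map (X j)), proj P X h I l x ^ n ≤
      ∫ y, h (Function.update y l x) ^ n ∂(Measure.pi fun k => P.map (X (I k))) := by
    filter_upwards [hint'.prod_right_ae] with x hx
    exact pow_integral_le hn hn0 (hh.comp measurable_update_left).aestronglyMeasurable hx
  have hint2 := hint'.integral_prod_left
  have hint1 : Integrable (fun x => proj P X h I l x ^ n) (P.map (X j)) := by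
    refine Integrable.mono' hint2 ((measurable_proj hX hh I l).pow_const n).aestronglyMeasurable ?_
    filter_upwards [hae] with x hx
    rwa [Real.norm_eq_abs, abs_of_nonneg (hn.pow_nonneg _)]
  refine ⟨(integrable_map_measure hint1.aestronglyMeasurable (hX j).aemeasurable).1 hint1, ?_⟩
  rw [← integral_map (f := fun x => proj P X h I l x ^ n) (hX j).aemeasurable
    hint1.aestronglyMeasurable]
  exact integral_mono_ae hint1 hint2 hae

/-- The tuple `I` with its `l`-th index replaced by `j`. -/
def replaceIndex (I : Fin m ↪ Fin N) (l : Fin m) (j : Fin N) (hj : ∀ k, k ≠ l → I k ≠ j) :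
    Fin m ↪ Fin N where
  toFun := Function.update I l j
  inj' := by
    intro k k' hkk
    by_cases hk : k = l <;> by_cases hk' : k' = l
    · rw [hk, hk']
    · subst hk; simp [hk'] at hkk; exact absurd hkk.symm (hj k' hk')
    · subst hk'; simp [hk] at hkk; exact absurd hkk (hj k hk)
    · simpa [hk, hk'] using hkk

theorem coe_replaceIndex (I : Fin m ↪ Fin N) (l : Fin m) (j : Fin N)
    (hj : ∀ k, k ≠ l → I k ≠ j) : ⇑(replaceIndex I l j hj) = Function.update I l j := rfl

@[simp] theorem replaceIndex_self (I : Fin m ↪ Fin N) (l : Fin m) (j : Fin N)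
    (hj : ∀ k, k ≠ l → I k ≠ j) : replaceIndex I l j hj l = j := by
  simp [coe_replaceIndex]

theorem replaceIndex_of_ne (I : Fin m ↪ Fin N) (l : Fin m) (j : Fin N)
    (hj : ∀ k, k ≠ l → I k ≠ j) {k : Fin m} (hk : k ≠ l) : replaceIndex I l j hj k = I k := by
  simp [coe_replaceIndex, hk]

theorem integral_tuple (hX : ∀ i, Measurable (X i)) (hind : iIndepFun X P) {f : (Fin m → 𝓧) → ℝ}
    (hf : Measurable f) (I : Fin m ↪ Fin N) :
    ∫ y, f y ∂(Measure.pi fun k => P.map (X (I k))) = ∫ ω, f (fun k => X (I k) ω) ∂P := by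
  rw [← map_tuple hX hind I, integral_map (measurable_pi_lambda _ fun k => hX (I k)).aemeasurable
    hf.aestronglyMeasurable]

theorem integrable_tuple (hX : ∀ i, Measurable (X i)) (hind : iIndepFun X P)
    {f : (Fin m → 𝓧) → ℝ} (hf : Measurable f) (I : Fin m ↪ Fin N) :
    Integrable f (Measure.pi fun k => P.map (X (I k))) ↔
      Integrable (fun ω => f (fun k => X (I k) ω)) P := by
  rw [← map_tuple hX hind I, integrable_map_measure hf.aestronglyMeasurable
    (measurable_pi_lambda _ fun k => hX (I k)).aemeasurable]
  rfl

/-- When `j` does not occur elsewhere, the product law is that of a genuine tuple of distinct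
indices, so the fourth-moment condition becomes available. -/
theorem proj_pow_le_of_forall_ne (hX : ∀ i, Measurable (X i)) (hind : iIndepFun X P)
    (hh : Measurable h) (I : Fin m ↪ Fin N) (l : Fin m) (j : Fin N) (hj : ∀ k, k ≠ l → I k ≠ j)
    {n : ℕ} (hn : Even n) (hn0 : n ≠ 0)
    (hint : Integrable (fun ω => h (fun k => X (replaceIndex I l j hj k) ω) ^ n) P) :
    Integrable (fun ω => proj P X h I l (X j ω) ^ n) P ∧
      ∫ ω, proj P X h I l (X j ω) ^ n ∂P ≤
        ∫ ω, h (fun k => X (replaceIndex I l j hj k) ω) ^ n ∂P := by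
  have hmn : Measurable fun y => h y ^ n := hh.pow_const n
  rw [← integral_tuple hX hind hmn]
  exact proj_pow_le hX hh I l j hn hn0 ((integrable_tuple hX hind hmn (replaceIndex I l j hj)).2 hint)

theorem replaceIndex_eq_self (I : Fin m ↪ Fin N) (l : Fin m) :
    replaceIndex I l (I l) (fun _ hk => fun e => hk (I.injective e)) = I := by
  ext k
  simp [replaceIndex]

/-- The projection of `h(X_I)` on its own variable has smaller moments. -/
theorem proj_self_pow_le (hX : ∀ i, Measurable (X i)) (hind : iIndepFun X P)
    (hh : Measurable h) (I : Fin m ↪ Fin N) (l : Fin m)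
    {n : ℕ} (hn : Even n) (hn0 : n ≠ 0)
    (hint : Integrable (fun ω => h (fun k => X (I k) ω) ^ n) P) :
    Integrable (fun ω => proj P X h I l (X (I l) ω) ^ n) P ∧
      ∫ ω, proj P X h I l (X (I l) ω) ^ n ∂P ≤ ∫ ω, h (fun k => X (I k) ω) ^ n ∂P := by
  have hj : ∀ k, k ≠ l → I k ≠ I l := fun _ hk => fun e => hk (I.injective e)
  have := proj_pow_le_of_forall_ne (P := P) hX hind hh I l (I l) hj hn hn0
  rw [replaceIndex_eq_self] at this
  exact this hint

end Moments

/-! ### The residual of the Hájek projection -/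

section Hajek

variable {𝓧 : Type*} [MeasurableSpace 𝓧] {m N : ℕ} {Ω : Type*} [MeasurableSpace Ω]
  {P : Measure Ω} [IsProbabilityMeasure P] {X : Fin N → Ω → 𝓧} {h : (Fin m → 𝓧) → ℝ}

theorem integral_proj (hX : ∀ i, Measurable (X i)) (hind : iIndepFun X P) (hh : Measurable h)
    (I : Fin m ↪ Fin N) (l : Fin m) (hint : Integrable (fun ω => h (fun k => X (I k) ω)) P) :
    ∫ ω, proj P X h I l (X (I l) ω) ∂P = theta P X h I := by
  have := integral_mul_proj hX hind hh (A := {I l}) (g := fun _ => 1) measurable_const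
    (fun _ _ _ => rfl) I l (by simp) (by simpa using hint)
  simpa [theta] using this

/-- The remainder of `h(X_I)` after subtraction of its mean and its first order projections. -/
noncomputable def residual (P : Measure Ω) (X : Fin N → Ω → 𝓧) (h : (Fin m → 𝓧) → ℝ)
    (I : Fin m ↪ Fin N) (x : Fin N → 𝓧) : ℝ :=
  h (fun l => x (I l)) - theta P X h I - ∑ p, (proj P X h I p (x (I p)) - theta P X h I)

theorem measurable_residual (hX : ∀ i, Measurable (X i)) (hh : Measurable h) (I : Fin m ↪ Fin N) :
    Measurable (residual P X h I) := by
  refine ((hh.comp (by fun_prop)).sub_const _).sub (Finset.measurable_sum _ fun p _ => ?_)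
  exact ((measurable_proj hX hh I p).comp (measurable_pi_apply _)).sub_const _

omit [IsProbabilityMeasure P] in
theorem dependsOn_residual (I : Fin m ↪ Fin N) :
    DependsOn (residual P X h I) (Set.range I) := by
  intro x y hxy
  have : ∀ l, x (I l) = y (I l) := fun l => hxy _ ⟨l, rfl⟩
  simp [residual, this]

theorem memLp_proj (hX : ∀ i, Measurable (X i)) (hind : iIndepFun X P) (hh : Measurable h)
    (I : Fin m ↪ Fin N) (l : Fin m) (h2 : MemLp (fun ω => h (fun k => X (I k) ω)) 2 P) :
    MemLp (fun ω => proj P X h I l (X (I l) ω)) 2 P := by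
  have hm : AEStronglyMeasurable (fun ω => proj P X h I l (X (I l) ω)) P :=
    ((measurable_proj hX hh I l).comp (hX _)).aestronglyMeasurable
  exact (memLp_two_iff_integrable_sq hm).2
    (proj_self_pow_le hX hind hh I l even_two two_ne_zero h2.integrable_sq).1

theorem memLp_residual (hX : ∀ i, Measurable (X i)) (hind : iIndepFun X P) (hh : Measurable h)
    (I : Fin m ↪ Fin N) (h2 : MemLp (fun ω => h (fun k => X (I k) ω)) 2 P) :
    MemLp (fun ω => residual P X h I fun i => X i ω) 2 P := by
  refine (h2.sub (memLp_const _)).sub (memLp_finsetSum Finset.univ fun p _ => ?_)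
  exact (memLp_proj hX hind hh I p h2).sub (memLp_const (theta P X h I))

/-- The residual is orthogonal to every function whose arguments include at most one of the
variables of the residual. -/
theorem integral_mul_residual (hX : ∀ i, Measurable (X i)) (hind : iIndepFun X P)
    (hh : Measurable h) (I : Fin m ↪ Fin N) (h2 : MemLp (fun ω => h (fun k => X (I k) ω)) 2 P)
    {A : Set (Fin N)} {g : (Fin N → 𝓧) → ℝ} (hg : Measurable g) (hgA : DependsOn g A)
    (hg2 : MemLp (fun ω => g fun i => X i ω) 2 P)
    (hA : ∀ l l', I l ∈ A → I l' ∈ A → l = l') :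
    ∫ ω, g (fun i => X i ω) * residual P X h I (fun i => X i ω) ∂P = 0 := by
  have hgi := hg2.integrable one_le_two
  have hgh : Integrable (fun ω => g (fun i => X i ω) * h (fun l => X (I l) ω)) P :=
    hg2.integrable_mul h2
  have hgp : ∀ p, Integrable (fun ω => g (fun i => X i ω) * proj P X h I p (X (I p) ω)) P :=
    fun p => hg2.integrable_mul (memLp_proj hX hind hh I p h2)
  have hexp : ∫ ω, g (fun i => X i ω) * residual P X h I (fun i => X i ω) ∂P =
      (∫ ω, g (fun i => X i ω) * h (fun l => X (I l) ω) ∂P) -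
        (∫ ω, g (fun i => X i ω) ∂P) * theta P X h I -
        ∑ p, ((∫ ω, g (fun i => X i ω) * proj P X h I p (X (I p) ω) ∂P) -
          (∫ ω, g (fun i => X i ω) ∂P) * theta P X h I) := by
    have hgθ : Integrable (fun ω => g (fun i => X i ω) * theta P X h I) P := hgi.mul_const _
    have hgpθ : ∀ p ∈ Finset.univ, Integrable (fun ω => g (fun i => X i ω) *
        proj P X h I p (X (I p) ω) - g (fun i => X i ω) * theta P X h I) P :=
      fun p _ => (hgp p).sub hgθ
    simp only [residual, mul_sub, Finset.mul_sum]
    rw [integral_sub (f := fun ω => g (fun i => X i ω) * h (fun l => X (I l) ω) -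
      g (fun i => X i ω) * theta P X h I) (hgh.sub hgθ) (integrable_finsetSum _ hgpθ),
      integral_sub hgh hgθ, integral_mul_const, integral_finsetSum _ hgpθ]
    congr 1
    refine Finset.sum_congr rfl fun p _ => ?_
    rw [integral_sub (hgp p) (hgi.mul_const _), integral_mul_const]
  -- A projection on a variable outside `A` is uncorrelated with `g`, so its centred term drops out.
  have hout : ∀ p, I p ∉ A → ∫ ω, g (fun i => X i ω) * proj P X h I p (X (I p) ω) ∂P =
      (∫ ω, g (fun i => X i ω) ∂P) * theta P X h I := by
    intro p hp
    rw [integral_mul_of_dependsOn hX hind A (f := fun x => proj P X h I p (x (I p)))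
      ((measurable_proj hX hh I p).comp (measurable_pi_apply _)) hg hgA
      (fun x y hxy => by simp only [hxy (I p) hp]) (hgp p),
      integral_proj hX hind hh I p (h2.integrable one_le_two)]
  rw [hexp]
  -- If `I p ∈ A`, the `p`-th projection has the same integral against `g` as the kernel and cancels
  -- it. If `I` misses `A`, the kernel itself is uncorrelated with `g`.
  by_cases hex : ∃ p, I p ∈ A
  · obtain ⟨p, hp⟩ := hex
    rw [Finset.sum_eq_single p, integral_mul_proj hX hind hh hg hgA I p
      (fun l => ⟨fun hl => hA l p hl hp, fun e => e ▸ hp⟩) hgh]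
    · ring
    · intro q _ hq
      rw [hout q fun hqA => hq (hA q p hqA hp), sub_self]
    · simp
  · push Not at hex
    rw [Finset.sum_eq_zero fun q _ => by rw [hout q (hex q), sub_self],
      integral_mul_of_dependsOn hX hind A (f := fun x => h fun l => x (I l))
      (hh.comp (by fun_prop)) hg hgA
      (fun x y hxy => by
        simp only
        congr 1
        ext1 l
        exact hxy (I l) (hex l)) hgh]
    simp [theta]

theorem integral_residual (hX : ∀ i, Measurable (X i)) (hind : iIndepFun X P)
    (hh : Measurable h) (I : Fin m ↪ Fin N) (h2 : MemLp (fun ω => h (fun k => X (I k) ω)) 2 P) :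
    ∫ ω, residual P X h I (fun i => X i ω) ∂P = 0 := by
  have := integral_mul_residual hX hind hh I h2 (A := ∅) (g := fun _ => 1) measurable_const
    (fun _ _ _ => rfl) (memLp_const _) (by simp)
  simpa using this

theorem integral_apply_mul_residual (hX : ∀ i, Measurable (X i)) (hind : iIndepFun X P)
    (hh : Measurable h) (I : Fin m ↪ Fin N) (h2 : MemLp (fun ω => h (fun k => X (I k) ω)) 2 P)
    (j : Fin N) {f : 𝓧 → ℝ} (hf : Measurable f) (hf2 : MemLp (fun ω => f (X j ω)) 2 P) :
    ∫ ω, f (X j ω) * residual P X h I (fun i => X i ω) ∂P = 0 :=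
  integral_mul_residual hX hind hh I h2 (A := {j}) (g := fun x => f (x j))
    (hf.comp (measurable_pi_apply _)) (fun x y hxy => by simp only [hxy j rfl]) hf2
    (fun _ _ hl hl' => I.injective (hl.trans hl'.symm))

omit [IsProbabilityMeasure P] in
theorem integral_add_sq {f g : Ω → ℝ} (hf : MemLp f 2 P) (hg : MemLp g 2 P)
    (hfg : ∫ ω, f ω * g ω ∂P = 0) :
    ∫ ω, (f ω + g ω) ^ 2 ∂P = ∫ ω, f ω ^ 2 ∂P + ∫ ω, g ω ^ 2 ∂P := by
  have hi : Integrable (fun ω => f ω * g ω) P := hf.integrable_mul hg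
  have h1 : Integrable (fun ω => f ω ^ 2 + g ω ^ 2) P := hf.integrable_sq.add hg.integrable_sq
  have h2 : Integrable (fun ω => 2 * (f ω * g ω)) P := hi.const_mul 2
  have : ∀ ω, (f ω + g ω) ^ 2 = f ω ^ 2 + g ω ^ 2 + 2 * (f ω * g ω) := fun ω => by ring
  simp only [this]
  rw [integral_add h1 h2, integral_add hf.integrable_sq hg.integrable_sq, integral_const_mul, hfg]
  ring

/-- Pythagoras: the residual is orthogonal to the constant and to each projection, hence to the rest
of the kernel. -/
theorem integral_residual_sq_le (hX : ∀ i, Measurable (X i)) (hind : iIndepFun X P)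
    (hh : Measurable h) (I : Fin m ↪ Fin N) (h2 : MemLp (fun ω => h (fun k => X (I k) ω)) 2 P) :
    ∫ ω, residual P X h I (fun i => X i ω) ^ 2 ∂P ≤ ∫ ω, h (fun k => X (I k) ω) ^ 2 ∂P := by
  have hR2 := memLp_residual hX hind hh I h2
  have hp2 : ∀ p, MemLp (fun ω => proj P X h I p (X (I p) ω) - theta P X h I) 2 P :=
    fun p => (memLp_proj hX hind hh I p h2).sub (memLp_const (theta P X h I))
  have hs2 : MemLp (fun ω => ∑ p, (proj P X h I p (X (I p) ω) - theta P X h I)) 2 P :=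
    memLp_finsetSum Finset.univ fun p _ => hp2 p
  have hψ2 : MemLp (fun ω => theta P X h I +
      ∑ p, (proj P X h I p (X (I p) ω) - theta P X h I)) 2 P :=
    (memLp_const (theta P X h I)).add hs2
  have hpR : ∀ p ∈ Finset.univ, Integrable (fun ω => (proj P X h I p (X (I p) ω) -
      theta P X h I) * residual P X h I (fun i => X i ω)) P :=
    fun p _ => (hp2 p).integrable_mul hR2
  have hsR : Integrable (fun ω => ∑ p, (proj P X h I p (X (I p) ω) -
      theta P X h I) * residual P X h I (fun i => X i ω)) P := integrable_finsetSum _ hpR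
  have hcR : Integrable (fun ω => theta P X h I * residual P X h I (fun i => X i ω)) P :=
    (hR2.integrable one_le_two).const_mul _
  have horth : ∫ ω, (theta P X h I + ∑ p, (proj P X h I p (X (I p) ω) - theta P X h I)) *
      residual P X h I (fun i => X i ω) ∂P = 0 := by
    simp only [add_mul, Finset.sum_mul]
    rw [integral_add hcR hsR, integral_const_mul, integral_residual hX hind hh I h2,
      integral_finsetSum _ hpR, mul_zero, zero_add]
    exact Finset.sum_eq_zero fun p _ => integral_apply_mul_residual hX hind hh I h2 (I p)
      ((measurable_proj hX hh I p).sub_const _) (hp2 p)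
  have hsum : ∀ ω, h (fun k => X (I k) ω) = (theta P X h I +
      ∑ p, (proj P X h I p (X (I p) ω) - theta P X h I)) +
      residual P X h I (fun i => X i ω) := by
    intro ω
    simp only [residual]
    ring
  have hsq := integral_add_sq hψ2 hR2 horth
  simp only [← hsum] at hsq
  rw [hsq]
  exact le_add_of_nonneg_left (integral_nonneg fun ω => sq_nonneg _)

end Hajek

/-! ### Second moments of weighted sums -/

section SecondMoments

variable {Ω : Type*} [MeasurableSpace Ω] {P : Measure Ω}

theorem integral_sum_mul_sum {ι κ : Type*} (s : Finset ι) (t : Finset κ) (c : ι → ℝ) (d : κ → ℝ)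
    {f : ι → Ω → ℝ} {g : κ → Ω → ℝ} (hf : ∀ i ∈ s, MemLp (f i) 2 P) (hg : ∀ j ∈ t, MemLp (g j) 2 P) :
    ∫ ω, (∑ i ∈ s, c i * f i ω) * (∑ j ∈ t, d j * g j ω) ∂P =
      ∑ i ∈ s, ∑ j ∈ t, c i * d j * ∫ ω, f i ω * g j ω ∂P := by
  have hi : ∀ i ∈ s, ∀ j ∈ t, Integrable (fun ω => c i * d j * (f i ω * g j ω)) P :=
    fun i hi j hj => ((hf i hi).integrable_mul (hg j hj)).const_mul _
  have hii : ∀ i ∈ s, Integrable (fun ω => ∑ j ∈ t, c i * d j * (f i ω * g j ω)) P :=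
    fun i his => integrable_finsetSum _ (hi i his)
  have : ∀ ω, (∑ i ∈ s, c i * f i ω) * (∑ j ∈ t, d j * g j ω) =
      ∑ i ∈ s, ∑ j ∈ t, c i * d j * (f i ω * g j ω) := by
    intro ω
    rw [Finset.sum_mul_sum]
    exact Finset.sum_congr rfl fun i _ => Finset.sum_congr rfl fun j _ => by ring
  simp only [this]
  rw [integral_finsetSum _ hii]
  refine Finset.sum_congr rfl fun i his => ?_
  rw [integral_finsetSum _ (hi i his)]
  exact Finset.sum_congr rfl fun j _ => integral_const_mul _ _

theorem integral_sum_sq {ι : Type*} (s : Finset ι) (c : ι → ℝ)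
    {f : ι → Ω → ℝ} (hf : ∀ i ∈ s, MemLp (f i) 2 P) :
    ∫ ω, (∑ i ∈ s, c i * f i ω) ^ 2 ∂P =
      ∑ i ∈ s, ∑ j ∈ s, c i * c j * ∫ ω, f i ω * f j ω ∂P := by
  simp only [pow_two]
  exact integral_sum_mul_sum s s c c hf hf

theorem abs_integral_mul_le {f g : Ω → ℝ} (hf : MemLp f 2 P) (hg : MemLp g 2 P) {K : ℝ}
    (hfK : ∫ ω, f ω ^ 2 ∂P ≤ K) (hgK : ∫ ω, g ω ^ 2 ∂P ≤ K) : |∫ ω, f ω * g ω ∂P| ≤ K := by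
  have h1 : Integrable (fun ω => 2⁻¹ * (f ω ^ 2 + g ω ^ 2)) P :=
    (hf.integrable_sq.add hg.integrable_sq).const_mul _
  calc |∫ ω, f ω * g ω ∂P| ≤ ∫ ω, |f ω * g ω| ∂P := abs_integral_le_integral_abs
    _ ≤ ∫ ω, 2⁻¹ * (f ω ^ 2 + g ω ^ 2) ∂P := by
        refine integral_mono (hf.integrable_mul hg).abs h1 fun ω => ?_
        simp only [abs_mul]
        nlinarith [sq_nonneg (|f ω| - |g ω|), sq_abs (f ω), sq_abs (g ω)]
    _ = 2⁻¹ * (∫ ω, f ω ^ 2 ∂P + ∫ ω, g ω ^ 2 ∂P) := by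
        rw [integral_const_mul, integral_add hf.integrable_sq hg.integrable_sq]
    _ ≤ K := by linarith

end SecondMoments

/-! ### Variance decomposition of the U-statistic -/

section Hajek

variable {𝓧 : Type*} [MeasurableSpace 𝓧] {m N : ℕ} {Ω : Type*} [MeasurableSpace Ω]
  {P : Measure Ω} [IsProbabilityMeasure P] {X : Fin N → Ω → 𝓧} {h : (Fin m → 𝓧) → ℝ}
  {a : (Fin m → Fin N) → ℝ}

theorem measurable_hOne (hX : ∀ i, Measurable (X i)) (hh : Measurable h) (i : Fin N) :
    Measurable (hOne P X a h i) := by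
  refine Measurable.const_mul (Finset.measurable_sum _ fun l _ =>
    Finset.measurable_sum _ fun I _ => ?_) _
  exact ((measurable_proj hX hh I l).sub_const _).const_mul _

theorem memLp_hOne (hX : ∀ i, Measurable (X i)) (hind : iIndepFun X P) (hh : Measurable h)
    (h2 : ∀ I : Fin m ↪ Fin N, MemLp (fun ω => h (fun k => X (I k) ω)) 2 P) (i : Fin N) :
    MemLp (fun ω => hOne P X a h i (X i ω)) 2 P := by
  have hi : ∀ l, ∀ I ∈ Finset.univ.filter (fun I : Fin m ↪ Fin N => I l = i),
      MemLp (fun ω => a I * (proj P X h I l (X i ω) - theta P X h I)) 2 P := by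
    intro l I hI
    obtain rfl := (Finset.mem_filter.1 hI).2
    exact ((memLp_proj hX hind hh I l (h2 I)).sub (memLp_const (theta P X h I))).const_mul _
  have hii : MemLp (fun ω => ∑ l, ∑ I ∈ Finset.univ.filter (fun I : Fin m ↪ Fin N => I l = i),
      a I * (proj P X h I l (X i ω) - theta P X h I)) 2 P :=
    memLp_finsetSum _ fun l _ => memLp_finsetSum _ (hi l)
  exact hii.const_mul _

theorem integral_hOne (hX : ∀ i, Measurable (X i)) (hind : iIndepFun X P) (hh : Measurable h)
    (h2 : ∀ I : Fin m ↪ Fin N, MemLp (fun ω => h (fun k => X (I k) ω)) 2 P) (i : Fin N) :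
    ∫ ω, hOne P X a h i (X i ω) ∂P = 0 := by
  have hi : ∀ l, ∀ I ∈ Finset.univ.filter (fun I : Fin m ↪ Fin N => I l = i),
      Integrable (fun ω => a I * (proj P X h I l (X i ω) - theta P X h I)) P := by
    intro l I hI
    obtain rfl := (Finset.mem_filter.1 hI).2
    exact (((memLp_proj hX hind hh I l (h2 I)).integrable one_le_two).sub
      (integrable_const (theta P X h I))).const_mul _
  have hii : ∀ l ∈ Finset.univ, Integrable (fun ω => ∑ I ∈ Finset.univ.filter
      (fun I : Fin m ↪ Fin N => I l = i), a I * (proj P X h I l (X i ω) - theta P X h I)) P :=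
    fun l _ => integrable_finsetSum _ (hi l)
  simp only [hOne]
  rw [integral_const_mul, integral_finsetSum _ hii, Finset.sum_eq_zero, mul_zero]
  intro l _
  rw [integral_finsetSum _ (hi l)]
  refine Finset.sum_eq_zero fun I hI => ?_
  obtain rfl := (Finset.mem_filter.1 hI).2
  rw [integral_const_mul, integral_sub ((memLp_proj hX hind hh I l (h2 I)).integrable one_le_two)
    (integrable_const _), integral_proj hX hind hh I l ((h2 I).integrable one_le_two)]
  simp

theorem mainVar_eq_integral (hX : ∀ i, Measurable (X i)) (hind : iIndepFun X P) (hh : Measurable h)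
    (h2 : ∀ I : Fin m ↪ Fin N, MemLp (fun ω => h (fun k => X (I k) ω)) 2 P) :
    mainVar P X a h = ∫ ω, ((N : ℝ)⁻¹ * ∑ i, hOne P X a h i (X i ω)) ^ 2 ∂P := by
  have hm : MemLp (fun ω => (N : ℝ)⁻¹ * ∑ i, hOne P X a h i (X i ω)) 2 P :=
    (memLp_finsetSum _ fun i _ => memLp_hOne hX hind hh h2 i).const_mul _
  rw [mainVar, variance_of_integral_eq_zero hm.aestronglyMeasurable.aemeasurable]
  rw [integral_const_mul, integral_finsetSum _ fun i _ =>
    (memLp_hOne hX hind hh h2 i).integrable one_le_two,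
    Finset.sum_eq_zero fun i _ => integral_hOne hX hind hh h2 i, mul_zero]

/-- The terms `hOne i (X i)` are centred and independent, so their second moments add. -/
theorem mainVar_eq_sum (hX : ∀ i, Measurable (X i)) (hind : iIndepFun X P) (hh : Measurable h)
    (h2 : ∀ I : Fin m ↪ Fin N, MemLp (fun ω => h (fun k => X (I k) ω)) 2 P) :
    mainVar P X a h = ((N : ℝ) ^ 2)⁻¹ * ∑ i, ∫ ω, hOne P X a h i (X i ω) ^ 2 ∂P := by
  rw [mainVar, variance_const_mul, inv_pow]
  congr 1
  have := IndepFun.variance_sum (μ := P) (X := fun i ω => hOne P X a h i (X i ω))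
    (s := Finset.univ) (fun i _ => memLp_hOne hX hind hh h2 i)
    (fun i _ j _ hij => (hind.indepFun hij).comp (measurable_hOne hX hh i)
      (measurable_hOne hX hh j))
  rw [show (∑ i, fun ω => hOne P X a h i (X i ω)) = fun ω => ∑ i, hOne P X a h i (X i ω) by
    ext ω; simp] at this
  rw [this]
  refine Finset.sum_congr rfl fun i _ => ?_
  exact variance_of_integral_eq_zero
    (memLp_hOne hX hind hh h2 i).aestronglyMeasurable.aemeasurable (integral_hOne hX hind hh h2 i)

theorem inv_mul_factorial_div (hN : 0 < N) :
    (N : ℝ)⁻¹ * (((N - m)! : ℝ) / ((N - 1)! : ℝ)) = ((N - m)! : ℝ) / (N ! : ℝ) := by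
  obtain ⟨n, rfl⟩ : ∃ n, N = n + 1 := ⟨N - 1, by omega⟩
  rw [Nat.factorial_succ, Nat.add_sub_cancel]
  push_cast
  field_simp

-- For each position `l`, summing over `i` and over the tuples with `I l = i` runs through every
-- tuple once.
omit [IsProbabilityMeasure P] in
theorem mean_hOne_eq (hN : 0 < N) (x : Fin N → 𝓧) :
    (N : ℝ)⁻¹ * ∑ i, hOne P X a h i (x i) = ((N - m)! : ℝ) / (N ! : ℝ) *
      ∑ I : Fin m ↪ Fin N, a I * ∑ p, (proj P X h I p (x (I p)) - theta P X h I) := by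
  simp only [hOne]
  rw [← Finset.mul_sum, ← mul_assoc, inv_mul_factorial_div hN, Finset.sum_comm]
  have hd : ∀ I : Fin m ↪ Fin N, a I * ∑ p, (proj P X h I p (x (I p)) - theta P X h I) =
      ∑ p, a I * (proj P X h I p (x (I p)) - theta P X h I) := fun I => Finset.mul_sum _ _ _
  simp only [hd]
  rw [Finset.sum_comm (s := Finset.univ (α := Fin m ↪ Fin N))]
  congr 1
  refine Finset.sum_congr rfl fun l _ => ?_
  rw [← Finset.sum_fiberwise Finset.univ (fun I : Fin m ↪ Fin N => I l)]
  refine Finset.sum_congr rfl fun i _ => Finset.sum_congr rfl fun I hI => ?_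
  rw [(Finset.mem_filter.1 hI).2]

omit [IsProbabilityMeasure P] in
/-- The Hájek decomposition of the U-statistic. -/
theorem uStat_eq (hN : 0 < N) (x : Fin N → 𝓧) :
    uStat a h x = ((N - m)! : ℝ) / (N ! : ℝ) * ∑ I : Fin m ↪ Fin N, a I * theta P X h I +
      ((N : ℝ)⁻¹ * ∑ i, hOne P X a h i (x i) +
      ∑ I : Fin m ↪ Fin N, (((N - m)! : ℝ) / (N ! : ℝ) * a I) * residual P X h I x) := by
  rw [mean_hOne_eq hN, uStat]
  simp only [mul_assoc]
  rw [← Finset.mul_sum, ← mul_add, ← mul_add, ← Finset.sum_add_distrib, ← Finset.sum_add_distrib]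
  congr 1
  refine Finset.sum_congr rfl fun I _ => ?_
  rw [residual]
  ring

theorem uVar_eq_add (hN : 0 < N) (hX : ∀ i, Measurable (X i)) (hind : iIndepFun X P)
    (hh : Measurable h)
    (h2 : ∀ I : Fin m ↪ Fin N, MemLp (fun ω => h (fun k => X (I k) ω)) 2 P) :
    uVar P X a h = mainVar P X a h + ∫ ω, (∑ I : Fin m ↪ Fin N,
      (((N - m)! : ℝ) / (N ! : ℝ) * a I) * residual P X h I (fun i => X i ω)) ^ 2 ∂P := by
  have hL : MemLp (fun ω => (N : ℝ)⁻¹ * ∑ i, hOne P X a h i (X i ω)) 2 P :=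
    (memLp_finsetSum _ fun i _ => memLp_hOne hX hind hh h2 i).const_mul _
  have hQ : MemLp (fun ω => ∑ I : Fin m ↪ Fin N,
      (((N - m)! : ℝ) / (N ! : ℝ) * a I) * residual P X h I (fun i => X i ω)) 2 P :=
    memLp_finsetSum _ fun I _ => (memLp_residual hX hind hh I (h2 I)).const_mul _
  have horth : ∫ ω, ((N : ℝ)⁻¹ * ∑ i, hOne P X a h i (X i ω)) * (∑ I : Fin m ↪ Fin N,
      (((N - m)! : ℝ) / (N ! : ℝ) * a I) * residual P X h I (fun i => X i ω)) ∂P = 0 := by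
    have := integral_sum_mul_sum (P := P) Finset.univ Finset.univ (fun _ : Fin N => (N : ℝ)⁻¹)
      (fun I : Fin m ↪ Fin N => ((N - m)! : ℝ) / (N ! : ℝ) * a I)
      (fun i _ => memLp_hOne (a := a) hX hind hh h2 i)
      (fun I _ => memLp_residual hX hind hh I (h2 I))
    simp only [← Finset.mul_sum Finset.univ _ (N : ℝ)⁻¹] at this
    rw [this]
    refine Finset.sum_eq_zero fun i _ => Finset.sum_eq_zero fun I _ => ?_
    rw [integral_apply_mul_residual hX hind hh I (h2 I) i (measurable_hOne hX hh i)
      (memLp_hOne hX hind hh h2 i), mul_zero]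
  have hmean : ∫ ω, ((N : ℝ)⁻¹ * ∑ i, hOne P X a h i (X i ω) + ∑ I : Fin m ↪ Fin N,
      (((N - m)! : ℝ) / (N ! : ℝ) * a I) * residual P X h I (fun i => X i ω)) ∂P = 0 := by
    rw [integral_add (hL.integrable one_le_two) (hQ.integrable one_le_two), integral_const_mul,
      integral_finsetSum _ fun i _ => (memLp_hOne hX hind hh h2 i).integrable one_le_two,
      Finset.sum_eq_zero fun i _ => integral_hOne hX hind hh h2 i,
      integral_finsetSum _ fun I _ =>
        ((memLp_residual hX hind hh I (h2 I)).integrable one_le_two).const_mul _,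
      Finset.sum_eq_zero fun I _ => by
        rw [integral_const_mul, integral_residual hX hind hh I (h2 I), mul_zero]]
    simp
  have hLQ : MemLp (fun ω => (N : ℝ)⁻¹ * ∑ i, hOne P X a h i (X i ω) + ∑ I : Fin m ↪ Fin N,
      (((N - m)! : ℝ) / (N ! : ℝ) * a I) * residual P X h I (fun i => X i ω)) 2 P := hL.add hQ
  rw [uVar, funext fun ω => uStat_eq (P := P) (X := X) hN fun k => X k ω,
    variance_const_add hLQ.aestronglyMeasurable,
    variance_of_integral_eq_zero hLQ.aestronglyMeasurable.aemeasurable hmean,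
    integral_add_sq hL hQ horth, mainVar_eq_integral hX hind hh h2]

theorem mainVar_le_uVar (hN : 0 < N) (hX : ∀ i, Measurable (X i)) (hind : iIndepFun X P)
    (hh : Measurable h)
    (h2 : ∀ I : Fin m ↪ Fin N, MemLp (fun ω => h (fun k => X (I k) ω)) 2 P) :
    mainVar P X a h ≤ uVar P X a h := by
  rw [uVar_eq_add hN hX hind hh h2]
  exact le_add_of_nonneg_right (integral_nonneg fun ω => sq_nonneg _)

theorem mem_commonIndices_pair {I J : Fin m ↪ Fin N} {x : Fin N} :
    x ∈ commonIndices ![I, J] ↔ (∃ l, I l = x) ∧ ∃ l, J l = x := by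
  simp [commonIndices, Fin.forall_fin_two]

/-- Residuals of tuples with at most one common index are uncorrelated, so in the expanded square
only pairs with two common indices survive, each bounded by `K`. -/
theorem uVar_le (hN : 0 < N) (hX : ∀ i, Measurable (X i)) (hind : iIndepFun X P)
    (hh : Measurable h)
    (h2 : ∀ I : Fin m ↪ Fin N, MemLp (fun ω => h (fun k => X (I k) ω)) 2 P) {K : ℝ}
    (hK : ∀ I : Fin m ↪ Fin N, ∫ ω, h (fun k => X (I k) ω) ^ 2 ∂P ≤ K) :
    uVar P X a h ≤ mainVar P X a h + (((N - m)! : ℝ) / (N ! : ℝ)) ^ 2 *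
      (∑ I ∈ sharingTuples m N 2 2, |∏ k, a (I k)|) * K := by
  rw [uVar_eq_add hN hX hind hh h2, integral_sum_sq _ _ fun I _ =>
    memLp_residual hX hind hh I (h2 I)]
  gcongr
  have hpair : ∀ I J : Fin m ↪ Fin N,
      (((N - m)! : ℝ) / (N ! : ℝ) * a I) * (((N - m)! : ℝ) / (N ! : ℝ) * a J) *
        ∫ ω, residual P X h I (fun i => X i ω) * residual P X h J (fun i => X i ω) ∂P ≤
      (((N - m)! : ℝ) / (N ! : ℝ)) ^ 2 *
        (if ![I, J] ∈ sharingTuples m N 2 2 then |a I * a J| * K else 0) := by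
    intro I J
    split_ifs with hIJ
    · have := abs_integral_mul_le (memLp_residual hX hind hh I (h2 I))
        (memLp_residual hX hind hh J (h2 J))
        ((integral_residual_sq_le hX hind hh I (h2 I)).trans (hK I))
        ((integral_residual_sq_le hX hind hh J (h2 J)).trans (hK J))
      rw [show ∀ w x y z : ℝ, w * x * (w * y) * z = w ^ 2 * (x * y * z) by intros; ring]
      refine mul_le_mul_of_nonneg_left ?_ (sq_nonneg _)
      refine (le_abs_self _).trans ?_
      rw [abs_mul]
      exact mul_le_mul_of_nonneg_left this (abs_nonneg _)
    · rw [integral_mul_residual hX hind hh J (h2 J) (measurable_residual hX hh I)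
        (dependsOn_residual I) (memLp_residual hX hind hh I (h2 I))]
      · simp
      -- Two different positions of `J` whose indices occur in `I` would give two common indices.
      · rintro l l' ⟨k, hk⟩ ⟨k', hk'⟩
        by_contra hne
        refine hIJ (Finset.mem_filter.2 ⟨Finset.mem_univ _, ?_⟩)
        refine Finset.one_lt_card.2 ⟨J l, mem_commonIndices_pair.2 ⟨⟨k, hk⟩, ⟨l, rfl⟩⟩, J l',
          mem_commonIndices_pair.2 ⟨⟨k', hk'⟩, ⟨l', rfl⟩⟩, fun e => hne (J.injective e)⟩
  refine (Finset.sum_le_sum fun I _ => Finset.sum_le_sum fun J _ => hpair I J).trans_eq ?_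
  simp only [← Finset.mul_sum]
  rw [mul_assoc, Finset.sum_mul, ← Finset.sum_product', Finset.univ_product_univ,
    ← (finTwoArrowEquiv (Fin m ↪ Fin N)).sum_comp, ← Finset.sum_filter]
  congr 1
  have hid : ∀ I : Fin 2 → (Fin m ↪ Fin N), ![I 0, I 1] = I := by
    intro I; ext k : 1; fin_cases k <;> rfl
  refine Finset.sum_congr ?_ fun I _ => ?_
  · ext I
    simp [hid]
  · simp [Fin.prod_univ_two]

end Hajek

/-! ### Uniform resampling indices -/

section Uniform

theorem integral_uniformOn_univ {α : Type*} [Fintype α] [Nonempty α] [MeasurableSpace α]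
    [MeasurableSingletonClass α] (f : α → ℝ) :
    ∫ x, f x ∂(uniformOn (Set.univ : Set α)) = (Fintype.card α : ℝ)⁻¹ * ∑ x, f x := by
  rw [integral_fintype (Integrable.of_finite), Finset.mul_sum]
  refine Finset.sum_congr rfl fun x _ => ?_
  rw [smul_eq_mul, Measure.real, uniformOn_univ]
  simp

/-- Uniformity on all maps means independent uniform coordinates, so the bootstrap indices form an
independent sample. -/
theorem uniformOn_univ_pi {ι : Type*} [Fintype ι] {N : ℕ} [NeZero N] :
    (uniformOn Set.univ : Measure (ι → Fin N)) = Measure.pi fun _ => uniformOn Set.univ := by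
  classical
  refine Measure.ext_of_singleton fun f => ?_
  rw [Measure.pi_singleton, uniformOn_univ]
  simp [uniformOn_univ, ENNReal.inv_pow]

end Uniform

/-! ### The bootstrap variance as the variance of a U-statistic -/

section Bootstrap

variable {𝓧 : Type*} {m N : ℕ}

/-- The average of `h(x_{k_1}, …, x_{k_m})` over all index tuples, repetitions allowed. -/
noncomputable def tupleAvg (h : (Fin m → 𝓧) → ℝ) (x : Fin N → 𝓧) : ℝ :=
  ((N : ℝ) ^ m)⁻¹ * ∑ k : Fin m → Fin N, h fun l => x (k l)

/-- The average of `h(x_{k_1}, …, x_{k_m})` over all index tuples with `k_l = j`. -/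
noncomputable def projAvg (h : (Fin m → 𝓧) → ℝ) (x : Fin N → 𝓧) (l : Fin m) (j : Fin N) : ℝ :=
  ((N : ℝ) ^ m)⁻¹ * ∑ k : Fin m → Fin N, h fun l' => x (Function.update k l j l')

/-- The first order expansion of the kernel under the bootstrap distribution. -/
noncomputable def bootOne (a : (Fin m → Fin N) → ℝ) (h : (Fin m → 𝓧) → ℝ) (x : Fin N → 𝓧)
    (i j : Fin N) : ℝ :=
  ((N - m)! : ℝ) / ((N - 1)! : ℝ) *
    ∑ l : Fin m, ∑ I ∈ Finset.univ.filter (fun I : Fin m ↪ Fin N => I l = i),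
      a I * (projAvg h x l j - tupleAvg h x)

/-- The bootstrap variance is the variance of its first order part plus a remainder that involves
only the pairs of tuples with two indices in common. -/
theorem bootVar_bounds (hN : 0 < N) (a : (Fin m → Fin N) → ℝ) (h : (Fin m → 𝓧) → ℝ)
    (x : Fin N → 𝓧) :
    ((N : ℝ) ^ 3)⁻¹ * ∑ i, ∑ j, bootOne a h x i j ^ 2 ≤ bootVar a h x ∧
    bootVar a h x ≤ ((N : ℝ) ^ 3)⁻¹ * ∑ i, ∑ j, bootOne a h x i j ^ 2 +
      (((N - m)! : ℝ) / (N ! : ℝ)) ^ 2 * (∑ I ∈ sharingTuples m N 2 2, |∏ k, a (I k)|) *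
        tupleAvg (fun y => h y ^ 2) x := by
  have : NeZero N := ⟨hN.ne'⟩
  -- With the data fixed, the resampled indices are an independent sample with values in `Fin N`,
  -- and the kernel is `h` read along `x`; the variance decomposition applies to them directly.
  set Q : Measure (Fin N → Fin N) := uniformOn Set.univ with hQ
  set Y : Fin N → (Fin N → Fin N) → Fin N := fun i J => J i with hY
  set H : (Fin m → Fin N) → ℝ := fun k => h fun l => x (k l) with hH
  have hYm : ∀ i, Measurable (Y i) := fun i => measurable_pi_apply i
  have hind : iIndepFun Y Q := by
    rw [hQ, uniformOn_univ_pi]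
    exact iIndepFun_pi (X := fun _ => id) fun i => aemeasurable_id
  have hHm : Measurable H := measurable_of_finite H
  have hlaw : ∀ i, Q.map (Y i) = uniformOn Set.univ := by
    intro i
    rw [hQ, uniformOn_univ_pi]
    exact (measurePreserving_eval _ i).map_eq
  have h2 : ∀ I : Fin m ↪ Fin N, MemLp (fun ω => H (fun k => Y (I k) ω)) 2 Q :=
    fun I => MemLp.of_discrete
  have hpi : ∀ (I : Fin m ↪ Fin N) (f : (Fin m → Fin N) → ℝ),
      ∫ y, f y ∂(Measure.pi fun k => Q.map (Y (I k))) = ((N : ℝ) ^ m)⁻¹ * ∑ k, f k := by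
    intro I f
    simp only [hlaw]
    rw [← uniformOn_univ_pi, integral_uniformOn_univ]
    simp
  have htuple : ∀ (I : Fin m ↪ Fin N) (f : (Fin m → Fin N) → ℝ),
      ∫ ω, f (fun k => Y (I k) ω) ∂Q = ((N : ℝ) ^ m)⁻¹ * ∑ k, f k := by
    intro I f
    rw [← integral_tuple hYm hind (measurable_of_finite f), hpi]
  have hone : ∀ i j, hOne Q Y a H i j = bootOne a h x i j := by
    intro i j
    simp only [hOne, bootOne, proj, theta, hpi, htuple]
    rfl
  have hmain : mainVar Q Y a H = ((N : ℝ) ^ 3)⁻¹ * ∑ i, ∑ j, bootOne a h x i j ^ 2 := by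
    -- Two powers of `N⁻¹` come from the normalization of `mainVar`, the third from the uniform law
    -- of a resampled index.
    rw [mainVar_eq_sum hYm hind hHm h2, pow_succ (N : ℝ) 2, mul_inv, mul_assoc]
    congr 1
    rw [Finset.mul_sum]
    refine Finset.sum_congr rfl fun i _ => ?_
    rw [← integral_map (f := fun j => hOne Q Y a H i j ^ 2) (hYm i).aemeasurable
      (measurable_of_finite _).aestronglyMeasurable, hlaw, integral_uniformOn_univ]
    simp [hone]
  have huvar : bootVar a h x = uVar Q Y a H := rfl
  rw [huvar, ← hmain]
  refine ⟨mainVar_le_uVar hN hYm hind hHm h2, uVar_le hN hYm hind hHm h2 fun I => ?_⟩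
  exact (htuple I fun k => H k ^ 2).le

end Bootstrap

/-! ### Counting tuples with common indices, and weight sums -/

section Counting

/-- Restriction to the complement of `B` is injective on `S`: every determined coordinate saves a
factor `card α`. -/
theorem card_le_of_determined {ι α : Type*} [Fintype ι] [DecidableEq ι] [Fintype α]
    [DecidableEq α] (S : Finset (ι → α)) (B : Finset ι)
    (hS : ∀ f ∈ S, ∀ g ∈ S, (∀ i ∉ B, f i = g i) → f = g) :
    S.card ≤ Fintype.card α ^ (Fintype.card ι - B.card) := by
  have h1 : S.card ≤ Fintype.card ({i // i ∉ B} → α) := by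
    rw [← Finset.card_univ]
    refine Finset.card_le_card_of_injOn (fun f i => f i.1) (fun _ _ => Finset.mem_univ _) ?_
    intro f hf g hg hfg
    exact hS f hf g hg fun i hi => congrFun hfg ⟨i, hi⟩
  refine h1.trans_eq ?_
  rw [Fintype.card_fun, Fintype.card_subtype_compl]
  simp

variable {m N : ℕ}

theorem card_tuples_le_of_determined {K : ℕ} (T : Finset (Fin K → (Fin m ↪ Fin N)))
    (B : Finset (Fin K × Fin m))
    (hT : ∀ I ∈ T, ∀ J ∈ T, (∀ t ∉ B, I t.1 t.2 = J t.1 t.2) → I = J) :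
    T.card ≤ N ^ (K * m - B.card) := by
  classical
  let e : (Fin K → (Fin m ↪ Fin N)) → (Fin K × Fin m → Fin N) := fun I t => I t.1 t.2
  have he : Function.Injective e := by
    intro I J hIJ
    ext k l : 2
    exact congrFun hIJ (k, l)
  rw [← Finset.card_image_of_injective T he]
  have := card_le_of_determined (T.image e) B ?_
  · simpa using this
  · intro f hf g hg hfg
    obtain ⟨I, hI, rfl⟩ := Finset.mem_image.1 hf
    obtain ⟨J, hJ, rfl⟩ := Finset.mem_image.1 hg
    rw [hT I hI J hJ hfg]

/-- Record in which position each tuple carries the common index. Once these positions are fixed,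
the entries there in the tuples `1, …, K` are determined by the entry in tuple `0`. -/
theorem card_sharingTuples_one_le {K : ℕ} :
    (sharingTuples m N (K + 1) 1).card ≤ m ^ (K + 1) * N ^ ((K + 1) * m - K) := by
  classical
  have hsub : sharingTuples m N (K + 1) 1 ⊆
      Finset.univ.biUnion fun p : Fin (K + 1) → Fin m =>
        Finset.univ.filter fun I : Fin (K + 1) → (Fin m ↪ Fin N) => ∀ k, I k (p k) = I 0 (p 0) := by
    intro I hI
    obtain ⟨x, hx⟩ := Finset.card_pos.1 (Finset.mem_filter.1 hI).2
    have hx' : ∀ k, ∃ l, I k l = x := (Finset.mem_filter.1 hx).2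
    choose p hp using hx'
    simp only [Finset.mem_biUnion, Finset.mem_univ, true_and, Finset.mem_filter]
    exact ⟨p, fun k => by rw [hp, hp]⟩
  refine (Finset.card_le_card hsub).trans (Finset.card_biUnion_le.trans ?_)
  refine (Finset.sum_le_card_nsmul _ _ (N ^ ((K + 1) * m - K)) fun p _ => ?_).trans_eq (by simp)
  have hB : ((Finset.univ.erase (0 : Fin (K + 1))).image fun k => (k, p k)).card = K := by
    rw [Finset.card_image_of_injective _ fun k k' h => (Prod.mk.inj h).1]
    simp
  refine (card_tuples_le_of_determined _ _ ?_).trans_eq (by rw [hB])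
  intro I hI J hJ hIJ
  have hI' := (Finset.mem_filter.1 hI).2
  have hJ' := (Finset.mem_filter.1 hJ).2
  have h0 : ∀ l, I 0 l = J 0 l := fun l => hIJ (0, l) (by simp)
  ext k l : 2
  by_cases hk : k = 0
  · rw [hk, h0]
  by_cases hl : l = p k
  · rw [hl, hI', hJ', h0]
  · exact hIJ (k, l) (by simp; exact fun _ h => hl h.symm)

/-- Four positions locate the two common indices in the two tuples; two distinct entries of the
second tuple are then determined by the first. -/
theorem card_sharingTuples_two_le :
    (sharingTuples m N 2 2).card ≤ m ^ 4 * N ^ (2 * m - 2) := by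
  classical
  have hsub : sharingTuples m N 2 2 ⊆
      Finset.univ.biUnion fun p : Fin 4 → Fin m =>
        Finset.univ.filter fun I : Fin 2 → (Fin m ↪ Fin N) =>
          p 1 ≠ p 3 ∧ I 0 (p 0) = I 1 (p 1) ∧ I 0 (p 2) = I 1 (p 3) := by
    intro I hI
    obtain ⟨x, hx, y, hy, hxy⟩ := Finset.one_lt_card.1 (Finset.mem_filter.1 hI).2
    have hx' : ∀ k, ∃ l, I k l = x := (Finset.mem_filter.1 hx).2
    have hy' : ∀ k, ∃ l, I k l = y := (Finset.mem_filter.1 hy).2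
    choose p hp using hx'
    choose q hq using hy'
    simp only [Finset.mem_biUnion, Finset.mem_univ, true_and, Finset.mem_filter]
    refine ⟨![p 0, p 1, q 0, q 1], fun h => hxy ?_, ?_, ?_⟩
    · simp at h
      rw [← hp 1, ← hq 1, h]
    · simp [hp]
    · simp [hq]
  refine (Finset.card_le_card hsub).trans (Finset.card_biUnion_le.trans ?_)
  refine (Finset.sum_le_card_nsmul _ _ (N ^ (2 * m - 2)) fun p _ => ?_).trans_eq (by simp)
  by_cases hp : p 1 = p 3
  · simp [hp]
  have hB : ({((1 : Fin 2), p 1), (1, p 3)} : Finset (Fin 2 × Fin m)).card = 2 :=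
    Finset.card_pair fun h => hp (Prod.mk.inj h).2
  refine (card_tuples_le_of_determined _ _ ?_).trans_eq (by rw [hB])
  intro I hI J hJ hIJ
  have hI' := (Finset.mem_filter.1 hI).2
  have hJ' := (Finset.mem_filter.1 hJ).2
  have h0 : ∀ l, I 0 l = J 0 l := fun l => hIJ (0, l) (by simp)
  ext k l : 2
  fin_cases k
  · exact h0 l
  · by_cases h1 : l = p 1
    · subst h1
      exact hI'.2.1.symm.trans ((h0 _).trans hJ'.2.1)
    by_cases h3 : l = p 3
    · subst h3
      exact hI'.2.2.symm.trans ((h0 _).trans hJ'.2.2)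
    · exact hIJ (1, l) (by simp [h1, h3])

/-- `(N - m)! / (N - 1)!`, the normalization of the first order kernels. -/
noncomputable def normFactor (m N : ℕ) : ℝ := ((N - m)! : ℝ) / ((N - 1)! : ℝ)

theorem normFactor_nonneg (m N : ℕ) : 0 ≤ normFactor m N := by
  unfold normFactor; positivity

/-- The normalization is the reciprocal of a falling factorial with `m - 1` factors, each at least
`N - m + 1 ≥ N / 2`. -/
theorem normFactor_mul_pow_le (hm : 1 ≤ m) (hN : 2 * m ≤ N) :
    normFactor m N * (N : ℝ) ^ (m - 1) ≤ 2 ^ (m - 1) := by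
  have h1 : (N - m)! * (N - 1).descFactorial (m - 1) = (N - 1)! := by
    have := Nat.factorial_mul_descFactorial (n := N - 1) (k := m - 1) (by omega)
    rwa [show N - 1 - (m - 1) = N - m by omega] at this
  have h2 : N ^ (m - 1) ≤ 2 ^ (m - 1) * (N - 1).descFactorial (m - 1) := by
    calc N ^ (m - 1) ≤ (2 * (N - 1 + 1 - (m - 1))) ^ (m - 1) :=
          Nat.pow_le_pow_left (by omega) _
      _ = 2 ^ (m - 1) * (N - 1 + 1 - (m - 1)) ^ (m - 1) := Nat.mul_pow _ _ _
      _ ≤ _ := Nat.mul_le_mul_left _ (Nat.pow_sub_le_descFactorial _ _)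
  have h1' : ((N - m)! : ℝ) * ((N - 1).descFactorial (m - 1) : ℝ) = ((N - 1)! : ℝ) := by
    exact_mod_cast h1
  have h2' : (N : ℝ) ^ (m - 1) ≤ 2 ^ (m - 1) * ((N - 1).descFactorial (m - 1) : ℝ) := by
    exact_mod_cast h2
  have hpos : (0 : ℝ) < ((N - 1)! : ℝ) := by positivity
  rw [normFactor, div_mul_eq_mul_div, div_le_iff₀ hpos, ← h1']
  calc ((N - m)! : ℝ) * (N : ℝ) ^ (m - 1)
      ≤ ((N - m)! : ℝ) * (2 ^ (m - 1) * ((N - 1).descFactorial (m - 1) : ℝ)) := by gcongr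
    _ = _ := by ring

/-- The normalized sum of the products of `K` weights that share `q` indices. -/
noncomputable def sharedWeight (a : (Fin m → Fin N) → ℝ) (K q : ℕ) : ℝ :=
  normFactor m N ^ K * ∑ I ∈ sharingTuples m N K q, |∏ k, a (I k)|

theorem sharedWeight_nonneg (a : (Fin m → Fin N) → ℝ) (K q : ℕ) : 0 ≤ sharedWeight a K q :=
  mul_nonneg (pow_nonneg (normFactor_nonneg _ _) _) (Finset.sum_nonneg fun _ _ => abs_nonneg _)

theorem avgWeight_nonneg (a : (Fin m → Fin N) → ℝ) (K q : ℕ) : 0 ≤ avgWeight a K q :=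
  mul_nonneg (by positivity) (Finset.sum_nonneg fun _ _ => abs_nonneg _)

theorem card_mul_avgWeight (a : (Fin m → Fin N) → ℝ) (K q : ℕ) :
    ((sharingTuples m N K q).card : ℝ) * avgWeight a K q =
      ∑ I ∈ sharingTuples m N K q, |∏ k, a (I k)| := by
  rw [avgWeight, ← mul_assoc]
  by_cases h : (sharingTuples m N K q).card = 0
  -- Without any sharing tuples the average is `0⁻¹ * 0`, and both sides vanish.
  · rw [Finset.card_eq_zero.1 h]; simp
  · rw [mul_inv_cancel₀ (by exact_mod_cast h), one_mul]

theorem sharedWeight_two_le_one (a : (Fin m → Fin N) → ℝ) (K : ℕ) :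
    sharedWeight a K 2 ≤ sharedWeight a K 1 := by
  refine mul_le_mul_of_nonneg_left ?_ (pow_nonneg (normFactor_nonneg _ _) _)
  refine Finset.sum_le_sum_of_subset_of_nonneg (fun I hI => ?_) fun _ _ _ => abs_nonneg _
  have := (Finset.mem_filter.1 hI).2
  exact Finset.mem_filter.2 ⟨Finset.mem_univ _, by omega⟩

/-- The `K + 1` normalizations cancel all but one power of `N` in the count. -/
theorem sharedWeight_one_le (hm : 1 ≤ m) (hN : 2 * m ≤ N) (a : (Fin m → Fin N) → ℝ) (K : ℕ) :
    sharedWeight a (K + 1) 1 ≤ (2 ^ (m - 1) * m) ^ (K + 1) * N * avgWeight a (K + 1) 1 := by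
  rw [sharedWeight, ← card_mul_avgWeight, ← mul_assoc]
  refine mul_le_mul_of_nonneg_right ?_ (avgWeight_nonneg _ _ _)
  have hc : ((sharingTuples m N (K + 1) 1).card : ℝ) ≤
      (m : ℝ) ^ (K + 1) * (N : ℝ) ^ ((K + 1) * m - K) := by
    exact_mod_cast card_sharingTuples_one_le
  have he : (K + 1) * m - K = (m - 1) * (K + 1) + 1 := by
    obtain ⟨m, rfl⟩ : ∃ k, m = k + 1 := ⟨m - 1, by omega⟩
    rw [Nat.add_sub_cancel]
    have : (K + 1) * (m + 1) = m * (K + 1) + 1 + K := by ring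
    omega
  calc normFactor m N ^ (K + 1) * ((sharingTuples m N (K + 1) 1).card : ℝ)
      ≤ normFactor m N ^ (K + 1) * ((m : ℝ) ^ (K + 1) * (N : ℝ) ^ ((K + 1) * m - K)) :=
        mul_le_mul_of_nonneg_left hc (pow_nonneg (normFactor_nonneg _ _) _)
    _ = (normFactor m N * (N : ℝ) ^ (m - 1)) ^ (K + 1) * (m : ℝ) ^ (K + 1) * N := by
        rw [he, pow_succ (N : ℝ), pow_mul]; ring
    _ ≤ (2 ^ (m - 1)) ^ (K + 1) * (m : ℝ) ^ (K + 1) * N := by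
        gcongr
        · exact mul_nonneg (normFactor_nonneg _ _) (by positivity)
        · exact normFactor_mul_pow_le hm hN
    _ = _ := by ring

/-- With a second common index, the two normalizations cancel every power of `N` in the count. -/
theorem sharedWeight_two_le (hm : 1 ≤ m) (hN : 2 * m ≤ N) (a : (Fin m → Fin N) → ℝ) :
    sharedWeight a 2 2 ≤ (2 ^ (m - 1)) ^ 2 * m ^ 4 * avgWeight a 2 2 := by
  rw [sharedWeight, ← card_mul_avgWeight, ← mul_assoc]
  refine mul_le_mul_of_nonneg_right ?_ (avgWeight_nonneg _ _ _)
  have hc : ((sharingTuples m N 2 2).card : ℝ) ≤ (m : ℝ) ^ 4 * (N : ℝ) ^ (2 * m - 2) := by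
    exact_mod_cast card_sharingTuples_two_le
  calc normFactor m N ^ 2 * ((sharingTuples m N 2 2).card : ℝ)
      ≤ normFactor m N ^ 2 * ((m : ℝ) ^ 4 * (N : ℝ) ^ (2 * m - 2)) :=
        mul_le_mul_of_nonneg_left hc (pow_nonneg (normFactor_nonneg _ _) _)
    _ = (normFactor m N * (N : ℝ) ^ (m - 1)) ^ 2 * (m : ℝ) ^ 4 := by
        rw [show 2 * m - 2 = (m - 1) * 2 by omega, pow_mul]; ring
    _ ≤ (2 ^ (m - 1)) ^ 2 * (m : ℝ) ^ 4 := by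
        gcongr
        · exact mul_nonneg (normFactor_nonneg _ _) (by positivity)
        · exact normFactor_mul_pow_le hm hN

/-- The coefficient of the pair `(l, I)` in the `i`-th first order kernel. -/
noncomputable def coef (a : (Fin m → Fin N) → ℝ) (i : Fin N) (t : Fin m × (Fin m ↪ Fin N)) : ℝ :=
  if t.2 t.1 = i then normFactor m N * a t.2 else 0

/-- Writes `hOne` and `bootOne` as linear forms with the same coefficients, so that they can be
compared term by term. -/
theorem sum_coef_mul (a : (Fin m → Fin N) → ℝ) (i : Fin N) (Z : Fin m → (Fin m ↪ Fin N) → ℝ) :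
    normFactor m N * ∑ l : Fin m, ∑ I ∈ Finset.univ.filter (fun I : Fin m ↪ Fin N => I l = i),
      a I * Z l I = ∑ t : Fin m × (Fin m ↪ Fin N), coef a i t * Z t.1 t.2 := by
  rw [Fintype.sum_prod_type, Finset.mul_sum]
  refine Finset.sum_congr rfl fun l _ => ?_
  rw [Finset.sum_filter, Finset.mul_sum]
  refine Finset.sum_congr rfl fun I _ => ?_
  simp only [coef]
  split_ifs
  · ring
  · simp

/-- The total absolute weight of the `i`-th first order kernel. -/
noncomputable def totalWeight (a : (Fin m → Fin N) → ℝ) (i : Fin N) : ℝ := ∑ t, |coef a i t|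

theorem totalWeight_nonneg (a : (Fin m → Fin N) → ℝ) (i : Fin N) : 0 ≤ totalWeight a i :=
  Finset.sum_nonneg fun _ _ => abs_nonneg _

/-- Expand the power: a product of coefficients vanishes unless each tuple carries `i` in its chosen
position, so the tuples share `i`. Given the positions, a family of tuples contributes for at most
one `i`, and there are `m ^ (K + 1)` choices of positions. -/
theorem sum_totalWeight_pow_le (a : (Fin m → Fin N) → ℝ) (K : ℕ) :
    ∑ i, totalWeight a i ^ (K + 1) ≤ (m : ℝ) ^ (K + 1) * sharedWeight a (K + 1) 1 := by
  classical
  have key : ∀ (l : Fin (K + 1) → Fin m) (I : Fin (K + 1) → (Fin m ↪ Fin N)),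
      ∑ i, ∏ k, |coef a i (l k, I k)| ≤
        if I ∈ sharingTuples m N (K + 1) 1 then normFactor m N ^ (K + 1) * |∏ k, a (I k)| else 0 := by
    intro l I
    have hpt : ∀ i, ∏ k, |coef a i (l k, I k)| ≤ if i = I 0 (l 0) then
        (if I ∈ sharingTuples m N (K + 1) 1 then normFactor m N ^ (K + 1) * |∏ k, a (I k)| else 0)
        else 0 := by
      intro i
      by_cases hall : ∀ k, I k (l k) = i
      · have hS : I ∈ sharingTuples m N (K + 1) 1 := by
          refine Finset.mem_filter.2 ⟨Finset.mem_univ _, Finset.card_pos.2 ⟨i, ?_⟩⟩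
          exact Finset.mem_filter.2 ⟨Finset.mem_univ _, fun k => ⟨l k, hall k⟩⟩
        rw [if_pos (hall 0).symm, if_pos hS]
        simp [coef, hall, abs_mul, Finset.prod_mul_distrib, Finset.abs_prod,
          abs_of_nonneg (normFactor_nonneg m N)]
      · push Not at hall
        obtain ⟨k, hk⟩ := hall
        rw [Finset.prod_eq_zero (Finset.mem_univ k) (by simp [coef, hk])]
        split_ifs
        · exact mul_nonneg (pow_nonneg (normFactor_nonneg _ _) _) (abs_nonneg _)
        · exact le_rfl
        · exact le_rfl
    refine (Finset.sum_le_sum fun i _ => hpt i).trans_eq ?_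
    rw [Finset.sum_ite_eq' Finset.univ (I 0 (l 0))]
    simp
  simp only [totalWeight, Fintype.sum_pow]
  rw [Finset.sum_comm,
    ← (Equiv.arrowProdEquivProdArrow (Fin (K + 1)) (fun _ => Fin m) fun _ => Fin m ↪ Fin N).symm.sum_comp,
    Fintype.sum_prod_type]
  refine (Finset.sum_le_sum fun l _ => Finset.sum_le_sum fun I _ => key l I).trans_eq ?_
  rw [Finset.sum_const, ← Finset.sum_filter, ← Finset.mul_sum, sharedWeight]
  simp

end Counting

/-! ### Averages over index maps in general position -/

section Generic

variable {m N : ℕ}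

/-- A union bound over coincidences of two entries and over hits of `F`; each such event fixes one
entry and so costs one power of `N`. -/
theorem card_not_generic_le {ι : Type*} [Fintype ι] [DecidableEq ι] (F : Finset (Fin N)) :
    (Finset.univ.filter fun κ : ι → Fin N =>
      ¬ (Function.Injective κ ∧ ∀ a, κ a ∉ F)).card * N ≤
      (Fintype.card ι ^ 2 + Fintype.card ι * F.card) * N ^ Fintype.card ι := by
  classical
  set S1 : Finset (ι → Fin N) := (Finset.univ.filter fun p : ι × ι => p.1 ≠ p.2).biUnion
    fun p => Finset.univ.filter fun κ => κ p.1 = κ p.2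
  set S2 : Finset (ι → Fin N) := (Finset.univ ×ˢ F).biUnion
    fun p : ι × Fin N => Finset.univ.filter fun κ => κ p.1 = p.2
  have hsub : (Finset.univ.filter fun κ : ι → Fin N =>
      ¬ (Function.Injective κ ∧ ∀ a, κ a ∉ F)) ⊆ S1 ∪ S2 := by
    intro κ hκ
    have := (Finset.mem_filter.1 hκ).2
    simp only [S1, S2, Finset.mem_union, Finset.mem_biUnion, Finset.mem_filter, Finset.mem_univ,
      true_and, Finset.mem_product, Prod.exists]
    by_cases hinj : Function.Injective κ
    · right
      push Not at this
      obtain ⟨a, ha⟩ := this hinj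
      exact ⟨a, κ a, ha, rfl⟩
    · left
      simp only [Function.Injective] at hinj
      push Not at hinj
      obtain ⟨x, y, hxy, hne⟩ := hinj
      exact ⟨x, y, hne, hxy⟩
  have h1 : S1.card ≤ Fintype.card ι ^ 2 * N ^ (Fintype.card ι - 1) := by
    refine Finset.card_biUnion_le.trans ?_
    refine (Finset.sum_le_card_nsmul _ _ (N ^ (Fintype.card ι - 1)) fun p hp => ?_).trans ?_
    · have hne := (Finset.mem_filter.1 hp).2
      have := card_le_of_determined (Finset.univ.filter fun κ : ι → Fin N => κ p.1 = κ p.2) {p.2} ?_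
      · simpa using this
      · intro f hf g hg hfg
        have h1 : f p.1 = g p.1 := hfg p.1 (by simpa using hne)
        ext1 x
        by_cases hx : x = p.2
        · rw [hx, ← (Finset.mem_filter.1 hf).2, ← (Finset.mem_filter.1 hg).2, h1]
        · exact hfg x (by simpa using hx)
    · rw [smul_eq_mul]
      refine Nat.mul_le_mul_right _ ((Finset.card_filter_le _ _).trans_eq ?_)
      simp [pow_two]
  have h2 : S2.card ≤ Fintype.card ι * F.card * N ^ (Fintype.card ι - 1) := by
    refine Finset.card_biUnion_le.trans ?_
    refine (Finset.sum_le_card_nsmul _ _ (N ^ (Fintype.card ι - 1)) fun p hp => ?_).trans ?_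
    · have := card_le_of_determined (Finset.univ.filter fun κ : ι → Fin N => κ p.1 = p.2) {p.1} ?_
      · simpa using this
      · intro f hf g hg hfg
        ext1 x
        by_cases hx : x = p.1
        · rw [hx, (Finset.mem_filter.1 hf).2, (Finset.mem_filter.1 hg).2]
        · exact hfg x (by simpa using hx)
    · rw [smul_eq_mul, Finset.card_product, Finset.card_univ]
  have hcard := (Finset.card_le_card hsub).trans (Finset.card_union_le S1 S2)
  rcases Nat.eq_zero_or_pos (Fintype.card ι) with h0 | hpos
  · rw [h0] at h1 h2
    have : (Finset.univ.filter fun κ : ι → Fin N =>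
      ¬ (Function.Injective κ ∧ ∀ a, κ a ∉ F)).card = 0 := by
      simp at h1 h2
      rw [h1, h2] at hcard
      simpa using hcard
    rw [this]; simp
  · have hpow : N ^ (Fintype.card ι - 1) * N = N ^ Fintype.card ι := by
      rw [← pow_succ]; congr 1; omega
    calc _ ≤ (Fintype.card ι ^ 2 * N ^ (Fintype.card ι - 1) +
          Fintype.card ι * F.card * N ^ (Fintype.card ι - 1)) * N :=
          Nat.mul_le_mul_right _ (hcard.trans (add_le_add h1 h2))
      _ = (Fintype.card ι ^ 2 + Fintype.card ι * F.card) *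
          (N ^ (Fintype.card ι - 1) * N) := by ring
      _ = _ := by rw [hpow]

/-- Non-generic maps make up a fraction `O(1/N)`, so the crude bound `v` enters only at that order.
-/
theorem average_le_of_generic {ι : Type*} [Fintype ι] [DecidableEq ι] (hN : 0 < N)
    (F : Finset (Fin N)) (f : (ι → Fin N) → ℝ) {u v : ℝ} (hu0 : 0 ≤ u) (hv0 : 0 ≤ v)
    (hu : ∀ κ, Function.Injective κ → (∀ a, κ a ∉ F) → f κ ≤ u) (hv : ∀ κ, f κ ≤ v) :
    ((N : ℝ) ^ Fintype.card ι)⁻¹ * ∑ κ, f κ ≤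
      u + v * ((Fintype.card ι : ℝ) ^ 2 + Fintype.card ι * F.card) / N := by
  classical
  have hN' : (0 : ℝ) < N := by exact_mod_cast hN
  set S := Finset.univ.filter fun κ : ι → Fin N => ¬ (Function.Injective κ ∧ ∀ a, κ a ∉ F)
  have hc : (S.card : ℝ) * N ≤ ((Fintype.card ι : ℝ) ^ 2 + Fintype.card ι * F.card) *
      (N : ℝ) ^ Fintype.card ι := by
    exact_mod_cast card_not_generic_le F
  have hpt : ∀ κ, f κ ≤ u + if κ ∈ S then v else 0 := by
    intro κ
    by_cases h : κ ∈ S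
    · rw [if_pos h]; linarith [hv κ]
    · rw [if_neg h, add_zero]
      have : Function.Injective κ ∧ ∀ a, κ a ∉ F := by
        by_contra hcon
        exact h (Finset.mem_filter.2 ⟨Finset.mem_univ _, hcon⟩)
      exact hu κ this.1 this.2
  have hsum : ∑ κ, f κ ≤ (N : ℝ) ^ Fintype.card ι * u + S.card * v := by
    refine (Finset.sum_le_sum fun κ _ => hpt κ).trans_eq ?_
    rw [Finset.sum_add_distrib, ← Finset.sum_filter]
    simp
  rw [inv_mul_le_iff₀ (by positivity), mul_add]
  refine hsum.trans (add_le_add_right ?_ _)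
  rw [mul_div_assoc', le_div_iff₀ hN']
  calc (S.card : ℝ) * v * N = v * (S.card * N) := by ring
    _ ≤ v * (((Fintype.card ι : ℝ) ^ 2 + Fintype.card ι * F.card) *
      (N : ℝ) ^ Fintype.card ι) := by gcongr
    _ = _ := by ring

/-- Two maps are treated as one map on `Fin m ⊕ Fin m`, so that general position also makes them
disjoint. -/
theorem average_pair_le_of_generic (hN : 0 < N) (F : Finset (Fin N))
    (f : (Fin m → Fin N) → (Fin m → Fin N) → ℝ) {u v : ℝ} (hu0 : 0 ≤ u) (hv0 : 0 ≤ v)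
    (hu : ∀ k k', Function.Injective (Sum.elim k k') → (∀ a, k a ∉ F) → (∀ a, k' a ∉ F) →
      f k k' ≤ u) (hv : ∀ k k', f k k' ≤ v) :
    ∑ k, ∑ k', ((N : ℝ) ^ m)⁻¹ * ((N : ℝ) ^ m)⁻¹ * f k k' ≤
      u + v * (4 * (m : ℝ) ^ 2 + 2 * m * F.card) / N := by
  have := average_le_of_generic (ι := Fin m ⊕ Fin m) hN F
    (fun κ => f (κ ∘ Sum.inl) (κ ∘ Sum.inr)) hu0 hv0
    (fun κ hκ hF => hu _ _ (by simpa using hκ) (fun a => hF _) (fun a => hF _))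
    (fun κ => hv _ _)
  rw [← (Equiv.sumArrowEquivProdArrow (Fin m) (Fin m) (Fin N)).symm.sum_comp,
    Fintype.sum_prod_type] at this
  simp only [← Finset.mul_sum]
  refine le_trans (le_of_eq ?_) (this.trans (le_of_eq ?_))
  · rw [Fintype.card_sum, Fintype.card_fin, pow_add, mul_inv]
    rfl
  · rw [Fintype.card_sum, Fintype.card_fin]
    push_cast
    ring

end Generic

/-! ### Moment bounds for a fixed sample -/

section Bounds

variable {𝓧 : Type*} [MeasurableSpace 𝓧] {m N : ℕ} {Ω : Type*} [MeasurableSpace Ω]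

/-- The moment assumptions on a sample: `B²` bounds the fourth moments of the kernel at distinct
indices, and `C` bounds all second moments. -/
structure SampleBounds (P : Measure Ω) (X : Fin N → Ω → 𝓧) (h : (Fin m → 𝓧) → ℝ) (B C : ℝ) :
    Prop where
  measurable_sample : ∀ i, Measurable (X i)
  indep : iIndepFun X P
  measurable_kernel : Measurable h
  nonneg_four : 0 ≤ B
  nonneg_two : 0 ≤ C
  integrable_four : ∀ I : Fin m ↪ Fin N, Integrable (fun ω => h (fun l => X (I l) ω) ^ 4) P
  four_le : ∀ I : Fin m ↪ Fin N, ∫ ω, h (fun l => X (I l) ω) ^ 4 ∂P ≤ B ^ 2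
  integrable_two : ∀ k : Fin m → Fin N, Integrable (fun ω => h (fun l => X (k l) ω) ^ 2) P
  two_le : ∀ k : Fin m → Fin N, ∫ ω, h (fun l => X (k l) ω) ^ 2 ∂P ≤ C
  integrable_pi : ∀ k : Fin m → Fin N,
    Integrable (fun y => h y ^ 2) (Measure.pi fun l => P.map (X (k l)))
  pi_le : ∀ k : Fin m → Fin N, ∫ y, h y ^ 2 ∂(Measure.pi fun l => P.map (X (k l))) ≤ C

variable {P : Measure Ω} [IsProbabilityMeasure P] {X : Fin N → Ω → 𝓧} {h : (Fin m → 𝓧) → ℝ}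
  {B C : ℝ}

namespace SampleBounds

omit [IsProbabilityMeasure P] in
theorem memLp (H : SampleBounds P X h B C) (k : Fin m → Fin N) :
    MemLp (fun ω => h (fun l => X (k l) ω)) 2 P := by
  have hm : Measurable fun ω => h fun l => X (k l) ω :=
    H.measurable_kernel.comp (measurable_pi_lambda _ fun l => H.measurable_sample (k l))
  exact (memLp_two_iff_integrable_sq hm.aestronglyMeasurable).2 (H.integrable_two k)

theorem sq_le_of_four_le {f : Ω → ℝ} (hB : 0 ≤ B) (hf : AEStronglyMeasurable f P)
    (hi : Integrable (fun ω => f ω ^ 4) P) (h4 : ∫ ω, f ω ^ 4 ∂P ≤ B ^ 2) :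
    ∫ ω, f ω ^ 2 ∂P ≤ B := by
  have hpow : (fun ω => (f ω ^ 2) ^ 2) = fun ω => f ω ^ 4 := by ext ω; ring
  have := pow_integral_le (μ := P) (f := fun ω => f ω ^ 2) even_two two_ne_zero (hf.pow 2)
    (by rw [hpow]; exact hi)
  rw [hpow] at this
  exact abs_le_of_sq_le_sq' (this.trans h4) hB |>.2

theorem two_le_of_embedding (H : SampleBounds P X h B C) (I : Fin m ↪ Fin N) :
    ∫ ω, h (fun l => X (I l) ω) ^ 2 ∂P ≤ B :=
  sq_le_of_four_le H.nonneg_four (H.memLp I).aestronglyMeasurable (H.integrable_four I)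
    (H.four_le I)

theorem measurable_proj (H : SampleBounds P X h B C) (I : Fin m ↪ Fin N) (l : Fin m)
    (j : Fin N) : Measurable fun ω => proj P X h I l (X j ω) :=
  (WeightedU.measurable_proj H.measurable_sample H.measurable_kernel I l).comp
    (H.measurable_sample j)

theorem memLp_proj (H : SampleBounds P X h B C) (I : Fin m ↪ Fin N) (l : Fin m) (j : Fin N) :
    MemLp (fun ω => proj P X h I l (X j ω)) 2 P :=
  (memLp_two_iff_integrable_sq (H.measurable_proj I l j).aestronglyMeasurable).2
    (proj_pow_le H.measurable_sample H.measurable_kernel I l j even_two two_ne_zero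
      (H.integrable_pi _)).1

theorem proj_sq_le (H : SampleBounds P X h B C) (I : Fin m ↪ Fin N) (l : Fin m) (j : Fin N) :
    ∫ ω, proj P X h I l (X j ω) ^ 2 ∂P ≤ C :=
  (proj_pow_le H.measurable_sample H.measurable_kernel I l j even_two two_ne_zero
      (H.integrable_pi _)).2.trans (H.pi_le _)

theorem proj_four (H : SampleBounds P X h B C) (I : Fin m ↪ Fin N) (l : Fin m) (j : Fin N)
    (hj : ∀ k, k ≠ l → I k ≠ j) :
    Integrable (fun ω => proj P X h I l (X j ω) ^ 4) P ∧
      ∫ ω, proj P X h I l (X j ω) ^ 4 ∂P ≤ B ^ 2 := by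
  have := proj_pow_le_of_forall_ne H.measurable_sample H.indep H.measurable_kernel I l j hj
    (n := 4) (by decide) (by norm_num) (H.integrable_four _)
  exact ⟨this.1, this.2.trans (H.four_le _)⟩

theorem proj_sq_le_of_forall_ne (H : SampleBounds P X h B C) (I : Fin m ↪ Fin N) (l : Fin m)
    (j : Fin N) (hj : ∀ k, k ≠ l → I k ≠ j) :
    ∫ ω, proj P X h I l (X j ω) ^ 2 ∂P ≤ B :=
  sq_le_of_four_le H.nonneg_four (H.measurable_proj I l j).aestronglyMeasurable
    (H.proj_four I l j hj).1 (H.proj_four I l j hj).2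

theorem theta_sq_le (H : SampleBounds P X h B C) (I : Fin m ↪ Fin N) :
    theta P X h I ^ 2 ≤ C :=
  (pow_integral_le even_two two_ne_zero (H.memLp I).aestronglyMeasurable
    (H.integrable_two I)).trans (H.two_le I)

theorem theta_four_le (H : SampleBounds P X h B C) (I : Fin m ↪ Fin N) :
    theta P X h I ^ 4 ≤ B ^ 2 :=
  (pow_integral_le (by decide) (by norm_num) (H.memLp I).aestronglyMeasurable
    (H.integrable_four I)).trans (H.four_le I)

omit [IsProbabilityMeasure P] in
theorem sub_sq_le {f g : Ω → ℝ} {K L : ℝ} (hf : MemLp f 2 P) (hg : MemLp g 2 P)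
    (hfK : ∫ ω, f ω ^ 2 ∂P ≤ K) (hgL : ∫ ω, g ω ^ 2 ∂P ≤ L) :
    ∫ ω, (f ω - g ω) ^ 2 ∂P ≤ 2 * K + 2 * L := by
  calc ∫ ω, (f ω - g ω) ^ 2 ∂P ≤ ∫ ω, (2 * f ω ^ 2 + 2 * g ω ^ 2) ∂P := by
        refine integral_mono (hf.sub hg).integrable_sq
          ((hf.integrable_sq.const_mul 2).add (hg.integrable_sq.const_mul 2)) fun ω => ?_
        simp only
        nlinarith [sq_nonneg (f ω + g ω)]
    _ = 2 * ∫ ω, f ω ^ 2 ∂P + 2 * ∫ ω, g ω ^ 2 ∂P := by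
        rw [integral_add (hf.integrable_sq.const_mul 2) (hg.integrable_sq.const_mul 2),
          integral_const_mul, integral_const_mul]
    _ ≤ _ := by linarith

/-- The mean of the average of `h²` over all index tuples. -/
theorem integral_tupleAvg_sq_le (H : SampleBounds P X h B C) (hN : 0 < N) :
    ∫ ω, tupleAvg (fun y => h y ^ 2) (fun i => X i ω) ∂P ≤ B + C * (m : ℝ) ^ 2 / N := by
  simp only [tupleAvg]
  rw [integral_const_mul, integral_finsetSum _ fun k _ => H.integrable_two k]
  have := average_le_of_generic hN ∅ (fun k : Fin m → Fin N => ∫ ω, h (fun l => X (k l) ω) ^ 2 ∂P)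
    H.nonneg_four H.nonneg_two (fun k hk _ => H.two_le_of_embedding ⟨k, hk⟩) H.two_le
  simpa using this

omit [MeasurableSpace 𝓧] [IsProbabilityMeasure P] in
theorem theta_sub_le (I J : Fin m ↪ Fin N) :
    |theta P X h I - theta P X h J| ≤ meanGap P X h :=
  le_ciSup (f := fun t : (Fin m ↪ Fin N) × (Fin m ↪ Fin N) =>
    |theta P X h t.1 - theta P X h t.2|) (Set.finite_range _).bddAbove (I, J)

omit [MeasurableSpace 𝓧] in
theorem tupleAvg_sub_eq (hN : 0 < N) (x : Fin N → 𝓧) (c : ℝ) :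
    tupleAvg h x - c = ∑ k : Fin m → Fin N, ((N : ℝ) ^ m)⁻¹ * (h (fun l => x (k l)) - c) := by
  have hN' : (N : ℝ) ≠ 0 := by exact_mod_cast hN.ne'
  rw [← Finset.mul_sum, Finset.sum_sub_distrib, tupleAvg]
  simp
  field_simp

/-- In the expanded square, pairs of disjoint injective tuples factor by independence into two
differences of means, each at most `meanGap`; the other pairs are rare. -/
theorem integral_tupleAvg_sub_sq_le (H : SampleBounds P X h B C) (hN : 0 < N)
    (I : Fin m ↪ Fin N) :
    ∫ ω, (tupleAvg h (fun i => X i ω) - theta P X h I) ^ 2 ∂P ≤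
      meanGap P X h ^ 2 + 4 * C * (4 * (m : ℝ) ^ 2) / N := by
  have hmem : ∀ k : Fin m → Fin N, MemLp (fun ω => h (fun l => X (k l) ω) - theta P X h I) 2 P :=
    fun k => (H.memLp k).sub (memLp_const (theta P X h I))
  have hsq : ∀ k : Fin m → Fin N,
      ∫ ω, (h (fun l => X (k l) ω) - theta P X h I) ^ 2 ∂P ≤ 4 * C := by
    intro k
    refine (sub_sq_le (H.memLp k) (memLp_const _) (H.two_le k) (L := C) ?_).trans_eq (by ring)
    simpa using H.theta_sq_le I
  simp only [tupleAvg_sub_eq hN]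
  rw [integral_sum_sq _ _ fun k _ => hmem k]
  refine (average_pair_le_of_generic hN ∅ _ (u := meanGap P X h ^ 2) (v := 4 * C) (sq_nonneg _)
    (mul_nonneg (by norm_num) H.nonneg_two) ?_ ?_).trans_eq (by simp)
  · intro k k' hkk _ _
    have hk : Function.Injective k := hkk.comp Sum.inl_injective
    have hk' : Function.Injective k' := hkk.comp Sum.inr_injective
    have hdis : ∀ l l', k l ≠ k' l' := fun l l' e => by
      have := @hkk (Sum.inl l) (Sum.inr l') e
      simp at this
    have := integral_mul_of_dependsOn (P := P) H.measurable_sample H.indep (Set.range k)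
      (f := fun x => h (fun l => x (k' l)) - theta P X h I)
      (g := fun x => h (fun l => x (k l)) - theta P X h I)
      ((H.measurable_kernel.comp (by fun_prop)).sub_const _)
      ((H.measurable_kernel.comp (by fun_prop)).sub_const _)
      (fun x y hxy => by
        simp only
        congr 2
        ext1 l
        exact hxy _ ⟨l, rfl⟩)
      (fun x y hxy => by
        simp only
        congr 2
        ext1 l
        exact hxy _ (by rintro ⟨l', hl'⟩; exact hdis _ _ hl'))
      ((hmem k).integrable_mul (hmem k'))
    rw [this]
    have hmean : ∀ J : Fin m ↪ Fin N, |∫ ω, (h (fun l => X (J l) ω) - theta P X h I) ∂P| ≤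
        meanGap P X h := by
      intro J
      rw [integral_sub ((H.memLp J).integrable one_le_two) (integrable_const _)]
      simpa [theta] using theta_sub_le (P := P) (X := X) (h := h) J I
    refine (le_abs_self _).trans ?_
    rw [abs_mul, pow_two]
    exact mul_le_mul (hmean ⟨k, hk⟩) (hmean ⟨k', hk'⟩) (abs_nonneg _)
      ((abs_nonneg _).trans (hmean ⟨k, hk⟩))
  · intro k k'
    exact (le_abs_self _).trans (abs_integral_mul_le (hmem k) (hmem k') (hsq k) (hsq k'))

end SampleBounds

end Bounds

/-! ### Pairs of tuples with exactly one common index -/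

section Cross

variable {𝓧 : Type*} [MeasurableSpace 𝓧] {m N : ℕ} {Ω : Type*} [MeasurableSpace Ω]
  {P : Measure Ω} [IsProbabilityMeasure P] {X : Fin N → Ω → 𝓧} {h : (Fin m → 𝓧) → ℝ}
  {B C : ℝ}

/-- The tuples `r` and `s` have exactly the index `r p = s q` in common. -/
def MeetAt (r s : Fin m ↪ Fin N) (p q : Fin m) : Prop :=
  r p = s q ∧ ∀ x y, r x = s y → x = p ∧ y = q

theorem MeetAt.commonIndices_eq {r s : Fin m ↪ Fin N} {p q : Fin m} (hrs : MeetAt r s p q) :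
    commonIndices ![r, s] = {s q} := by
  ext x
  rw [mem_commonIndices_pair, Finset.mem_singleton]
  constructor
  · rintro ⟨⟨l, rfl⟩, l', hl'⟩
    rw [(hrs.2 l l' hl'.symm).1, hrs.1]
  · rintro rfl
    exact ⟨⟨p, hrs.1⟩, q, rfl⟩

theorem MeetAt.symm {r s : Fin m ↪ Fin N} {p q : Fin m} (hrs : MeetAt r s p q) :
    MeetAt s r q p := ⟨hrs.1.symm, fun x y hxy => (hrs.2 y x hxy.symm).symm⟩

theorem meetAt_of_card_lt_two {r s : Fin m ↪ Fin N} {p q : Fin m} (hpq : r p = s q)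
    (hcard : (commonIndices ![r, s]).card < 2) : MeetAt r s p q := by
  refine ⟨hpq, fun x y hxy => ?_⟩
  have h1 := Finset.card_le_one.1 (Nat.lt_succ_iff.1 hcard) (r x)
    (mem_commonIndices_pair.2 ⟨⟨x, rfl⟩, y, hxy.symm⟩) (r p)
    (mem_commonIndices_pair.2 ⟨⟨p, rfl⟩, q, hpq.symm⟩)
  exact ⟨r.injective h1, s.injective (by rw [← hxy, h1, hpq])⟩

/-- By the tower property the conditioning leaves no trace. -/
theorem crossMoment_eq (hX : ∀ i, Measurable (X i)) (r s : Fin m ↪ Fin N) (i : Fin N) :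
    crossMoment P X h r s i = ∫ ω, h (fun l => X (r l) ω) * h (fun l => X (s l) ω) ∂P :=
  integral_condExp (hX i).comap_le

omit [IsProbabilityMeasure P] in
theorem crossGap_nonneg : 0 ≤ crossGap P X h := Real.iSup_nonneg fun _ => abs_nonneg _

theorem sub_le_crossGap (hX : ∀ i, Measurable (X i)) {r s k : Fin m ↪ Fin N} {p q : Fin m}
    (hrs : MeetAt r s p q) (hks : MeetAt k s p q) :
    |∫ ω, h (fun l => X (r l) ω) * h (fun l => X (s l) ω) ∂P -
      ∫ ω, h (fun l => X (k l) ω) * h (fun l => X (s l) ω) ∂P| ≤ crossGap P X h := by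
  have : |crossMoment P X h r s (k p) - crossMoment P X h k s (k p)| ≤ crossGap P X h :=
    le_ciSup (f := fun t : CrossConfig m N =>
    |crossMoment P X h t.1.2.1 t.1.2.2.1 (t.1.2.2.2 t.1.1.1) -
      crossMoment P X h t.1.2.2.2 t.1.2.2.1 (t.1.2.2.2 t.1.1.1)|) (Set.finite_range _).bddAbove
    ⟨((p, q), (r, s, k)), hrs.commonIndices_eq, hrs.1, hks.commonIndices_eq, hks.1⟩
  rwa [crossMoment_eq hX, crossMoment_eq hX] at this

namespace SampleBounds

/-- Replacing a kernel by its projection on the common variable. -/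
theorem integral_mul_proj (H : SampleBounds P X h B C) {r s : Fin m ↪ Fin N} {p q : Fin m}
    (hrs : MeetAt r s p q) :
    ∫ ω, h (fun l => X (r l) ω) * proj P X h s q (X (s q) ω) ∂P =
      ∫ ω, h (fun l => X (r l) ω) * h (fun l => X (s l) ω) ∂P := by
  refine WeightedU.integral_mul_proj H.measurable_sample H.indep H.measurable_kernel
    (A := Set.range r) (g := fun x => h fun l => x (r l))
    (H.measurable_kernel.comp (by fun_prop)) ?_ s q ?_ ((H.memLp r).integrable_mul (H.memLp s))
  · intro x y hxy
    simp only
    congr 1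
    ext1 l
    exact hxy _ ⟨l, rfl⟩
  · intro l
    constructor
    · rintro ⟨x, hx⟩
      exact (hrs.2 x l hx).2
    · rintro rfl
      exact ⟨p, hrs.1⟩

/-- The replacement of a kernel by its projection is made twice, the second time against a function
of the common variable alone. -/
theorem integral_proj_mul_proj (H : SampleBounds P X h B C) {r s : Fin m ↪ Fin N} {p q : Fin m}
    (hrs : MeetAt r s p q) :
    ∫ ω, proj P X h r p (X (r p) ω) * proj P X h s q (X (s q) ω) ∂P =
      ∫ ω, h (fun l => X (r l) ω) * h (fun l => X (s l) ω) ∂P := by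
  have h1 : ∫ ω, proj P X h s q (X (s q) ω) * proj P X h r p (X (r p) ω) ∂P =
      ∫ ω, proj P X h s q (X (s q) ω) * h (fun l => X (r l) ω) ∂P := by
    refine WeightedU.integral_mul_proj H.measurable_sample H.indep H.measurable_kernel
      (A := {s q}) (g := fun x => proj P X h s q (x (s q)))
      ((WeightedU.measurable_proj H.measurable_sample H.measurable_kernel s q).comp
        (measurable_pi_apply _)) ?_ r p ?_ ((H.memLp_proj s q _).integrable_mul (H.memLp r))
    · intro x y hxy
      simp only [hxy _ rfl]
    · intro l
      rw [Set.mem_singleton_iff, ← hrs.1]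
      exact r.injective.eq_iff
  rw [← H.integral_mul_proj hrs]
  simpa only [mul_comm] using h1

/-- After expansion, each of the four terms equals a cross moment of two kernels meeting at
positions `p` and `q`. The signed sum is `(rs - ks) - (rt - kt)`, and each bracket is at most
`crossGap`. -/
theorem abs_integral_sub_mul_sub_le (H : SampleBounds P X h B C) {r s k t : Fin m ↪ Fin N}
    {p q : Fin m} (hrs : MeetAt r s p q) (hrt : MeetAt r t p q) (hks : MeetAt k s p q)
    (hkt : MeetAt k t p q) :
    |∫ ω, (h (fun l => X (r l) ω) - proj P X h k p (X (k p) ω)) *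
      (h (fun l => X (s l) ω) - proj P X h t q (X (t q) ω)) ∂P| ≤ 2 * crossGap P X h := by
  have i1 : Integrable (fun ω => h (fun l => X (r l) ω) * h (fun l => X (s l) ω)) P :=
    (H.memLp r).integrable_mul (H.memLp s)
  have i2 : Integrable (fun ω => h (fun l => X (s l) ω) * proj P X h k p (X (k p) ω)) P :=
    (H.memLp s).integrable_mul (H.memLp_proj k p _)
  have i3 : Integrable (fun ω => h (fun l => X (r l) ω) * proj P X h t q (X (t q) ω)) P :=
    (H.memLp r).integrable_mul (H.memLp_proj t q _)
  have i4 : Integrable (fun ω => proj P X h k p (X (k p) ω) * proj P X h t q (X (t q) ω)) P :=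
    (H.memLp_proj k p _).integrable_mul (H.memLp_proj t q _)
  have hexp : ∀ ω, (h (fun l => X (r l) ω) - proj P X h k p (X (k p) ω)) *
      (h (fun l => X (s l) ω) - proj P X h t q (X (t q) ω)) =
      (h (fun l => X (r l) ω) * h (fun l => X (s l) ω) -
        h (fun l => X (s l) ω) * proj P X h k p (X (k p) ω)) -
      (h (fun l => X (r l) ω) * proj P X h t q (X (t q) ω) -
        proj P X h k p (X (k p) ω) * proj P X h t q (X (t q) ω)) := fun ω => by ring
  have i12 : Integrable (fun ω => h (fun l => X (r l) ω) * h (fun l => X (s l) ω) -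
        h (fun l => X (s l) ω) * proj P X h k p (X (k p) ω)) P := i1.sub i2
  have i34 : Integrable (fun ω => h (fun l => X (r l) ω) * proj P X h t q (X (t q) ω) -
        proj P X h k p (X (k p) ω) * proj P X h t q (X (t q) ω)) P := i3.sub i4
  simp only [hexp]
  rw [integral_sub i12 i34, integral_sub i1 i2, integral_sub i3 i4,
    H.integral_mul_proj (hks.symm), H.integral_mul_proj hrt, H.integral_proj_mul_proj hkt]
  have e1 := sub_le_crossGap (P := P) (h := h) H.measurable_sample hrs hks
  have e2 := sub_le_crossGap (P := P) (h := h) H.measurable_sample hrt hkt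
  have e3 : ∫ ω, h (fun l => X (s l) ω) * h (fun l => X (k l) ω) ∂P =
      ∫ ω, h (fun l => X (k l) ω) * h (fun l => X (s l) ω) ∂P := by simp only [mul_comm]
  rw [e3, two_mul]
  refine le_trans (le_of_eq ?_) ((abs_sub _ _).trans (add_le_add e1 e2))
  congr 1

omit [IsProbabilityMeasure P] in
theorem memLp_projAvg (H : SampleBounds P X h B C) (l : Fin m) (j : Fin N) :
    MemLp (fun ω => projAvg h (fun i => X i ω) l j) 2 P := by
  have : MemLp (fun ω => ∑ k : Fin m → Fin N, h fun l' => X (Function.update k l j l') ω) 2 P :=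
    memLp_finsetSum _ fun k _ => H.memLp (Function.update k l j)
  exact this.const_mul _

omit [IsProbabilityMeasure P] in
theorem memLp_tupleAvg (H : SampleBounds P X h B C) :
    MemLp (fun ω => tupleAvg h (fun i => X i ω)) 2 P := by
  have : MemLp (fun ω => ∑ k : Fin m → Fin N, h fun l' => X (k l') ω) 2 P :=
    memLp_finsetSum _ fun k _ => H.memLp k
  exact this.const_mul _

omit [IsProbabilityMeasure P] in
theorem integral_projAvg_sq_le_average (H : SampleBounds P X h B C) (hN : 0 < N) (l : Fin m)
    (j : Fin N) :
    ∫ ω, projAvg h (fun i => X i ω) l j ^ 2 ∂P ≤ ((N : ℝ) ^ m)⁻¹ * ∑ k : Fin m → Fin N,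
      ∫ ω, h (fun l' => X (Function.update k l j l') ω) ^ 2 ∂P := by
  have hN' : (0 : ℝ) < N := by exact_mod_cast hN
  have hi : ∀ k ∈ Finset.univ, Integrable
      (fun ω => h (fun l' => X (Function.update k l j l') ω) ^ 2) P :=
    fun k _ => H.integrable_two (Function.update k l j)
  rw [← integral_finsetSum _ hi, ← integral_const_mul]
  refine integral_mono (H.memLp_projAvg l j).integrable_sq
    ((integrable_finsetSum _ hi).const_mul _) fun ω => ?_
  simp only [projAvg]
  rw [mul_pow, pow_two (((N : ℝ) ^ m)⁻¹), mul_assoc]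
  gcongr
  rw [inv_mul_le_iff₀ (by positivity)]
  have := sq_sum_le_card_mul_sum_sq (s := Finset.univ)
    (f := fun k : Fin m → Fin N => h fun l' => X (Function.update k l j l') ω)
  simpa using this

omit [IsProbabilityMeasure P] in
theorem integral_projAvg_sq_le (H : SampleBounds P X h B C) (hN : 0 < N) (l : Fin m)
    (j : Fin N) : ∫ ω, projAvg h (fun i => X i ω) l j ^ 2 ∂P ≤ C := by
  have hN' : (0 : ℝ) < N := by exact_mod_cast hN
  refine (H.integral_projAvg_sq_le_average hN l j).trans ?_
  rw [inv_mul_le_iff₀ (by positivity)]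
  refine (Finset.sum_le_card_nsmul _ _ C fun k _ => H.two_le _).trans_eq (by simp)

theorem injective_update {k : Fin m → Fin N} (hk : Function.Injective k) (l : Fin m) {j : Fin N}
    (hj : ∀ a, k a ≠ j) : Function.Injective (Function.update k l j) :=
  (replaceIndex ⟨k, hk⟩ l j fun a _ => hj a).injective

/-- If `k` is injective and avoids `j`, then writing `j` into position `l` gives a tuple of distinct
indices, with second moment at most `B`; the other `k` are rare. -/
theorem integral_projAvg_sq_le' (H : SampleBounds P X h B C) (hN : 0 < N) (l : Fin m)
    (j : Fin N) : ∫ ω, projAvg h (fun i => X i ω) l j ^ 2 ∂P ≤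
      B + C * ((m : ℝ) ^ 2 + m) / N := by
  refine (H.integral_projAvg_sq_le_average hN l j).trans ?_
  have := average_le_of_generic hN {j} (fun k : Fin m → Fin N =>
    ∫ ω, h (fun l' => X (Function.update k l j l') ω) ^ 2 ∂P) H.nonneg_four H.nonneg_two
    (fun k hk hj => H.two_le_of_embedding
      ⟨Function.update k l j, injective_update hk l fun a => by simpa using hj a⟩)
    (fun k => H.two_le _)
  simpa using this

omit [MeasurableSpace 𝓧] in
theorem projAvg_sub_eq (hN : 0 < N) (x : Fin N → 𝓧) (l : Fin m) (j : Fin N) (c : ℝ) :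
    projAvg h x l j - c = ∑ k : Fin m → Fin N,
      ((N : ℝ) ^ m)⁻¹ * (h (fun l' => x (Function.update k l j l')) - c) := by
  have hN' : (N : ℝ) ≠ 0 := by exact_mod_cast hN.ne'
  rw [← Finset.mul_sum, Finset.sum_sub_distrib, projAvg]
  simp
  field_simp

/-- The differences between averaged and exact projections are almost uncorrelated when the tuples
have only one index in common. -/
theorem abs_integral_projAvg_sub_mul_le (H : SampleBounds P X h B C) (hN : 0 < N)
    {I J : Fin m ↪ Fin N} {p q : Fin m} (hIJ : MeetAt I J p q) (j : Fin N)
    (hI : ∀ k, k ≠ p → I k ≠ j) (hJ : ∀ k, k ≠ q → J k ≠ j) :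
    |∫ ω, (projAvg h (fun i => X i ω) p j - proj P X h I p (X j ω)) *
      (projAvg h (fun i => X i ω) q j - proj P X h J q (X j ω)) ∂P| ≤
      2 * crossGap P X h + 4 * C * (4 * (m : ℝ) ^ 2 + 2 * m * (2 * m + 1)) / N := by
  classical
  -- Tuples that avoid `F` meet neither `I` nor `J` and do not contain `j`.
  set F : Finset (Fin N) := {j} ∪ (Finset.univ.image I ∪ Finset.univ.image J) with hF
  have hFcard : (F.card : ℝ) ≤ 2 * m + 1 := by
    have : F.card ≤ 1 + (m + m) := by
      refine (Finset.card_union_le _ _).trans (add_le_add (by simp) ?_)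
      refine (Finset.card_union_le _ _).trans (add_le_add ?_ ?_) <;>
      exact Finset.card_image_le.trans_eq (by simp)
    have h2 : (F.card : ℝ) ≤ 1 + (m + m) := by exact_mod_cast this
    linarith
  have hmem : ∀ (K : Fin m ↪ Fin N) (l : Fin m) (k : Fin m → Fin N), MemLp (fun ω =>
      h (fun l' => X (Function.update k l j l') ω) - proj P X h K l (X j ω)) 2 P :=
    fun K l k => (H.memLp _).sub (H.memLp_proj K l j)
  have hsq : ∀ (K : Fin m ↪ Fin N) (l : Fin m) (k : Fin m → Fin N), ∫ ω,
      (h (fun l' => X (Function.update k l j l') ω) - proj P X h K l (X j ω)) ^ 2 ∂P ≤ 4 * C :=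
    fun K l k => (sub_sq_le (H.memLp _) (H.memLp_proj K l j) (H.two_le _)
      (H.proj_sq_le K l j)).trans_eq (by ring)
  simp only [projAvg_sub_eq hN]
  rw [integral_sum_mul_sum _ _ _ _ (fun k _ => hmem I p k) (fun k _ => hmem J q k)]
  have habs : ∀ f : (Fin m → Fin N) → (Fin m → Fin N) → ℝ,
      |∑ k, ∑ k', ((N : ℝ) ^ m)⁻¹ * ((N : ℝ) ^ m)⁻¹ * f k k'| ≤
        ∑ k, ∑ k', ((N : ℝ) ^ m)⁻¹ * ((N : ℝ) ^ m)⁻¹ * |f k k'| := fun f => by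
    refine (Finset.abs_sum_le_sum_abs _ _).trans (Finset.sum_le_sum fun k _ => ?_)
    refine (Finset.abs_sum_le_sum_abs _ _).trans_eq (Finset.sum_congr rfl fun k' _ => ?_)
    rw [abs_mul, abs_of_nonneg (by positivity : (0 : ℝ) ≤ ((N : ℝ) ^ m)⁻¹ * ((N : ℝ) ^ m)⁻¹)]
  refine (habs _).trans ?_
  refine (average_pair_le_of_generic hN F _ (u := 2 * crossGap P X h) (v := 4 * C)
    (mul_nonneg zero_le_two crossGap_nonneg) (mul_nonneg (by norm_num) H.nonneg_two)
    ?_ ?_).trans ?_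
  · intro k k' hkk hkF hkF'
    have hk : Function.Injective k := hkk.comp Sum.inl_injective
    have hk' : Function.Injective k' := hkk.comp Sum.inr_injective
    have hdis : ∀ l l', k l ≠ k' l' := fun l l' e => by
      have := @hkk (Sum.inl l) (Sum.inr l') e
      simp at this
    simp only [hF, Finset.mem_union, Finset.mem_singleton, Finset.mem_image, Finset.mem_univ,
      true_and, not_or, not_exists] at hkF hkF'
    -- Each of `r`, `u` meets each of `s`, `t` exactly at `j`, in positions `p` and `q`. For `u` and
    -- `t` this uses `hIJ`: the only index common to `I` and `J` has been overwritten.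
    set r := replaceIndex ⟨k, hk⟩ p j fun a _ => (hkF a).1 with hr
    set s := replaceIndex ⟨k', hk'⟩ q j fun a _ => (hkF' a).1 with hs
    set u := replaceIndex I p j hI with hu
    set t := replaceIndex J q j hJ with ht
    have meet : ∀ {K L : Fin m ↪ Fin N} (hK : ∀ a, a ≠ p → K a ≠ j) (hL : ∀ a, a ≠ q → L a ≠ j),
        (∀ x y, x ≠ p → y ≠ q → K x ≠ L y) →
        MeetAt (replaceIndex K p j hK) (replaceIndex L q j hL) p q := by
      intro K L hK hL hKL
      refine ⟨by simp, fun x y hxy => ?_⟩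
      by_cases hx : x = p <;> by_cases hy : y = q
      · exact ⟨hx, hy⟩
      · rw [hx, replaceIndex_self, replaceIndex_of_ne _ _ _ _ hy] at hxy
        exact absurd hxy.symm (hL y hy)
      · rw [hy, replaceIndex_self, replaceIndex_of_ne _ _ _ _ hx] at hxy
        exact absurd hxy (hK x hx)
      · rw [replaceIndex_of_ne _ _ _ _ hx, replaceIndex_of_ne _ _ _ _ hy] at hxy
        exact absurd hxy (hKL x y hx hy)
    have key := H.abs_integral_sub_mul_sub_le (r := r) (s := s) (k := u) (t := t) (p := p) (q := q)
      (meet _ _ fun x y _ _ => hdis x y)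
      (meet _ _ fun x y _ _ => fun e => (hkF x).2.2 y e.symm)
      (meet _ _ fun x y _ _ => fun e => (hkF' y).2.1 x e)
      (meet _ _ fun x y hx _ => fun e => hx (hIJ.2 x y e).1)
    -- A projection ignores the overwritten entry, so the projections of `I` and `J` reappear.
    have e1 : ∀ ω, proj P X h u p (X (u p) ω) = proj P X h I p (X j ω) := fun ω => by
      rw [hu, replaceIndex_self]
      exact proj_congr H.measurable_sample H.measurable_kernel
        (fun a ha => replaceIndex_of_ne _ _ _ _ ha) _
    have e2 : ∀ ω, proj P X h t q (X (t q) ω) = proj P X h J q (X j ω) := fun ω => by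
      rw [ht, replaceIndex_self]
      exact proj_congr H.measurable_sample H.measurable_kernel
        (fun a ha => replaceIndex_of_ne _ _ _ _ ha) _
    simp only [e1, e2] at key
    exact key
  · intro k k'
    exact abs_integral_mul_le (hmem I p k) (hmem J q k') (hsq I p k) (hsq J q k')
  · have hC := H.nonneg_two
    gcongr

end SampleBounds

end Cross

/-! ### Empirical against true first order kernels -/

section Compare

variable {m N : ℕ}

/-- The index `j` occurs in the tuple of `t = (l, I)` only possibly in position `l`. -/
def OffDiag (j : Fin N) (t : Fin m × (Fin m ↪ Fin N)) : Prop := ∀ k, k ≠ t.1 → t.2 k ≠ j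

open Classical in
/-- The coefficients of the pairs with `OffDiag j`. -/
noncomputable def offCoef (a : (Fin m → Fin N) → ℝ) (i j : Fin N)
    (t : Fin m × (Fin m ↪ Fin N)) : ℝ := if OffDiag j t then coef a i t else 0

open Classical in
/-- The coefficients of the pairs without `OffDiag j`. -/
noncomputable def diagCoef (a : (Fin m → Fin N) → ℝ) (i j : Fin N)
    (t : Fin m × (Fin m ↪ Fin N)) : ℝ := if OffDiag j t then 0 else coef a i t

theorem offCoef_add_diagCoef (a : (Fin m → Fin N) → ℝ) (i j : Fin N)
    (t : Fin m × (Fin m ↪ Fin N)) : offCoef a i j t + diagCoef a i j t = coef a i t := by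
  unfold offCoef diagCoef; split_ifs <;> simp

theorem abs_offCoef_le (a : (Fin m → Fin N) → ℝ) (i j : Fin N)
    (t : Fin m × (Fin m ↪ Fin N)) : |offCoef a i j t| ≤ |coef a i t| := by
  unfold offCoef; split_ifs <;> simp

/-- A tuple contains only `m` indices, so each coefficient is counted for at most `m` values of `j`;
the sum of squares is then at most the square of the sum. -/
theorem sum_abs_diagCoef_sq_le (a : (Fin m → Fin N) → ℝ) (i : Fin N) :
    ∑ j, (∑ t, |diagCoef a i j t|) ^ 2 ≤ (m : ℝ) ^ 2 * totalWeight a i ^ 2 := by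
  classical
  have h1 : ∑ j, ∑ t, |diagCoef a i j t| ≤ m * totalWeight a i := by
    rw [Finset.sum_comm, totalWeight, Finset.mul_sum]
    refine Finset.sum_le_sum fun t _ => ?_
    have hpt : ∀ j, |diagCoef a i j t| ≤ if j ∈ Finset.univ.image t.2 then |coef a i t| else 0 := by
      intro j
      unfold diagCoef
      split_ifs with h1 h2 h3
      · simp
      · simp
      · exact le_rfl
      · refine absurd (fun k _ e => h3 ?_) h1
        exact Finset.mem_image.2 ⟨k, Finset.mem_univ _, e⟩
    refine (Finset.sum_le_sum fun j _ => hpt j).trans ?_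
    rw [← Finset.sum_filter, Finset.sum_const, nsmul_eq_mul]
    refine mul_le_mul_of_nonneg_right ?_ (abs_nonneg _)
    rw [Finset.filter_mem_eq_inter, Finset.univ_inter]
    exact_mod_cast Finset.card_image_le.trans_eq (by simp)
  have hnn : ∀ j ∈ Finset.univ, 0 ≤ ∑ t, |diagCoef a i j t| :=
    fun j _ => Finset.sum_nonneg fun _ _ => abs_nonneg _
  calc ∑ j, (∑ t, |diagCoef a i j t|) ^ 2 ≤ (∑ j, ∑ t, |diagCoef a i j t|) ^ 2 :=
        Finset.sum_sq_le_sq_sum_of_nonneg hnn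
    _ ≤ (m * totalWeight a i) ^ 2 := by
        gcongr
    _ = _ := by ring

/-- A pair of positioned tuples contributes for at most one `i`, and the positions give the factor
`m ^ 2`. -/
theorem sum_coef_pair_le (a : (Fin m → Fin N) → ℝ) :
    ∑ i, ∑ t, ∑ t', |coef a i t| * |coef a i t'| *
      (if 2 ≤ (commonIndices ![t.2, t'.2]).card then 1 else 0) ≤
      (m : ℝ) ^ 2 * sharedWeight a 2 2 := by
  have key : ∀ t t' : Fin m × (Fin m ↪ Fin N), ∑ i, |coef a i t| * |coef a i t'| *
      (if 2 ≤ (commonIndices ![t.2, t'.2]).card then 1 else 0) ≤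
      if ![t.2, t'.2] ∈ sharingTuples m N 2 2 then
        normFactor m N ^ 2 * |a t.2 * a t'.2| else 0 := by
    intro t t'
    have hpt : ∀ i, |coef a i t| * |coef a i t'| ≤
        if i = t.2 t.1 then normFactor m N ^ 2 * |a t.2 * a t'.2| else 0 := by
      intro i
      have hn := normFactor_nonneg m N
      have hnn : 0 ≤ normFactor m N ^ 2 * |a t.2 * a t'.2| := by positivity
      unfold coef
      by_cases h1 : t.2 t.1 = i
      · rw [if_pos h1, if_pos h1.symm]
        by_cases h2 : t'.2 t'.1 = i
        · rw [if_pos h2, abs_mul, abs_mul, abs_mul, abs_of_nonneg hn]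
          exact le_of_eq (by ring)
        · rw [if_neg h2, abs_zero, mul_zero]
          exact hnn
      · rw [if_neg h1, abs_zero, zero_mul]
        split_ifs
        exacts [hnn, le_rfl]
    by_cases hc : 2 ≤ (commonIndices ![t.2, t'.2]).card
    · have hmem : ![t.2, t'.2] ∈ sharingTuples m N 2 2 :=
        Finset.mem_filter.2 ⟨Finset.mem_univ _, hc⟩
      simp only [if_pos hc, if_pos hmem, mul_one]
      refine (Finset.sum_le_sum fun i _ => hpt i).trans_eq ?_
      rw [Finset.sum_ite_eq' Finset.univ (t.2 t.1)]
      simp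
    · have hmem : ![t.2, t'.2] ∉ sharingTuples m N 2 2 :=
        fun hh => hc (Finset.mem_filter.1 hh).2
      simp [if_neg hc, if_neg hmem]
  rw [Finset.sum_comm]
  simp_rw [Finset.sum_comm (s := Finset.univ (α := Fin N))]
  refine (Finset.sum_le_sum fun t _ => Finset.sum_le_sum fun t' _ => key t t').trans_eq ?_
  rw [Fintype.sum_prod_type]
  simp only [Fintype.sum_prod_type, Finset.sum_const]
  have hid : ∀ I : Fin 2 → (Fin m ↪ Fin N), ![I 0, I 1] = I := by
    intro I; ext k : 1; fin_cases k <;> rfl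
  have hpair : ∑ I : Fin m ↪ Fin N, ∑ J : Fin m ↪ Fin N,
      (if ![I, J] ∈ sharingTuples m N 2 2 then normFactor m N ^ 2 * |a I * a J| else 0) =
      sharedWeight a 2 2 := by
    rw [← Finset.sum_product', Finset.univ_product_univ,
      ← (finTwoArrowEquiv (Fin m ↪ Fin N)).sum_comp, ← Finset.sum_filter, ← Finset.mul_sum,
      sharedWeight]
    congr 1
    refine Finset.sum_congr ?_ fun I _ => ?_
    · ext I
      simp [hid]
    · simp [Fin.prod_univ_two]
  simp only [Finset.card_univ, Fintype.card_fin, nsmul_eq_mul, ← Finset.mul_sum]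
  rw [hpair]
  ring

variable {𝓧 : Type*} [MeasurableSpace 𝓧] {Ω : Type*} [MeasurableSpace Ω]
  {P : Measure Ω} [IsProbabilityMeasure P] {X : Fin N → Ω → 𝓧} {h : (Fin m → 𝓧) → ℝ}
  {B C : ℝ} {a : (Fin m → Fin N) → ℝ}

omit [IsProbabilityMeasure P] in
theorem integral_weighted_sq_le {ι : Type*} [Fintype ι] (c : ι → ℝ) {f : ι → Ω → ℝ} {K : ℝ}
    (hf : ∀ t, MemLp (f t) 2 P) (hK : ∀ t, ∫ ω, f t ω ^ 2 ∂P ≤ K) :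
    ∫ ω, (∑ t, c t * f t ω) ^ 2 ∂P ≤ (∑ t, |c t|) ^ 2 * K := by
  rw [integral_sum_sq _ _ fun t _ => hf t, pow_two, Finset.sum_mul_sum, Finset.sum_mul]
  refine Finset.sum_le_sum fun t _ => ?_
  rw [Finset.sum_mul]
  refine Finset.sum_le_sum fun t' _ => ?_
  refine (le_abs_self _).trans ?_
  rw [abs_mul, abs_mul]
  exact mul_le_mul_of_nonneg_left (abs_integral_mul_le (hf t) (hf t') (hK t) (hK t'))
    (by positivity)

/-- The part of the first order kernel `h_{1,i}`, evaluated at `X_j`, that comes from the tuples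
that do not contain `j` in another position. -/
noncomputable def offOne (P : Measure Ω) (X : Fin N → Ω → 𝓧) (a : (Fin m → Fin N) → ℝ)
    (h : (Fin m → 𝓧) → ℝ) (i j : Fin N) (x : 𝓧) : ℝ :=
  ∑ t : Fin m × (Fin m ↪ Fin N), offCoef a i j t * (proj P X h t.2 t.1 x - theta P X h t.2)

omit [IsProbabilityMeasure P] in
theorem hOne_eq_sum (i : Fin N) (x : 𝓧) : hOne P X a h i x =
    ∑ t : Fin m × (Fin m ↪ Fin N), coef a i t * (proj P X h t.2 t.1 x - theta P X h t.2) :=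
  sum_coef_mul a i fun l I => proj P X h I l x - theta P X h I

omit [MeasurableSpace 𝓧] in
theorem bootOne_eq_sum (x : Fin N → 𝓧) (i j : Fin N) : bootOne a h x i j =
    ∑ t : Fin m × (Fin m ↪ Fin N), coef a i t * (projAvg h x t.1 j - tupleAvg h x) :=
  sum_coef_mul a i fun l _ => projAvg h x l j - tupleAvg h x

namespace SampleBounds

theorem memLp_proj_sub (H : SampleBounds P X h B C) (j : Fin N) (t : Fin m × (Fin m ↪ Fin N)) :
    MemLp (fun ω => proj P X h t.2 t.1 (X j ω) - theta P X h t.2) 2 P :=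
  (H.memLp_proj _ _ _).sub (memLp_const (theta P X h t.2))

theorem integral_proj_sub_sq_le (H : SampleBounds P X h B C) (j : Fin N)
    (t : Fin m × (Fin m ↪ Fin N)) :
    ∫ ω, (proj P X h t.2 t.1 (X j ω) - theta P X h t.2) ^ 2 ∂P ≤ 4 * C := by
  refine (sub_sq_le (H.memLp_proj _ _ _) (memLp_const _) (H.proj_sq_le _ _ _) (L := C)
    ?_).trans_eq (by ring)
  simpa using H.theta_sq_le t.2

theorem memLp_offOne (H : SampleBounds P X h B C) (i j : Fin N) :
    MemLp (fun ω => offOne P X a h i j (X j ω)) 2 P :=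
  memLp_finsetSum _ fun t _ => (H.memLp_proj_sub j t).const_mul _

theorem memLp_hOne' (H : SampleBounds P X h B C) (i j : Fin N) :
    MemLp (fun ω => hOne P X a h i (X j ω)) 2 P := by
  simp only [hOne_eq_sum]
  exact memLp_finsetSum _ fun t _ => (H.memLp_proj_sub j t).const_mul _

omit [IsProbabilityMeasure P] in
theorem memLp_bootOne (H : SampleBounds P X h B C) (i j : Fin N) :
    MemLp (fun ω => bootOne a h (fun k => X k ω) i j) 2 P := by
  simp only [bootOne_eq_sum]
  exact memLp_finsetSum _ fun t _ => ((H.memLp_projAvg t.1 j).sub H.memLp_tupleAvg).const_mul _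

/-- The tuples that contain `j` in another position are negligible. -/
theorem sum_integral_hOne_sub_offOne_sq_le (H : SampleBounds P X h B C) :
    ∑ i, ∑ j, ∫ ω, (hOne P X a h i (X j ω) - offOne P X a h i j (X j ω)) ^ 2 ∂P ≤
      4 * C * (m : ℝ) ^ 2 * ∑ i, totalWeight a i ^ 2 := by
  have hdiff : ∀ i j ω, hOne P X a h i (X j ω) - offOne P X a h i j (X j ω) =
      ∑ t, diagCoef a i j t * (proj P X h t.2 t.1 (X j ω) - theta P X h t.2) := by
    intro i j ω
    rw [hOne_eq_sum, offOne, ← Finset.sum_sub_distrib]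
    refine Finset.sum_congr rfl fun t _ => ?_
    rw [← offCoef_add_diagCoef a i j t]; ring
  simp only [hdiff]
  rw [Finset.mul_sum]
  refine Finset.sum_le_sum fun i _ => ?_
  calc _ ≤ ∑ j, (∑ t, |diagCoef a i j t|) ^ 2 * (4 * C) := Finset.sum_le_sum fun j _ =>
        integral_weighted_sq_le _ (fun t => H.memLp_proj_sub j t)
          (fun t => H.integral_proj_sub_sq_le j t)
    _ ≤ ((m : ℝ) ^ 2 * totalWeight a i ^ 2) * (4 * C) := by
        rw [← Finset.sum_mul]
        exact mul_le_mul_of_nonneg_right (sum_abs_diagCoef_sq_le a i)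
          (mul_nonneg (by norm_num) H.nonneg_two)
    _ = _ := by ring

theorem memLp_projAvg_sub (H : SampleBounds P X h B C) (j : Fin N)
    (t : Fin m × (Fin m ↪ Fin N)) :
    MemLp (fun ω => projAvg h (fun i => X i ω) t.1 j - proj P X h t.2 t.1 (X j ω)) 2 P :=
  (H.memLp_projAvg t.1 j).sub (H.memLp_proj _ _ _)

/-- Expand the square over pairs of positioned tuples, all of which carry `i`. Pairs with only `i`
in common are almost uncorrelated; pairs with a further common index are bounded through their
second moments and charged to `sharedWeight a 2 2`. -/
theorem sum_integral_offCoef_projAvg_sub_sq_le (H : SampleBounds P X h B C) (hN : 0 < N)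
    (j : Fin N) :
    ∑ i, ∫ ω, (∑ t, offCoef a i j t *
        (projAvg h (fun k => X k ω) t.1 j - proj P X h t.2 t.1 (X j ω))) ^ 2 ∂P ≤
      (2 * crossGap P X h + 4 * C * (4 * (m : ℝ) ^ 2 + 2 * m * (2 * m + 1)) / N) *
          ∑ i, totalWeight a i ^ 2 +
        (4 * B + 2 * C * ((m : ℝ) ^ 2 + m) / N) * ((m : ℝ) ^ 2 * sharedWeight a 2 2) := by
  set K1 := 2 * crossGap P X h + 4 * C * (4 * (m : ℝ) ^ 2 + 2 * m * (2 * m + 1)) / N with hK1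
  set K2 := 4 * B + 2 * C * ((m : ℝ) ^ 2 + m) / N with hK2
  have hC := H.nonneg_two
  have hB := H.nonneg_four
  have hK1nn : 0 ≤ K1 := by
    have : 0 ≤ crossGap P X h := crossGap_nonneg
    positivity
  have hK2nn : 0 ≤ K2 := by positivity
  have hterm : ∀ i t t', offCoef a i j t * offCoef a i j t' *
      ∫ ω, (projAvg h (fun k => X k ω) t.1 j - proj P X h t.2 t.1 (X j ω)) *
        (projAvg h (fun k => X k ω) t'.1 j - proj P X h t'.2 t'.1 (X j ω)) ∂P ≤
      |coef a i t| * |coef a i t'| * K1 + K2 * (|coef a i t| * |coef a i t'| *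
        (if 2 ≤ (commonIndices ![t.2, t'.2]).card then 1 else 0)) := by
    intro i t t'
    have hrhs : 0 ≤ |coef a i t| * |coef a i t'| * K1 + K2 * (|coef a i t| * |coef a i t'| *
        (if 2 ≤ (commonIndices ![t.2, t'.2]).card then 1 else 0)) := by
      have : (0 : ℝ) ≤ if 2 ≤ (commonIndices ![t.2, t'.2]).card then 1 else 0 := by
        split_ifs <;> norm_num
      positivity
    by_cases ht : OffDiag j t
    swap
    · rw [show offCoef a i j t = 0 from if_neg ht]; simpa using hrhs
    by_cases ht' : OffDiag j t'
    swap
    · rw [show offCoef a i j t' = 0 from if_neg ht']; simpa using hrhs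
    by_cases hi : t.2 t.1 = i
    swap
    · rw [show offCoef a i j t = 0 by simp [offCoef, coef, hi]]; simpa using hrhs
    by_cases hi' : t'.2 t'.1 = i
    swap
    · rw [show offCoef a i j t' = 0 by simp [offCoef, coef, hi']]; simpa using hrhs
    refine (le_abs_self _).trans ?_
    rw [abs_mul, abs_mul, show offCoef a i j t = coef a i t from if_pos ht,
      show offCoef a i j t' = coef a i t' from if_pos ht']
    have hnn : 0 ≤ |coef a i t| * |coef a i t'| := by positivity
    split_ifs with hcard
    · have hsq : ∀ s, OffDiag j s → ∫ ω, (projAvg h (fun k => X k ω) s.1 j -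
          proj P X h s.2 s.1 (X j ω)) ^ 2 ∂P ≤ K2 := fun s hs =>
        (sub_sq_le (H.memLp_projAvg s.1 j) (H.memLp_proj _ _ _)
          (H.integral_projAvg_sq_le' hN s.1 j) (H.proj_sq_le_of_forall_ne _ _ _ hs)).trans_eq
          (by rw [hK2]; ring)
      have := abs_integral_mul_le (H.memLp_projAvg_sub j t) (H.memLp_projAvg_sub j t')
        (hsq t ht) (hsq t' ht')
      have h1 := mul_le_mul_of_nonneg_left this hnn
      have h2 := mul_nonneg hnn hK1nn
      linarith
    · have := H.abs_integral_projAvg_sub_mul_le hN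
        (meetAt_of_card_lt_two (hi.trans hi'.symm) (not_le.1 hcard)) j ht ht'
      have h1 := mul_le_mul_of_nonneg_left this hnn
      linarith
  calc _ ≤ ∑ i, ∑ t, ∑ t', (|coef a i t| * |coef a i t'| * K1 + K2 *
        (|coef a i t| * |coef a i t'| *
        (if 2 ≤ (commonIndices ![t.2, t'.2]).card then 1 else 0))) := by
        refine Finset.sum_le_sum fun i _ => ?_
        rw [integral_sum_sq _ _ fun t _ => H.memLp_projAvg_sub j t]
        exact Finset.sum_le_sum fun t _ => Finset.sum_le_sum fun t' _ => hterm i t t'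
    _ = K1 * ∑ i, totalWeight a i ^ 2 + K2 * ∑ i, ∑ t, ∑ t', |coef a i t| * |coef a i t'| *
        (if 2 ≤ (commonIndices ![t.2, t'.2]).card then 1 else 0) := by
        simp only [Finset.sum_add_distrib, ← Finset.sum_mul, ← Finset.mul_sum, totalWeight,
          pow_two]
        ring
    _ ≤ _ := by
        gcongr
        exact sum_coef_pair_le a

/-- The first order kernels under the bootstrap distribution are close to the true ones. -/
theorem sum_integral_bootOne_sub_hOne_sq_le (H : SampleBounds P X h B C) (hN : 0 < N) :
    ∑ i, ∑ j, ∫ ω, (bootOne a h (fun k => X k ω) i j - hOne P X a h i (X j ω)) ^ 2 ∂P ≤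
      3 * (N * ((2 * crossGap P X h + 4 * C * (4 * (m : ℝ) ^ 2 + 2 * m * (2 * m + 1)) / N) *
          ∑ i, totalWeight a i ^ 2 +
        (4 * B + 2 * C * ((m : ℝ) ^ 2 + m) / N) * ((m : ℝ) ^ 2 * sharedWeight a 2 2)) +
        4 * C * (m : ℝ) ^ 2 * ∑ i, totalWeight a i ^ 2 +
        N * ((meanGap P X h ^ 2 + 4 * C * (4 * (m : ℝ) ^ 2) / N) *
          ∑ i, totalWeight a i ^ 2)) := by
  -- `f1` collects the off-diagonal terms, where decorrelation helps; `f2` the diagonal ones, which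
  -- have only a crude bound but lack the factor `N`; `f3` the error in the centring.
  set f1 : Fin N → Fin N → Ω → ℝ := fun i j ω => ∑ t, offCoef a i j t *
    (projAvg h (fun k => X k ω) t.1 j - proj P X h t.2 t.1 (X j ω)) with hf1
  set f2 : Fin N → Fin N → Ω → ℝ := fun i j ω => ∑ t, diagCoef a i j t *
    (projAvg h (fun k => X k ω) t.1 j - proj P X h t.2 t.1 (X j ω)) with hf2
  set f3 : Fin N → Fin N → Ω → ℝ := fun i _ ω => ∑ t, coef a i t *
    (tupleAvg h (fun k => X k ω) - theta P X h t.2) with hf3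
  have hdiff : ∀ i j ω, bootOne a h (fun k => X k ω) i j - hOne P X a h i (X j ω) =
      f1 i j ω + f2 i j ω - f3 i j ω := by
    intro i j ω
    simp only [hf1, hf2, hf3]
    rw [hOne_eq_sum, bootOne_eq_sum, ← Finset.sum_sub_distrib, ← Finset.sum_add_distrib,
      ← Finset.sum_sub_distrib]
    refine Finset.sum_congr rfl fun t _ => ?_
    rw [← offCoef_add_diagCoef a i j t]; ring
  have m1 : ∀ i j, MemLp (f1 i j) 2 P := fun i j =>
    memLp_finsetSum _ fun t _ => (H.memLp_projAvg_sub j t).const_mul _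
  have m2 : ∀ i j, MemLp (f2 i j) 2 P := fun i j =>
    memLp_finsetSum _ fun t _ => (H.memLp_projAvg_sub j t).const_mul _
  have m3' : ∀ t : Fin m × (Fin m ↪ Fin N),
      MemLp (fun ω => tupleAvg h (fun k => X k ω) - theta P X h t.2) 2 P := fun t =>
    H.memLp_tupleAvg.sub (memLp_const (theta P X h t.2))
  have m3 : ∀ i j, MemLp (f3 i j) 2 P := fun i j =>
    memLp_finsetSum _ fun t _ => (m3' t).const_mul _
  have hsplit : ∀ i j, ∫ ω, (bootOne a h (fun k => X k ω) i j - hOne P X a h i (X j ω)) ^ 2 ∂P ≤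
      3 * (∫ ω, f1 i j ω ^ 2 ∂P + ∫ ω, f2 i j ω ^ 2 ∂P + ∫ ω, f3 i j ω ^ 2 ∂P) := by
    intro i j
    have i1 := (m1 i j).integrable_sq
    have i2 := (m2 i j).integrable_sq
    have i3 := (m3 i j).integrable_sq
    have i12 : Integrable (fun ω => f1 i j ω ^ 2 + f2 i j ω ^ 2) P := i1.add i2
    have i123 : Integrable (fun ω => f1 i j ω ^ 2 + f2 i j ω ^ 2 + f3 i j ω ^ 2) P := i12.add i3
    rw [← integral_add i1 i2, ← integral_add i12 i3, ← integral_const_mul]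
    simp only [hdiff]
    refine integral_mono (((m1 i j).add (m2 i j)).sub (m3 i j)).integrable_sq
      (i123.const_mul 3) fun ω => ?_
    simp only
    nlinarith [sq_nonneg (f1 i j ω - f2 i j ω), sq_nonneg (f1 i j ω + f3 i j ω),
      sq_nonneg (f2 i j ω + f3 i j ω)]
  have b1 : ∑ i, ∑ j, ∫ ω, f1 i j ω ^ 2 ∂P ≤ (Finset.univ : Finset (Fin N)).card •
      ((2 * crossGap P X h + 4 * C * (4 * (m : ℝ) ^ 2 + 2 * m * (2 * m + 1)) / N) *
          ∑ i, totalWeight a i ^ 2 +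
        (4 * B + 2 * C * ((m : ℝ) ^ 2 + m) / N) * ((m : ℝ) ^ 2 * sharedWeight a 2 2)) := by
    rw [Finset.sum_comm]
    exact (Finset.sum_le_card_nsmul _ _ _ fun j _ =>
      H.sum_integral_offCoef_projAvg_sub_sq_le hN j)
  have b2 : ∑ i, ∑ j, ∫ ω, f2 i j ω ^ 2 ∂P ≤ 4 * C * (m : ℝ) ^ 2 * ∑ i, totalWeight a i ^ 2 := by
    rw [Finset.mul_sum]
    refine Finset.sum_le_sum fun i _ => ?_
    calc _ ≤ ∑ j, (∑ t, |diagCoef a i j t|) ^ 2 * (4 * C) := Finset.sum_le_sum fun j _ =>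
          integral_weighted_sq_le _ (fun t => H.memLp_projAvg_sub j t) fun t =>
            (sub_sq_le (H.memLp_projAvg _ _) (H.memLp_proj _ _ _)
              (H.integral_projAvg_sq_le hN _ _) (H.proj_sq_le _ _ _)).trans_eq (by ring)
      _ ≤ ((m : ℝ) ^ 2 * totalWeight a i ^ 2) * (4 * C) := by
          rw [← Finset.sum_mul]
          exact mul_le_mul_of_nonneg_right (sum_abs_diagCoef_sq_le a i)
            (mul_nonneg (by norm_num) H.nonneg_two)
      _ = _ := by ring
  have b3 : ∑ i, ∑ j, ∫ ω, f3 i j ω ^ 2 ∂P ≤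
      N * ((meanGap P X h ^ 2 + 4 * C * (4 * (m : ℝ) ^ 2) / N) *
          ∑ i, totalWeight a i ^ 2) := by
    rw [Finset.mul_sum, Finset.mul_sum]
    refine Finset.sum_le_sum fun i _ => ?_
    refine (Finset.sum_le_card_nsmul _ _ _ fun j _ =>
      integral_weighted_sq_le _ m3' fun t => H.integral_tupleAvg_sub_sq_le hN t.2).trans_eq ?_
    rw [Finset.card_univ, Fintype.card_fin, nsmul_eq_mul, totalWeight]
    ring
  refine (Finset.sum_le_sum fun i _ => Finset.sum_le_sum fun j _ => hsplit i j).trans ?_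
  simp only [← Finset.mul_sum, Finset.sum_add_distrib]
  rw [Finset.card_univ, Fintype.card_fin, nsmul_eq_mul] at b1
  gcongr

end SampleBounds

end Compare

/-! ### Concentration of the off-diagonal sum of squares -/

section Variance

variable {𝓧 : Type*} [MeasurableSpace 𝓧] {m N : ℕ} {Ω : Type*} [MeasurableSpace Ω]
  {P : Measure Ω} [IsProbabilityMeasure P] {X : Fin N → Ω → 𝓧} {h : (Fin m → 𝓧) → ℝ}
  {B C : ℝ} {a : (Fin m → Fin N) → ℝ}

-- Cauchy–Schwarz twice: over the tuples for fixed `i`, then over all pairs of `i` and a positioned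
-- tuple, with the coefficients as weights. Only fourth powers with nonzero off-diagonal weight
-- remain.
omit [IsProbabilityMeasure P] in
theorem sum_offOne_sq_sq_le (j : Fin N) (x : 𝓧) :
    (∑ i, offOne P X a h i j x ^ 2) ^ 2 ≤ (∑ i, totalWeight a i ^ 2) *
      ∑ i, totalWeight a i * ∑ t, |offCoef a i j t| *
        (proj P X h t.2 t.1 x - theta P X h t.2) ^ 4 := by
  set z : Fin m × (Fin m ↪ Fin N) → ℝ := fun t => proj P X h t.2 t.1 x - theta P X h t.2 with hz
  set v : Fin N × (Fin m × (Fin m ↪ Fin N)) → ℝ :=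
    fun s => totalWeight a s.1 * |offCoef a s.1 j s.2| with hv
  have hv0 : ∀ s, 0 ≤ v s := fun s => mul_nonneg (totalWeight_nonneg _ _) (abs_nonneg _)
  have htw : ∀ i, ∑ t, |offCoef a i j t| ≤ totalWeight a i := fun i =>
    Finset.sum_le_sum fun t _ => abs_offCoef_le a i j t
  have h1 : ∑ i, offOne P X a h i j x ^ 2 ≤ ∑ s, v s * z s.2 ^ 2 := by
    rw [Fintype.sum_prod_type]
    refine Finset.sum_le_sum fun i _ => ?_
    have := Finset.sum_sq_le_sum_mul_sum_of_sq_le_mul Finset.univ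
      (r := fun t => offCoef a i j t * z t) (f := fun t => |offCoef a i j t|)
      (g := fun t => |offCoef a i j t| * z t ^ 2) (fun t _ => abs_nonneg _)
      (fun t _ => by positivity) (fun t _ => by
        rw [mul_pow, ← sq_abs (offCoef a i j t)]; exact le_of_eq (by ring))
    refine this.trans ?_
    simp only [hv, mul_assoc, ← Finset.mul_sum]
    exact mul_le_mul_of_nonneg_right (htw i) (Finset.sum_nonneg fun t _ => by positivity)
  have h2 : (∑ s, v s * z s.2 ^ 2) ^ 2 ≤ (∑ s, v s) * ∑ s, v s * z s.2 ^ 4 :=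
    Finset.sum_sq_le_sum_mul_sum_of_sq_le_mul Finset.univ (fun s _ => hv0 s)
      (fun s _ => mul_nonneg (hv0 s) (by positivity))
      (fun s _ => le_of_eq (by ring))
  have h3 : ∑ s, v s ≤ ∑ i, totalWeight a i ^ 2 := by
    rw [Fintype.sum_prod_type]
    refine Finset.sum_le_sum fun i _ => ?_
    simp only [hv, ← Finset.mul_sum]
    rw [pow_two]
    exact mul_le_mul_of_nonneg_left (htw i) (totalWeight_nonneg _ _)
  have h4 : ∑ s, v s * z s.2 ^ 4 = ∑ i, totalWeight a i * ∑ t, |offCoef a i j t| * z t ^ 4 := by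
    rw [Fintype.sum_prod_type]
    simp only [hv, mul_assoc, ← Finset.mul_sum]
  rw [← h4]
  refine (pow_le_pow_left₀ (Finset.sum_nonneg fun i _ => sq_nonneg _) h1 2).trans (h2.trans ?_)
  exact mul_le_mul_of_nonneg_right h3
    (Finset.sum_nonneg fun s _ => mul_nonneg (hv0 s) (by positivity))

namespace SampleBounds

/-- A nonzero coefficient guarantees distinct indices, hence a fourth moment. The factor `16` comes
from `(x - y) ^ 4 ≤ 8 * (x ^ 4 + y ^ 4)` with both terms at most `B ^ 2`. -/
theorem offCoef_proj_sub_four (H : SampleBounds P X h B C) (i j : Fin N)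
    (t : Fin m × (Fin m ↪ Fin N)) :
    Integrable (fun ω => |offCoef a i j t| *
      (proj P X h t.2 t.1 (X j ω) - theta P X h t.2) ^ 4) P ∧
    ∫ ω, |offCoef a i j t| * (proj P X h t.2 t.1 (X j ω) - theta P X h t.2) ^ 4 ∂P ≤
      |coef a i t| * (16 * B ^ 2) := by
  by_cases ht : OffDiag j t
  · have h4 := H.proj_four t.2 t.1 j ht
    have hdom : Integrable (fun ω => 8 * (proj P X h t.2 t.1 (X j ω) ^ 4 +
        theta P X h t.2 ^ 4)) P := (h4.1.add (integrable_const _)).const_mul 8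
    have hpt : ∀ ω, (proj P X h t.2 t.1 (X j ω) - theta P X h t.2) ^ 4 ≤
        8 * (proj P X h t.2 t.1 (X j ω) ^ 4 + theta P X h t.2 ^ 4) := fun ω => by
      set x := proj P X h t.2 t.1 (X j ω)
      set y := theta P X h t.2
      nlinarith [sq_nonneg (x + y), sq_nonneg (x ^ 2 - y ^ 2), sq_nonneg (x - y),
        mul_nonneg (sq_nonneg (x + y)) (sq_nonneg (x - y)), sq_nonneg ((x + y) ^ 2),
        mul_nonneg (sq_nonneg (x + y)) (add_nonneg (sq_nonneg x) (sq_nonneg y)),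
        mul_nonneg (sq_nonneg (x + y)) (sq_nonneg (x + y))]
    have hi : Integrable (fun ω => (proj P X h t.2 t.1 (X j ω) - theta P X h t.2) ^ 4) P := by
      refine hdom.mono' (((H.measurable_proj t.2 t.1 j).sub_const _).pow_const 4).aestronglyMeasurable
        (.of_forall fun ω => ?_)
      rw [Real.norm_eq_abs, abs_of_nonneg (by positivity)]
      exact hpt ω
    refine ⟨hi.const_mul _, ?_⟩
    rw [integral_const_mul]
    refine mul_le_mul (abs_offCoef_le a i j t) ?_ (integral_nonneg fun ω => by positivity)
      (abs_nonneg _)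
    refine (integral_mono hi hdom hpt).trans ?_
    rw [integral_const_mul, integral_add h4.1 (integrable_const _)]
    have := H.theta_four_le t.2
    simp only [integral_const, probReal_univ, one_smul]
    linarith [h4.2]
  · have : offCoef a i j t = 0 := if_neg ht
    simp only [this, abs_zero, zero_mul, integral_zero]
    exact ⟨integrable_zero _ _ _, by positivity⟩

theorem sum_offOne_sq_second_moment (H : SampleBounds P X h B C) (j : Fin N) :
    MemLp (fun ω => ∑ i, offOne P X a h i j (X j ω) ^ 2) 2 P ∧
    ∫ ω, (∑ i, offOne P X a h i j (X j ω) ^ 2) ^ 2 ∂P ≤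
      16 * B ^ 2 * (∑ i, totalWeight a i ^ 2) ^ 2 := by
  have hint : ∀ i ∈ Finset.univ, Integrable (fun ω => totalWeight a i * ∑ t, |offCoef a i j t| *
      (proj P X h t.2 t.1 (X j ω) - theta P X h t.2) ^ 4) P := fun i _ =>
    (integrable_finsetSum _ fun t _ => (H.offCoef_proj_sub_four i j t).1).const_mul _
  have hdom : Integrable (fun ω => (∑ i, totalWeight a i ^ 2) * ∑ i, totalWeight a i *
      ∑ t, |offCoef a i j t| * (proj P X h t.2 t.1 (X j ω) - theta P X h t.2) ^ 4) P :=
    (integrable_finsetSum _ hint).const_mul _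
  have hm : Measurable fun ω => ∑ i, offOne P X a h i j (X j ω) ^ 2 := by
    refine Finset.measurable_sum _ fun i _ => Measurable.pow_const ?_ 2
    exact Finset.measurable_sum _ fun t _ => ((H.measurable_proj t.2 t.1 j).sub_const _).const_mul _
  have hsq : Integrable (fun ω => (∑ i, offOne P X a h i j (X j ω) ^ 2) ^ 2) P := by
    refine hdom.mono' (hm.pow_const 2).aestronglyMeasurable (.of_forall fun ω => ?_)
    rw [Real.norm_eq_abs, abs_of_nonneg (sq_nonneg _)]
    exact sum_offOne_sq_sq_le j (X j ω)
  refine ⟨(memLp_two_iff_integrable_sq hm.aestronglyMeasurable).2 hsq, ?_⟩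
  refine (integral_mono hsq hdom fun ω => sum_offOne_sq_sq_le j (X j ω)).trans ?_
  rw [integral_const_mul, integral_finsetSum _ hint]
  have hle : ∀ i, ∫ ω, totalWeight a i * ∑ t, |offCoef a i j t| *
      (proj P X h t.2 t.1 (X j ω) - theta P X h t.2) ^ 4 ∂P ≤
      totalWeight a i ^ 2 * (16 * B ^ 2) := by
    intro i
    rw [integral_const_mul, integral_finsetSum _ fun t _ => (H.offCoef_proj_sub_four i j t).1,
      pow_two, mul_assoc]
    refine mul_le_mul_of_nonneg_left ?_ (totalWeight_nonneg _ _)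
    refine (Finset.sum_le_sum fun t _ => (H.offCoef_proj_sub_four i j t).2).trans_eq ?_
    rw [← Finset.sum_mul, totalWeight]
  calc _ ≤ (∑ i, totalWeight a i ^ 2) * ∑ i, totalWeight a i ^ 2 * (16 * B ^ 2) := by
        refine mul_le_mul_of_nonneg_left (Finset.sum_le_sum fun i _ => hle i)
          (Finset.sum_nonneg fun i _ => sq_nonneg _)
    _ = _ := by rw [← Finset.sum_mul]; ring

/-- The inner sum for `j` depends on `X j` alone, so the variances add. -/
theorem variance_sum_offOne_sq_le (H : SampleBounds P X h B C) :
    MemLp (fun ω => ∑ j, ∑ i, offOne P X a h i j (X j ω) ^ 2) 2 P ∧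
    variance (fun ω => ∑ j, ∑ i, offOne P X a h i j (X j ω) ^ 2) P ≤
      N * (16 * B ^ 2 * (∑ i, totalWeight a i ^ 2) ^ 2) := by
  have hm : ∀ j, Measurable fun x => ∑ i, offOne P X a h i j x ^ 2 := by
    intro j
    refine Finset.measurable_sum _ fun i _ => Measurable.pow_const ?_ 2
    exact Finset.measurable_sum _ fun t _ => ((WeightedU.measurable_proj H.measurable_sample
      H.measurable_kernel t.2 t.1).sub_const _).const_mul _
  refine ⟨memLp_finsetSum _ fun j _ => (H.sum_offOne_sq_second_moment j).1, ?_⟩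
  have := IndepFun.variance_sum (μ := P)
    (X := fun j ω => ∑ i, offOne P X a h i j (X j ω) ^ 2) (s := Finset.univ)
    (fun j _ => (H.sum_offOne_sq_second_moment j).1)
    (fun i _ j _ hij => (H.indep.indepFun hij).comp (hm i) (hm j))
  rw [show (∑ j, fun ω => ∑ i, offOne P X a h i j (X j ω) ^ 2) =
    fun ω => ∑ j, ∑ i, offOne P X a h i j (X j ω) ^ 2 by ext ω; simp] at this
  rw [this]
  refine (Finset.sum_le_card_nsmul _ _ (16 * B ^ 2 * (∑ i, totalWeight a i ^ 2) ^ 2)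
    fun j _ => ?_).trans_eq (by simp)
  exact (variance_le_expectation_sq (H.sum_offOne_sq_second_moment j).1.aestronglyMeasurable).trans
    (H.sum_offOne_sq_second_moment j).2

end SampleBounds

end Variance

/-! ### From convergence in probability to convergence in L¹ -/

section Convergence

/-- Termwise `x² - y² = 2y(x - y) + (x - y)²`, with Young's inequality at parameter `δ` on the cross
term. -/
theorem abs_sum_sq_sub_le {ι : Type*} [Fintype ι] (x y : ι → ℝ) {δ : ℝ} (hδ : 0 < δ) :
    |∑ t, x t ^ 2 - ∑ t, y t ^ 2| ≤ δ * ∑ t, y t ^ 2 + (δ⁻¹ + 1) * ∑ t, (x t - y t) ^ 2 := by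
  rw [← Finset.sum_sub_distrib, Finset.mul_sum, Finset.mul_sum, ← Finset.sum_add_distrib]
  refine (Finset.abs_sum_le_sum_abs _ _).trans (Finset.sum_le_sum fun t _ => ?_)
  have hs : δ * δ⁻¹ = 1 := mul_inv_cancel₀ hδ.ne'
  have h1 : 0 ≤ δ * (y t - δ⁻¹ * (x t - y t)) ^ 2 := by positivity
  have h2 : 0 ≤ δ * (y t + δ⁻¹ * (x t - y t)) ^ 2 := by positivity
  have e1 : δ * (y t - δ⁻¹ * (x t - y t)) ^ 2 = δ * y t ^ 2 - 2 * (δ * δ⁻¹) * (y t * (x t - y t)) +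
    (δ * δ⁻¹) * δ⁻¹ * (x t - y t) ^ 2 := by ring
  have e2 : δ * (y t + δ⁻¹ * (x t - y t)) ^ 2 = δ * y t ^ 2 + 2 * (δ * δ⁻¹) * (y t * (x t - y t)) +
    (δ * δ⁻¹) * δ⁻¹ * (x t - y t) ^ 2 := by ring
  rw [e1, hs] at h1
  rw [e2, hs] at h2
  rw [abs_le]
  constructor <;> nlinarith [sq_nonneg (x t - y t)]

variable {Ω : ℕ → Type*} [∀ n, MeasurableSpace (Ω n)] {P : ∀ n, Measure (Ω n)}
  [∀ n, IsProbabilityMeasure (P n)]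

theorem tendstoInProb_of_integral {Y : ∀ n, Ω n → ℝ} {c : ℝ}
    (hi : ∀ᶠ n in atTop, Integrable (fun ω => |Y n ω - c|) (P n))
    (hY : Tendsto (fun n => ∫ ω, |Y n ω - c| ∂(P n)) atTop (𝓝 0)) : TendstoInProb P Y c := by
  intro ε hε
  have hlim : Tendsto (fun n => ENNReal.ofReal (ε⁻¹ * ∫ ω, |Y n ω - c| ∂(P n))) atTop (𝓝 0) := by
    have := ENNReal.tendsto_ofReal (hY.const_mul ε⁻¹)
    simpa using this
  refine tendsto_of_tendsto_of_tendsto_of_le_of_le' tendsto_const_nhds hlim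
    (.of_forall fun _ => zero_le) ?_
  filter_upwards [hi] with n hn
  rw [← ofReal_measureReal]
  refine ENNReal.ofReal_le_ofReal ?_
  have := mul_meas_ge_le_integral_of_nonneg (μ := P n) (.of_forall fun ω => abs_nonneg (Y n ω - c))
    hn ε
  rwa [inv_mul_eq_div, le_div_iff₀ hε, mul_comm]

omit [∀ n, IsProbabilityMeasure (P n)] in
theorem TendstoInProb.of_le_of_le {Y Z W : ∀ n, Ω n → ℝ} {c d e : ℝ} (hZ : TendstoInProb P Z d)
    (hW : TendstoInProb P W e)
    (hsub : ∀ ε, 0 < ε → ∃ η, 0 < η ∧ ∃ η', 0 < η' ∧ ∀ n ω,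
      |Z n ω - d| < η → |W n ω - e| < η' → |Y n ω - c| < ε) : TendstoInProb P Y c := by
  intro ε hε
  obtain ⟨η, hη, η', hη', hs⟩ := hsub ε hε
  have hlim := (hZ η hη).add (hW η' hη')
  rw [add_zero] at hlim
  refine tendsto_of_tendsto_of_tendsto_of_le_of_le tendsto_const_nhds hlim
    (fun _ => zero_le) fun n => ?_
  refine (measure_mono fun ω hω => ?_).trans (measure_union_le _ _)
  by_contra hcon
  simp only [Set.mem_union, Set.mem_ofPred_eq, not_or, not_le] at hcon
  exact absurd hω (not_le.2 (hs n ω hcon.1 hcon.2))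

theorem abs_integral_sub_le_sqrt_variance {α : Type*} [MeasurableSpace α] {μ : Measure α}
    [IsProbabilityMeasure μ] {f : α → ℝ} (hf : MemLp f 2 μ) :
    ∫ x, |f x - ∫ y, f y ∂μ| ∂μ ≤ √(variance f μ) := by
  have hsub : MemLp (fun x => f x - ∫ y, f y ∂μ) 2 μ := hf.sub (memLp_const _)
  refine Real.le_sqrt_of_sq_le ?_
  rw [variance_eq_integral hf.aestronglyMeasurable.aemeasurable]
  have := pow_integral_le (μ := μ) (f := fun x => |f x - ∫ y, f y ∂μ|) even_two two_ne_zero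
    hsub.aestronglyMeasurable.norm (by simpa only [sq_abs] using hsub.integrable_sq)
  simpa only [sq_abs] using this

/-- If the sum of squares of an array tends to `1` in probability, and the array is close in `L²`
to an array whose sum of squares has small variance, then every array close to it in `L²` has a
sum of squares that tends to `1` in `L¹`. -/
theorem tendsto_integral_abs_sum_sq_sub_one {ι : ℕ → Type*} [∀ n, Fintype (ι n)]
    {A D G : ∀ n, ι n → Ω n → ℝ}
    (hA : ∀ᶠ n in atTop, ∀ t, MemLp (A n t) 2 (P n))
    (hD : ∀ᶠ n in atTop, ∀ t, MemLp (D n t) 2 (P n))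
    (hG : ∀ᶠ n in atTop, ∀ t, MemLp (G n t) 2 (P n))
    (hG2 : ∀ᶠ n in atTop, MemLp (fun ω => ∑ t, G n t ω ^ 2) 2 (P n))
    (hone : TendstoInProb P (fun n ω => ∑ t, A n t ω ^ 2) 1)
    (hDA : Tendsto (fun n => ∑ t, ∫ ω, (D n t ω - A n t ω) ^ 2 ∂(P n)) atTop (𝓝 0))
    (hAG : Tendsto (fun n => ∑ t, ∫ ω, (A n t ω - G n t ω) ^ 2 ∂(P n)) atTop (𝓝 0))
    (hvar : Tendsto (fun n => variance (fun ω => ∑ t, G n t ω ^ 2) (P n)) atTop (𝓝 0)) :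
    Tendsto (fun n => ∫ ω, |∑ t, D n t ω ^ 2 - 1| ∂(P n)) atTop (𝓝 0) := by
  set g : ℕ → ℝ := fun n => ∫ ω, ∑ t, G n t ω ^ 2 ∂(P n) with hg
  -- convergence in probability of the sum of squares of `G`
  have hAGint : ∀ᶠ n in atTop, Integrable (fun ω => ∑ t, (A n t ω - G n t ω) ^ 2) (P n) := by
    filter_upwards [hA, hG] with n h1 h2
    exact integrable_finsetSum _ fun t _ => ((h1 t).sub (h2 t)).integrable_sq
  have hAGprob : TendstoInProb P (fun n ω => ∑ t, (A n t ω - G n t ω) ^ 2) 0 := by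
    refine tendstoInProb_of_integral ?_ ?_
    · filter_upwards [hAGint] with n hn
      simpa using hn.abs
    · refine hAG.congr' ?_
      filter_upwards [hA, hG] with n h1 h2
      have hi : ∀ t ∈ Finset.univ, Integrable (fun ω => (A n t ω - G n t ω) ^ 2) (P n) :=
        fun t _ => ((h1 t).sub (h2 t)).integrable_sq
      rw [← integral_finsetSum _ hi]
      refine integral_congr_ae (.of_forall fun ω => ?_)
      simp only [sub_zero]
      rw [abs_of_nonneg (Finset.sum_nonneg fun t _ => sq_nonneg _)]
  have hGprob : TendstoInProb P (fun n ω => ∑ t, G n t ω ^ 2) 1 := by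
    refine hone.of_le_of_le hAGprob fun ε hε => ?_
    -- The threshold `1` keeps the sum for `A` below `2`, so the comparison costs less than `2 * (ε
    -- / 8) + ε / 4`; the last `ε / 4` is the distance of that sum from `1`.
    have hδ : 0 < ε / 8 := by positivity
    refine ⟨min (ε / 4) 1, by positivity, ε / 4 / ((ε / 8)⁻¹ + 1), by positivity,
      fun n ω h1 h2 => ?_⟩
    have h3 := abs_sum_sq_sub_le (fun t => G n t ω) (fun t => A n t ω) hδ
    simp only [sub_sq_comm (G n _ ω)] at h3
    rw [sub_zero, lt_div_iff₀ (by positivity), abs_of_nonneg (Finset.sum_nonneg fun t _ =>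
      sq_nonneg _)] at h2
    have h4 := lt_min_iff.1 h1
    have h5 := abs_lt.1 h4.2
    have h6 := abs_sub_le (∑ t, G n t ω ^ 2) (∑ t, A n t ω ^ 2) 1
    nlinarith [h4.1, mul_lt_mul_of_pos_left (show ∑ t, A n t ω ^ 2 < 2 by linarith [h5.2]) hδ]
  -- convergence of the means
  have hdev : Tendsto (fun n => ∫ ω, |(∑ t, G n t ω ^ 2) - g n| ∂(P n)) atTop (𝓝 0) := by
    have hs : Tendsto (fun n => √(variance (fun ω => ∑ t, G n t ω ^ 2) (P n))) atTop (𝓝 0) := by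
      simpa using hvar.sqrt
    refine tendsto_of_tendsto_of_tendsto_of_le_of_le' tendsto_const_nhds hs
      (.of_forall fun n => integral_nonneg fun ω => abs_nonneg _) ?_
    filter_upwards [hG2] with n hn
    exact abs_integral_sub_le_sqrt_variance hn
  have hdevprob : TendstoInProb P (fun n ω => ∑ t, G n t ω ^ 2 - g n) 0 := by
    refine tendstoInProb_of_integral ?_ (by simpa using hdev)
    filter_upwards [hG2] with n hn
    simpa using ((hn.integrable one_le_two).sub (integrable_const (g n))).abs
  have hg1 : Tendsto g atTop (𝓝 1) := by
    rw [Metric.tendsto_atTop']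
    intro ε hε
    have e1 := (hGprob (ε / 2) (by positivity)).eventually_lt_const (u := 2⁻¹) (by simp)
    have e2 := (hdevprob (ε / 2) (by positivity)).eventually_lt_const (u := 2⁻¹) (by simp)
    obtain ⟨n0, hn0⟩ := eventually_atTop.1 (e1.and e2)
    refine ⟨n0, fun n hn => ?_⟩
    obtain ⟨h1, h2⟩ := hn0 n hn.le
    -- Two events of probability below one half cannot cover the space; at a point outside both, the
    -- deterministic `g n` is within `ε` of `1`.
    have hex : ∃ ω, ω ∉ {ω | ε / 2 ≤ |∑ t, G n t ω ^ 2 - 1|} ∪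
        {ω | ε / 2 ≤ |∑ t, G n t ω ^ 2 - g n - 0|} := by
      by_contra hcon
      push Not at hcon
      have huniv := Set.eq_univ_of_forall hcon
      have hlt : P n Set.univ < 1 := by
        rw [← huniv]
        refine (measure_union_le _ _).trans_lt ((ENNReal.add_lt_add h1 h2).trans_eq ?_)
        exact ENNReal.inv_two_add_inv_two
      simp at hlt
    obtain ⟨ω, hω⟩ := hex
    simp only [Set.mem_union, Set.mem_ofPred_eq, not_or, not_le, sub_zero] at hω
    rw [Real.dist_eq]
    have := abs_sub_le (g n) (∑ t, G n t ω ^ 2) 1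
    rw [abs_sub_comm (g n) (∑ t, G n t ω ^ 2)] at this
    linarith [hω.1, hω.2]
  -- comparison of `D` and `G`
  have hDG : Tendsto (fun n => ∑ t, ∫ ω, (D n t ω - G n t ω) ^ 2 ∂(P n)) atTop (𝓝 0) := by
    have hlim := (hDA.const_mul 2).add (hAG.const_mul 2)
    simp only [mul_zero, add_zero] at hlim
    refine tendsto_of_tendsto_of_tendsto_of_le_of_le' tendsto_const_nhds hlim
      (.of_forall fun n => Finset.sum_nonneg fun t _ => integral_nonneg fun ω => sq_nonneg _) ?_
    filter_upwards [hA, hD, hG] with n h1 h2 h3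
    rw [Finset.mul_sum, Finset.mul_sum, ← Finset.sum_add_distrib]
    refine Finset.sum_le_sum fun t _ => ?_
    have i1 : Integrable (fun ω => (D n t ω - A n t ω) ^ 2) (P n) :=
      ((h2 t).sub (h1 t)).integrable_sq
    have i2 : Integrable (fun ω => (A n t ω - G n t ω) ^ 2) (P n) :=
      ((h1 t).sub (h3 t)).integrable_sq
    rw [← integral_const_mul, ← integral_const_mul, ← integral_add (i1.const_mul 2) (i2.const_mul 2)]
    refine integral_mono ((h2 t).sub (h3 t)).integrable_sq
      ((i1.const_mul 2).add (i2.const_mul 2)) fun ω => ?_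
    simp only
    nlinarith [sq_nonneg (D n t ω - A n t ω - (A n t ω - G n t ω))]
  -- For fixed `δ` the right side tends to `δ`; the choice `δ = ε / 2` finishes.
  have hbound : ∀ δ, 0 < δ → ∀ᶠ n in atTop, ∫ ω, |∑ t, D n t ω ^ 2 - 1| ∂(P n) ≤
      δ * g n + (δ⁻¹ + 1) * ∑ t, ∫ ω, (D n t ω - G n t ω) ^ 2 ∂(P n) +
        ∫ ω, |(∑ t, G n t ω ^ 2) - g n| ∂(P n) + |g n - 1| := by
    intro δ hδ
    filter_upwards [hD, hG, hG2] with n h2 h3 h4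
    have i1 : Integrable (fun ω => ∑ t, G n t ω ^ 2) (P n) := h4.integrable one_le_two
    have i2' : ∀ t ∈ Finset.univ, Integrable (fun ω => (D n t ω - G n t ω) ^ 2) (P n) :=
      fun t _ => ((h2 t).sub (h3 t)).integrable_sq
    have i2 : Integrable (fun ω => ∑ t, (D n t ω - G n t ω) ^ 2) (P n) :=
      integrable_finsetSum _ i2'
    have i3 : Integrable (fun ω => |(∑ t, G n t ω ^ 2) - g n|) (P n) :=
      (i1.sub (integrable_const (g n))).abs
    have i4 : Integrable (fun ω => |∑ t, D n t ω ^ 2 - 1|) (P n) :=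
      ((integrable_finsetSum _ fun t _ => (h2 t).integrable_sq).sub (integrable_const (1 : ℝ))).abs
    have i12 : Integrable (fun ω => δ * ∑ t, G n t ω ^ 2 +
        (δ⁻¹ + 1) * ∑ t, (D n t ω - G n t ω) ^ 2) (P n) := (i1.const_mul _).add (i2.const_mul _)
    have i123 : Integrable (fun ω => δ * ∑ t, G n t ω ^ 2 +
        (δ⁻¹ + 1) * ∑ t, (D n t ω - G n t ω) ^ 2 + |(∑ t, G n t ω ^ 2) - g n|) (P n) := i12.add i3
    calc _ ≤ ∫ ω, (δ * ∑ t, G n t ω ^ 2 + (δ⁻¹ + 1) * ∑ t, (D n t ω - G n t ω) ^ 2 +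
          |(∑ t, G n t ω ^ 2) - g n| + |g n - 1|) ∂(P n) := by
          refine integral_mono i4 (i123.add (integrable_const |g n - 1|)) fun ω => ?_
          have h5 := abs_sum_sq_sub_le (fun t => D n t ω) (fun t => G n t ω) hδ
          have h6 := abs_sub_le (∑ t, D n t ω ^ 2) (∑ t, G n t ω ^ 2) 1
          have h7 := abs_sub_le (∑ t, G n t ω ^ 2) (g n) 1
          simp only
          linarith
      _ = _ := by
          rw [integral_add i123 (integrable_const _), integral_add i12 i3,
            integral_add (i1.const_mul _) (i2.const_mul _), integral_const_mul, integral_const_mul,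
            integral_finsetSum _ i2']
          simp [hg]
  rw [Metric.tendsto_atTop']
  intro ε hε
  have hlim : Tendsto (fun n => ε / 2 * g n + ((ε / 2)⁻¹ + 1) *
      ∑ t, ∫ ω, (D n t ω - G n t ω) ^ 2 ∂(P n) + ∫ ω, |(∑ t, G n t ω ^ 2) - g n| ∂(P n) +
      |g n - 1|) atTop (𝓝 (ε / 2 * 1 + ((ε / 2)⁻¹ + 1) * 0 + 0 + |1 - 1|)) :=
    (((hg1.const_mul _).add (hDG.const_mul _)).add hdev).add (hg1.sub_const 1).abs
  have hev := hlim.eventually_lt_const (u := ε) (by simp [hε])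
  obtain ⟨n0, hn0⟩ := eventually_atTop.1 (hev.and (hbound (ε / 2) (by positivity)))
  refine ⟨n0, fun n hn => ?_⟩
  rw [Real.dist_eq, sub_zero, abs_of_nonneg (integral_nonneg fun ω => abs_nonneg _)]
  exact (hn0 n hn.le).2.trans_lt (hn0 n hn.le).1

end Convergence

/-! ### Error terms in terms of the assumed rates -/

section Rates

variable {𝓧 : Type*} [MeasurableSpace 𝓧] {m N : ℕ} {Ω : Type*} [MeasurableSpace Ω]
  {P : Measure Ω} [IsProbabilityMeasure P] {X : Fin N → Ω → 𝓧} {h : (Fin m → 𝓧) → ℝ}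
  {B C τ : ℝ} {a : (Fin m → Fin N) → ℝ}

theorem measurable_bootVar (hN : 0 < N) (hh : Measurable h) : Measurable (bootVar a h) := by
  have : NeZero N := ⟨hN.ne'⟩
  have hm : ∀ J : Fin N → Fin N, Measurable fun x : Fin N → 𝓧 => uStat a h fun k => x (J k) := by
    intro J
    exact (Finset.measurable_sum _ fun I _ => (hh.comp (by fun_prop)).const_mul _).const_mul _
  have heq : bootVar a h = fun x : Fin N → 𝓧 =>
      (Fintype.card (Fin N → Fin N) : ℝ)⁻¹ * ∑ J : Fin N → Fin N, uStat a h (fun k => x (J k)) ^ 2 -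
        ((Fintype.card (Fin N → Fin N) : ℝ)⁻¹ * ∑ J : Fin N → Fin N, uStat a h fun k => x (J k)) ^ 2 := by
    ext x
    rw [bootVar, variance_eq_sub MemLp.of_discrete, integral_uniformOn_univ,
      integral_uniformOn_univ]
    rfl
  rw [heq]
  exact ((Finset.measurable_sum _ fun J _ => (hm J).pow_const 2).const_mul _).sub
    (((Finset.measurable_sum _ fun J _ => hm J).const_mul _).pow_const 2)

/-- The first of the two rates that control the errors. -/
noncomputable def rateOne (P : Measure Ω) (X : Fin N → Ω → 𝓧) (a : (Fin m → Fin N) → ℝ)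
    (h : (Fin m → 𝓧) → ℝ) (τ : ℝ) : ℝ :=
  (N : ℝ)⁻¹ * τ⁻¹ * avgWeight a 2 1 * (meanGap P X h ^ 2 + crossGap P X h + (N : ℝ)⁻¹)

/-- The second of the two rates that control the errors. -/
noncomputable def rateTwo (a : (Fin m → Fin N) → ℝ) (B τ : ℝ) : ℝ :=
  ((N : ℝ) ^ 2)⁻¹ * τ⁻¹ * avgWeight a 2 2 * B

/-- A constant that depends on the degree and on the moment bound only. -/
noncomputable def rateConst (m : ℕ) (C : ℝ) : ℝ :=
  3 * ((2 + C * (4 * (4 * (m : ℝ) ^ 2 + 2 * m * (2 * m + 1)) + 20 * m ^ 2)) *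
      (m ^ 2 * (2 ^ (m - 1) * m) ^ 2) +
    2 * C * (m ^ 2 + m) * m ^ 2 * (2 ^ (m - 1) * m) ^ 2 +
    4 * m ^ 2 * ((2 ^ (m - 1)) ^ 2 * m ^ 4)) +
  4 * C * m ^ 2 * (m ^ 2 * (2 ^ (m - 1) * m) ^ 2) + (2 ^ (m - 1)) ^ 2 * m ^ 4 +
  C * m ^ 2 * (2 ^ (m - 1) * m) ^ 2

theorem sum_totalWeight_sq_le (hm : 1 ≤ m) (hN : 2 * m ≤ N) :
    ∑ i, totalWeight a i ^ 2 ≤ (m : ℝ) ^ 2 * (2 ^ (m - 1) * m) ^ 2 * (N * avgWeight a 2 1) := by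
  refine (sum_totalWeight_pow_le a 1).trans ?_
  rw [mul_assoc, ← mul_assoc _ (N : ℝ)]
  exact mul_le_mul_of_nonneg_left (sharedWeight_one_le hm hN a 1) (by positivity)

/-- Interpolation of power sums: `S₂² ≤ S₁ S₃` and `S₁² ≤ N S₂` give `S₂³ ≤ N S₃²`. In this way the
condition on `A_{3,1}` controls the sum of squares. -/
theorem sum_totalWeight_sq_pow_le (hm : 1 ≤ m) (hN : 2 * m ≤ N) :
    (∑ i, totalWeight a i ^ 2) ^ 3 ≤
      N * ((m : ℝ) ^ 3 * (2 ^ (m - 1) * m) ^ 3 * (N * avgWeight a 3 1)) ^ 2 := by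
  have hT : ∑ i, totalWeight a i ^ 3 ≤ (m : ℝ) ^ 3 * (2 ^ (m - 1) * m) ^ 3 *
      (N * avgWeight a 3 1) := by
    refine (sum_totalWeight_pow_le a 2).trans ?_
    rw [mul_assoc, ← mul_assoc _ (N : ℝ)]
    exact mul_le_mul_of_nonneg_left (sharedWeight_one_le hm hN a 2) (by positivity)
  have hnn := totalWeight_nonneg (m := m) (N := N) a
  have hT0 : 0 ≤ ∑ i, totalWeight a i ^ 3 := Finset.sum_nonneg fun i _ => pow_nonneg (hnn i) 3
  have hS0 : 0 ≤ ∑ i, totalWeight a i ^ 2 := Finset.sum_nonneg fun i _ => sq_nonneg _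
  have h1 : (∑ i, totalWeight a i ^ 2) ^ 2 ≤ (∑ i, totalWeight a i) * ∑ i, totalWeight a i ^ 3 :=
    Finset.sum_sq_le_sum_mul_sum_of_sq_le_mul _ (fun i _ => hnn i)
      (fun i _ => pow_nonneg (hnn i) 3) fun i _ => le_of_eq (by ring)
  have h2 : (∑ i, totalWeight a i) ^ 2 ≤ N * ∑ i, totalWeight a i ^ 2 := by
    simpa using sq_sum_le_card_mul_sum_sq (s := Finset.univ) (f := totalWeight a)
  have h3 : (∑ i, totalWeight a i ^ 2) ^ 3 ≤ N * (∑ i, totalWeight a i ^ 3) ^ 2 := by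
    rcases hS0.eq_or_lt with h0 | hpos
    · rw [← h0, zero_pow three_ne_zero]
      positivity
    · refine le_of_mul_le_mul_left ?_ hpos
      calc (∑ i, totalWeight a i ^ 2) * (∑ i, totalWeight a i ^ 2) ^ 3
          = ((∑ i, totalWeight a i ^ 2) ^ 2) ^ 2 := by ring
        _ ≤ ((∑ i, totalWeight a i) * ∑ i, totalWeight a i ^ 3) ^ 2 :=
          pow_le_pow_left₀ (sq_nonneg _) h1 2
        _ = (∑ i, totalWeight a i) ^ 2 * (∑ i, totalWeight a i ^ 3) ^ 2 := by ring
        _ ≤ (N * ∑ i, totalWeight a i ^ 2) * (∑ i, totalWeight a i ^ 3) ^ 2 :=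
          mul_le_mul_of_nonneg_right h2 (sq_nonneg _)
        _ = _ := by ring
  refine h3.trans ?_
  gcongr

theorem combination_bounds {k₁ k₂ k₃ k₄ k₅ k₆ x y : ℝ} (h₁ : 0 ≤ k₁) (h₂ : 0 ≤ k₂) (h₃ : 0 ≤ k₃)
    (h₄ : 0 ≤ k₄) (h₅ : 0 ≤ k₅) (h₆ : 0 ≤ k₆) (hx : 0 ≤ x) (hy : 0 ≤ y) :
    3 * (k₁ * x + k₃ * y + k₂ * x) ≤ (3 * (k₁ + k₂ + k₃) + k₄ + k₅ + k₆) * (x + y) ∧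
    k₄ * x ≤ (3 * (k₁ + k₂ + k₃) + k₄ + k₅ + k₆) * (x + y) ∧
    k₅ * y + k₆ * x ≤ (3 * (k₁ + k₂ + k₃) + k₄ + k₅ + k₆) * (x + y) := by
  refine ⟨?_, ?_, ?_⟩ <;> rw [← sub_nonneg] <;> ring_nf <;> positivity

namespace SampleBounds

/-- The weight sums and counts turn every error into a constant times `rateOne` or `rateTwo`;
`rateConst` is large enough for all three bounds. -/
theorem rate_bounds (H : SampleBounds P X h B C) (hm : 1 ≤ m) (hN : 2 * m ≤ N) (hτ : 0 < τ) :
    ((N : ℝ) ^ 3 * τ)⁻¹ * ∑ i, ∑ j,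
        ∫ ω, (bootOne a h (fun k => X k ω) i j - hOne P X a h i (X j ω)) ^ 2 ∂P ≤
      rateConst m C * (rateOne P X a h τ + rateTwo a B τ) ∧
    ((N : ℝ) ^ 3 * τ)⁻¹ * ∑ i, ∑ j,
        ∫ ω, (hOne P X a h i (X j ω) - offOne P X a h i j (X j ω)) ^ 2 ∂P ≤
      rateConst m C * (rateOne P X a h τ + rateTwo a B τ) ∧
    ((N : ℝ) ^ 2)⁻¹ * τ⁻¹ * sharedWeight a 2 2 * (B + C * (m : ℝ) ^ 2 / N) ≤
      rateConst m C * (rateOne P X a h τ + rateTwo a B τ) := by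
  have hN0 : 0 < N := by omega
  have hn : (0 : ℝ) < N := by exact_mod_cast hN0
  have hA := avgWeight_nonneg a 2 1
  have hA2 := avgWeight_nonneg a 2 2
  have hC := H.nonneg_two
  have hB := H.nonneg_four
  have hg : 0 ≤ crossGap P X h := crossGap_nonneg
  have hS := sum_totalWeight_sq_le (a := a) hm hN
  have hS0 : 0 ≤ ∑ i, totalWeight a i ^ 2 := Finset.sum_nonneg fun i _ => sq_nonneg _
  -- The pair weight is bounded in two ways: by `A_{2,1}` where it is multiplied by `C`, and by
  -- `A_{2,2}` where it is multiplied by `B`.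
  have hx1 : sharedWeight a 2 2 ≤ (2 ^ (m - 1) * m) ^ 2 * (N * avgWeight a 2 1) := by
    rw [← mul_assoc]
    exact (sharedWeight_two_le_one a 2).trans (sharedWeight_one_le hm hN a 1)
  have hx2 := sharedWeight_two_le hm hN a
  have hx0 := sharedWeight_nonneg a 2 2
  have hb := H.sum_integral_bootOne_sub_hOne_sq_le (a := a) hN0
  have hd := H.sum_integral_hOne_sub_offOne_sq_le (a := a)
  rw [rateOne, rateTwo, rateConst]
  set n : ℝ := (N : ℝ)
  set S := ∑ i, totalWeight a i ^ 2
  set x := sharedWeight a 2 2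
  set A := avgWeight a 2 1
  set A2 := avgWeight a 2 2
  set g := crossGap P X h
  set M1 := meanGap P X h
  set c1 : ℝ := (2 ^ (m - 1) * m) ^ 2
  set c2 : ℝ := (2 ^ (m - 1)) ^ 2 * m ^ 4
  set μ : ℝ := (m : ℝ)
  set k : ℝ := 4 * (4 * μ ^ 2 + 2 * μ * (2 * μ + 1)) + 20 * μ ^ 2
  have hμ : 0 ≤ μ := Nat.cast_nonneg m
  have hk : 0 ≤ k := by positivity
  have hc1 : 0 ≤ c1 := by positivity
  have hc2 : 0 ≤ c2 := by positivity
  set z := M1 ^ 2 + g + n⁻¹ with hz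
  have hz0 : 0 ≤ z := by positivity
  have hnz : n * z = n * M1 ^ 2 + n * g + 1 := by rw [hz]; field_simp
  -- The summand `N⁻¹` in `z` lets terms of lower order in `N` be absorbed into `rateOne`.
  have h1nz : 1 ≤ n * z := by
    rw [hnz]
    linarith [mul_nonneg hn.le hg, mul_nonneg hn.le (sq_nonneg M1)]
  set e1 := n⁻¹ * τ⁻¹ * A * z with he1
  set e2 := (n ^ 2)⁻¹ * τ⁻¹ * A2 * B with he2
  have he10 : 0 ≤ e1 := by positivity
  have he20 : 0 ≤ e2 := by positivity
  have hp : 0 ≤ (n ^ 3 * τ)⁻¹ := by positivity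
  have hcomb := combination_bounds (k₁ := (2 + C * k) * (μ ^ 2 * c1))
    (k₂ := 2 * C * (μ ^ 2 + μ) * μ ^ 2 * c1) (k₃ := 4 * μ ^ 2 * c2)
    (k₄ := 4 * C * μ ^ 2 * (μ ^ 2 * c1)) (k₅ := c2) (k₆ := C * μ ^ 2 * c1) (by positivity)
    (by positivity) (by positivity) (by positivity) hc2 (by positivity) he10 he20
  have hpe1 : (n ^ 3 * τ)⁻¹ * (n ^ 2 * A * z) = e1 := by rw [he1]; field_simp
  have hpe2 : (n ^ 3 * τ)⁻¹ * (n * A2 * B) = e2 := by rw [he2]; field_simp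
  have hnA : n * A ≤ n ^ 2 * A * z := by
    calc n * A = n * A * 1 := by ring
      _ ≤ n * A * (n * z) := by gcongr
      _ = _ := by ring
  refine ⟨?_, ?_, ?_⟩
  · have hform : 3 * (n * ((2 * g + 4 * C * (4 * μ ^ 2 + 2 * μ * (2 * μ + 1)) / n) * S +
        (4 * B + 2 * C * (μ ^ 2 + μ) / n) * (μ ^ 2 * x)) + 4 * C * μ ^ 2 * S +
        n * ((M1 ^ 2 + 4 * C * (4 * μ ^ 2) / n) * S)) =
        3 * (S * (n * (2 * g + M1 ^ 2) + C * k) + 4 * μ ^ 2 * (n * B * x) +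
          2 * C * (μ ^ 2 + μ) * μ ^ 2 * x) := by
      simp only [k]; field_simp; ring
    rw [hform] at hb
    have t1 : S * (n * (2 * g + M1 ^ 2) + C * k) ≤
        (2 + C * k) * (μ ^ 2 * c1) * (n ^ 2 * A * z) := by
      have : n * (2 * g + M1 ^ 2) + C * k ≤ (2 + C * k) * (n * z) := by
        rw [hnz]
        rw [← sub_nonneg]
        have e : (2 + C * k) * (n * M1 ^ 2 + n * g + 1) - (n * (2 * g + M1 ^ 2) + C * k) =
          n * M1 ^ 2 + 2 + C * k * (n * M1 ^ 2 + n * g) := by ring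
        rw [e]
        positivity
      calc S * (n * (2 * g + M1 ^ 2) + C * k) ≤
          (μ ^ 2 * c1 * (n * A)) * ((2 + C * k) * (n * z)) := by gcongr
        _ = _ := by ring
    have t2 : 4 * μ ^ 2 * (n * B * x) ≤ 4 * μ ^ 2 * c2 * (n * A2 * B) := by
      calc 4 * μ ^ 2 * (n * B * x) ≤ 4 * μ ^ 2 * (n * B * (c2 * A2)) := by gcongr
        _ = _ := by ring
    have t3 : 2 * C * (μ ^ 2 + μ) * μ ^ 2 * x ≤
        2 * C * (μ ^ 2 + μ) * μ ^ 2 * c1 * (n ^ 2 * A * z) := by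
      calc 2 * C * (μ ^ 2 + μ) * μ ^ 2 * x ≤
          2 * C * (μ ^ 2 + μ) * μ ^ 2 * (c1 * (n ^ 2 * A * z)) := by
            gcongr
            exact hx1.trans (by gcongr)
        _ = _ := by ring
    calc _ ≤ (n ^ 3 * τ)⁻¹ * (3 * ((2 + C * k) * (μ ^ 2 * c1) * (n ^ 2 * A * z) +
          4 * μ ^ 2 * c2 * (n * A2 * B) +
          2 * C * (μ ^ 2 + μ) * μ ^ 2 * c1 * (n ^ 2 * A * z))) := by
          exact mul_le_mul_of_nonneg_left (hb.trans (mul_le_mul_of_nonneg_left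
            (add_le_add (add_le_add t1 t2) t3) three_pos.le)) hp
      _ = 3 * ((2 + C * k) * (μ ^ 2 * c1) * ((n ^ 3 * τ)⁻¹ * (n ^ 2 * A * z)) +
          4 * μ ^ 2 * c2 * ((n ^ 3 * τ)⁻¹ * (n * A2 * B)) +
          2 * C * (μ ^ 2 + μ) * μ ^ 2 * c1 * ((n ^ 3 * τ)⁻¹ * (n ^ 2 * A * z))) := by ring
      _ = 3 * ((2 + C * k) * (μ ^ 2 * c1) * e1 + 4 * μ ^ 2 * c2 * e2 +
          2 * C * (μ ^ 2 + μ) * μ ^ 2 * c1 * e1) := by rw [hpe1, hpe2]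
      _ ≤ _ := hcomb.1
  · have t1 : 4 * C * μ ^ 2 * S ≤ 4 * C * μ ^ 2 * (μ ^ 2 * c1) * (n ^ 2 * A * z) := by
      calc 4 * C * μ ^ 2 * S ≤ 4 * C * μ ^ 2 * (μ ^ 2 * c1 * (n ^ 2 * A * z)) := by
            gcongr
            exact hS.trans (by gcongr)
        _ = _ := by ring
    calc _ ≤ (n ^ 3 * τ)⁻¹ * (4 * C * μ ^ 2 * (μ ^ 2 * c1) * (n ^ 2 * A * z)) :=
          mul_le_mul_of_nonneg_left (hd.trans t1) hp
      _ = 4 * C * μ ^ 2 * (μ ^ 2 * c1) * ((n ^ 3 * τ)⁻¹ * (n ^ 2 * A * z)) := by ring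
      _ = 4 * C * μ ^ 2 * (μ ^ 2 * c1) * e1 := by rw [hpe1]
      _ ≤ _ := hcomb.2.1
  · have t1 : n * B * x ≤ c2 * (n * A2 * B) := by
      calc n * B * x ≤ n * B * (c2 * A2) := by gcongr
        _ = _ := by ring
    have t2 : C * μ ^ 2 * x ≤ C * μ ^ 2 * c1 * (n ^ 2 * A * z) := by
      calc C * μ ^ 2 * x ≤ C * μ ^ 2 * (c1 * (n ^ 2 * A * z)) := by
            gcongr
            exact hx1.trans (by gcongr)
        _ = _ := by ring
    calc _ = (n ^ 3 * τ)⁻¹ * (n * B * x + C * μ ^ 2 * x) := by field_simp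
      _ ≤ (n ^ 3 * τ)⁻¹ * (c2 * (n * A2 * B) + C * μ ^ 2 * c1 * (n ^ 2 * A * z)) :=
          mul_le_mul_of_nonneg_left (add_le_add t1 t2) hp
      _ = c2 * ((n ^ 3 * τ)⁻¹ * (n * A2 * B)) +
          C * μ ^ 2 * c1 * ((n ^ 3 * τ)⁻¹ * (n ^ 2 * A * z)) := by ring
      _ = c2 * e2 + C * μ ^ 2 * c1 * e1 := by rw [hpe1, hpe2]
      _ ≤ _ := hcomb.2.2

/-- The variance rate, through the third power of the bound. -/
theorem variance_rate (H : SampleBounds P X h B C) (hm : 1 ≤ m) (hN : 2 * m ≤ N) (hτ : 0 < τ) :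
    (variance (fun ω => ((N : ℝ) ^ 3 * τ)⁻¹ * ∑ j, ∑ i, offOne P X a h i j (X j ω) ^ 2) P) ^ 3 ≤
      16 ^ 3 * ((m : ℝ) ^ 3 * (2 ^ (m - 1) * m) ^ 3) ^ 4 *
        ((N : ℝ)⁻¹ * (((N : ℝ) ^ 2)⁻¹ ^ 4 * (τ ^ 6)⁻¹ * avgWeight a 3 1 ^ 4 * B ^ 6)) := by
  have hN0 : 0 < N := by omega
  have hn : (0 : ℝ) < N := by exact_mod_cast hN0
  have hS := sum_totalWeight_sq_pow_le (a := a) hm hN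
  have hS0 : 0 ≤ ∑ i, totalWeight a i ^ 2 := Finset.sum_nonneg fun i _ => sq_nonneg _
  have hB := H.nonneg_four
  rw [variance_const_mul]
  calc _ ≤ ((((N : ℝ) ^ 3 * τ)⁻¹) ^ 2 * (N * (16 * B ^ 2 *
        (∑ i, totalWeight a i ^ 2) ^ 2))) ^ 3 := by
        refine pow_le_pow_left₀ (mul_nonneg (sq_nonneg _) (variance_nonneg _ _)) ?_ 3
        exact mul_le_mul_of_nonneg_left H.variance_sum_offOne_sq_le.2 (sq_nonneg _)
    _ = (((N : ℝ) ^ 3 * τ)⁻¹) ^ 6 * N ^ 3 * 16 ^ 3 * B ^ 6 *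
        ((∑ i, totalWeight a i ^ 2) ^ 3) ^ 2 := by ring
    _ ≤ (((N : ℝ) ^ 3 * τ)⁻¹) ^ 6 * N ^ 3 * 16 ^ 3 * B ^ 6 * (N * ((m : ℝ) ^ 3 *
        (2 ^ (m - 1) * m) ^ 3 * (N * avgWeight a 3 1)) ^ 2) ^ 2 := by gcongr
    _ = _ := by field_simp

end SampleBounds

end Rates

/-! ### From the quadratic form to the bootstrap variance -/

section Comparison

variable {𝓧 : Type*} [MeasurableSpace 𝓧] {m N : ℕ} {Ω : Type*} [MeasurableSpace Ω]
  {P : Measure Ω} [IsProbabilityMeasure P] {X : Fin N → Ω → 𝓧} {h : (Fin m → 𝓧) → ℝ}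
  {B C τ : ℝ} {a : (Fin m → Fin N) → ℝ}

namespace SampleBounds

omit [IsProbabilityMeasure P] in
theorem integrable_tupleAvg_sq (H : SampleBounds P X h B C) :
    Integrable (fun ω => tupleAvg (fun y => h y ^ 2) fun i => X i ω) P :=
  (integrable_finsetSum _ fun k _ => H.integrable_two k).const_mul _

omit [IsProbabilityMeasure P] in
theorem integrable_sum_sq_bootOne (H : SampleBounds P X h B C) :
    Integrable (fun ω => ∑ i, ∑ j, bootOne a h (fun k => X k ω) i j ^ 2) P :=
  integrable_finsetSum _ fun i _ => integrable_finsetSum _ fun j _ =>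
    (H.memLp_bootOne i j).integrable_sq

omit [IsProbabilityMeasure P] in
theorem integrable_bootVar (H : SampleBounds P X h B C) (hN : 0 < N) :
    Integrable (fun ω => bootVar a h fun k => X k ω) P := by
  have hb := fun ω => bootVar_bounds hN a h fun k => X k ω
  have hG := ((H.integrable_sum_sq_bootOne (a := a)).const_mul ((N : ℝ) ^ 3)⁻¹).add
    (H.integrable_tupleAvg_sq.const_mul
      ((((N - m)! : ℝ) / (N ! : ℝ)) ^ 2 * ∑ I ∈ sharingTuples m N 2 2, |∏ k, a (I k)|))
  refine hG.mono' ?_ (.of_forall fun ω => ?_)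
  · exact ((measurable_bootVar hN H.measurable_kernel).comp
      (measurable_pi_lambda _ H.measurable_sample)).aestronglyMeasurable
  · rw [Real.norm_of_nonneg (show 0 ≤ bootVar a h fun k => X k ω from variance_nonneg _ _)]
    exact (hb ω).2

/-- The two-sided bound on `bootVar` leaves a nonnegative remainder whose mean is covered by the
last rate bound. -/
theorem integral_abs_bootVar_div_sub_one_le (H : SampleBounds P X h B C) (hm : 1 ≤ m)
    (hN : 2 * m ≤ N) (hτ : 0 < τ) :
    ∫ ω, |bootVar a h (fun k => X k ω) / τ - 1| ∂P ≤
      ∫ ω, |∑ t : Fin N × Fin N, (√((N : ℝ) ^ 3 * τ)⁻¹ *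
        bootOne a h (fun k => X k ω) t.1 t.2) ^ 2 - 1| ∂P +
      rateConst m C * (rateOne P X a h τ + rateTwo a B τ) := by
  have hN0 : 0 < N := by omega
  have hκ : 0 ≤ ((N : ℝ) ^ 3 * τ)⁻¹ := by positivity
  have hsum : ∀ ω, ∑ t : Fin N × Fin N, (√((N : ℝ) ^ 3 * τ)⁻¹ *
      bootOne a h (fun k => X k ω) t.1 t.2) ^ 2 =
      ((N : ℝ) ^ 3 * τ)⁻¹ * ∑ i, ∑ j, bootOne a h (fun k => X k ω) i j ^ 2 := by
    intro ω
    simp only [mul_pow, Real.sq_sqrt hκ]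
    rw [← Finset.mul_sum, Fintype.sum_prod_type]
  simp only [hsum]
  set w : ℝ := ((N : ℝ) ^ 2)⁻¹ * τ⁻¹ * sharedWeight a 2 2 with hw
  have hw0 : 0 ≤ w := mul_nonneg (by positivity) (sharedWeight_nonneg a 2 2)
  have hS : Integrable (fun ω => |((N : ℝ) ^ 3 * τ)⁻¹ *
      (∑ i, ∑ j, bootOne a h (fun k => X k ω) i j ^ 2) - 1|) P :=
    ((H.integrable_sum_sq_bootOne.const_mul _).sub (integrable_const _)).abs
  have hT : Integrable (fun ω => w * tupleAvg (fun y => h y ^ 2) fun i => X i ω) P :=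
    H.integrable_tupleAvg_sq.const_mul w
  have hfac : ((((N - m)! : ℝ) / (N ! : ℝ)) ^ 2 *
      ∑ I ∈ sharingTuples m N 2 2, |∏ k, a (I k)|) = ((N : ℝ) ^ 2)⁻¹ * sharedWeight a 2 2 := by
    rw [sharedWeight, normFactor, ← inv_mul_factorial_div hN0]
    ring
  calc _ ≤ ∫ ω, (|((N : ℝ) ^ 3 * τ)⁻¹ *
        (∑ i, ∑ j, bootOne a h (fun k => X k ω) i j ^ 2) - 1| +
        w * tupleAvg (fun y => h y ^ 2) fun i => X i ω) ∂P := by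
        refine integral_mono_of_nonneg (.of_forall fun ω => abs_nonneg _) (hS.add hT)
          (.of_forall fun ω => ?_)
        obtain ⟨h1, h2⟩ := bootVar_bounds hN0 a h fun k => X k ω
        rw [hfac] at h2
        have e1 : ((N : ℝ) ^ 3)⁻¹ * (∑ i, ∑ j, bootOne a h (fun k => X k ω) i j ^ 2) / τ =
            ((N : ℝ) ^ 3 * τ)⁻¹ * ∑ i, ∑ j, bootOne a h (fun k => X k ω) i j ^ 2 := by
          rw [mul_inv]; ring
        have e2 : ((N : ℝ) ^ 2)⁻¹ * sharedWeight a 2 2 *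
            tupleAvg (fun y => h y ^ 2) (fun i => X i ω) / τ =
            w * tupleAvg (fun y => h y ^ 2) fun i => X i ω := by
          rw [hw]; ring
        have h1' := div_le_div_of_nonneg_right h1 hτ.le
        have h2' := div_le_div_of_nonneg_right h2 hτ.le
        rw [add_div, e1, e2] at h2'
        rw [e1] at h1'
        simp only
        set u := ((N : ℝ) ^ 3 * τ)⁻¹ * ∑ i, ∑ j, bootOne a h (fun k => X k ω) i j ^ 2
        have h3 := le_abs_self (u - 1)
        have h4 := neg_abs_le (u - 1)
        rw [abs_le]
        constructor <;> linarith
    _ = ∫ ω, |((N : ℝ) ^ 3 * τ)⁻¹ *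
          (∑ i, ∑ j, bootOne a h (fun k => X k ω) i j ^ 2) - 1| ∂P +
        w * ∫ ω, tupleAvg (fun y => h y ^ 2) (fun i => X i ω) ∂P := by
        rw [integral_add hS hT, integral_const_mul]
    _ ≤ _ := by
        refine add_le_add le_rfl (le_trans ?_ (H.rate_bounds (a := a) hm hN hτ).2.2)
        exact mul_le_mul_of_nonneg_left (H.integral_tupleAvg_sq_le hN0) hw0

end SampleBounds

end Comparison

/-! ### Consistency of the bootstrap variance in L¹ -/

section Consistency

variable {𝓧 : Type*} [MeasurableSpace 𝓧] {m : ℕ} {Ω : ℕ → Type*} [∀ n, MeasurableSpace (Ω n)]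
  {P : ∀ n, Measure (Ω n)} [∀ n, IsProbabilityMeasure (P n)] {N : ℕ → ℕ}
  {X : ∀ n, Fin (N n) → Ω n → 𝓧} {a : ∀ n, (Fin m → Fin (N n)) → ℝ}
  {h : ℕ → (Fin m → 𝓧) → ℝ}

theorem rateTwo_le {k : ℕ} {a : (Fin m → Fin k) → ℝ} {M V τ : ℝ} (hM : 0 < M) (hV : 0 < V)
    (hτ : V ≤ τ) :
    rateTwo a (√M) τ ≤
      (k : ℝ) ^ (-2 : ℝ) * V ^ (-1 : ℝ) * avgWeight a 2 2 * M ^ (1 / 2 : ℝ) := by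
  have e1 : (k : ℝ) ^ (-2 : ℝ) = ((k : ℝ) ^ 2)⁻¹ := by
    rw [Real.rpow_neg (Nat.cast_nonneg k)]
    norm_cast
  rw [rateTwo, e1, Real.rpow_neg_one, ← Real.sqrt_eq_rpow]
  have := avgWeight_nonneg a 2 2
  gcongr

/-- The fourth power clears the fractional exponents of the second normality rate; replacing `τ` by
the smaller `V` only increases the bound. -/
theorem varianceRate_le {k : ℕ} {A M V τ : ℝ} (hM : 0 < M) (hV : 0 < V) (hτ : V ≤ τ) :
    ((k : ℝ) ^ 2)⁻¹ ^ 4 * (τ ^ 6)⁻¹ * A ^ 4 * √M ^ 6 ≤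
      ((k : ℝ) ^ (-2 : ℝ) * V ^ (-3 / 2 : ℝ) * A * M ^ (3 / 4 : ℝ)) ^ 4 := by
  have e1 : (k : ℝ) ^ (-2 : ℝ) = ((k : ℝ) ^ 2)⁻¹ := by
    rw [Real.rpow_neg (Nat.cast_nonneg k)]
    norm_cast
  have e2 : (V ^ (-3 / 2 : ℝ)) ^ 4 = (V ^ 6)⁻¹ := by
    rw [← Real.rpow_natCast, ← Real.rpow_mul hV.le, ← Real.rpow_natCast, ← Real.rpow_neg hV.le]
    norm_num
  have e3 : (M ^ (3 / 4 : ℝ)) ^ 4 = √M ^ 6 := by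
    rw [Real.sqrt_eq_rpow, ← Real.rpow_natCast, ← Real.rpow_mul hM.le, ← Real.rpow_natCast,
      ← Real.rpow_mul hM.le]
    norm_num
  rw [mul_pow, mul_pow, mul_pow, e1, e2, e3]
  have : 0 ≤ A ^ 4 := Even.pow_nonneg (by decide) A
  gcongr

theorem tendsto_zero_of_pow_three {u : ℕ → ℝ} (hu : ∀ n, 0 ≤ u n)
    (hlim : Tendsto (fun n => u n ^ 3) atTop (𝓝 0)) : Tendsto u atTop (𝓝 0) := by
  have := hlim.rpow_const (p := ((3 : ℕ) : ℝ)⁻¹) (.inr (by positivity))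
  rw [Real.zero_rpow (by positivity)] at this
  refine this.congr fun n => ?_
  exact Real.pow_rpow_inv_natCast (hu n) three_ne_zero

namespace BootstrapConditions

/-- The bootstrap variance is consistent for the variance of the U-statistic, in `L¹`. -/
theorem tendsto_integral_abs_bootVar (H : BootstrapConditions P N X a h) (hm : 1 ≤ m)
    (hN : Tendsto N atTop atTop) (hX : ∀ n i, Measurable (X n i))
    (hind : ∀ n, iIndepFun (X n) (P n)) (hh : ∀ n, Measurable (h n)) :
    (∀ᶠ n in atTop, 0 < uVar (P n) (X n) (a n) (h n)) ∧
    (∀ᶠ n in atTop, Integrable (fun ω => bootVar (a n) (h n) fun k => X n k ω) (P n)) ∧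
    Tendsto (fun n => ∫ ω, |bootVar (a n) (h n) (fun k => X n k ω) /
      uVar (P n) (X n) (a n) (h n) - 1| ∂(P n)) atTop (𝓝 0) := by
  obtain ⟨M, hM, hM4, hr2, hr3⟩ := H.normality
  obtain ⟨C, hC⟩ := H.vonMises
  -- `B = √M` makes `B ^ 2` the fourth-moment bound; `max C 0` because the sign of `C` is not given.
  have hSB : ∀ᶠ n in atTop, SampleBounds (P n) (X n) (h n) (√(M n)) (max C 0) := by
    filter_upwards [hC] with n hn
    exact {
      measurable_sample := hX n
      indep := hind n
      measurable_kernel := hh n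
      nonneg_four := Real.sqrt_nonneg _
      nonneg_two := le_max_right _ _
      integrable_four := fun I => (hM4 n I).1
      four_le := fun I => (hM4 n I).2.trans_eq (Real.sq_sqrt (hM n).le).symm
      integrable_two := fun k => (hn k).1.1
      two_le := fun k => (hn k).1.2.trans (le_max_left _ _)
      integrable_pi := fun k => (hn k).2.1
      pi_le := fun k => (hn k).2.2.trans (le_max_left _ _) }
  have hNm : ∀ᶠ n in atTop, 2 * m ≤ N n := hN.eventually_ge_atTop _
  have hN0 : ∀ᶠ n in atTop, 0 < N n := hN.eventually_gt_atTop _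
  have hle : ∀ᶠ n in atTop,
      mainVar (P n) (X n) (a n) (h n) ≤ uVar (P n) (X n) (a n) (h n) := by
    filter_upwards [hSB, hN0] with n hn hn0
    exact mainVar_le_uVar hn0 (hX n) (hind n) (hh n) fun I => hn.memLp I
  have hpos : ∀ᶠ n in atTop, 0 < uVar (P n) (X n) (a n) (h n) := by
    filter_upwards [hle, H.mainVar_pos] with n h1 h2 using h2.trans_le h1
  refine ⟨hpos, by filter_upwards [hSB, hN0] with n hn hn0 using hn.integrable_bootVar hn0, ?_⟩
  set τ : ℕ → ℝ := fun n => uVar (P n) (X n) (a n) (h n) with hτ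
  have hτ0 : ∀ n, 0 ≤ τ n := fun n => variance_nonneg _ _
  -- This scaling makes the sum of squares of `κ * hOne` the statistic of the first homogeneity
  -- condition.
  set κ : ℕ → ℝ := fun n => √((N n : ℝ) ^ 3 * τ n)⁻¹ with hκ
  have hκ2 : ∀ n, κ n ^ 2 = ((N n : ℝ) ^ 3 * τ n)⁻¹ := fun n =>
    Real.sq_sqrt (inv_nonneg.2 (mul_nonneg (by positivity) (hτ0 n)))
  have hrate : Tendsto (fun n => rateConst m (max C 0) *
      (rateOne (P n) (X n) (a n) (h n) (τ n) + rateTwo (a n) (√(M n)) (τ n))) atTop (𝓝 0) := by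
    have h2 : Tendsto (fun n => rateTwo (a n) (√(M n)) (τ n)) atTop (𝓝 0) := by
      refine tendsto_of_tendsto_of_tendsto_of_le_of_le' tendsto_const_nhds hr2
        (.of_forall fun n => ?_) ?_
      · exact mul_nonneg (mul_nonneg (mul_nonneg (by positivity) (inv_nonneg.2 (hτ0 n)))
          (avgWeight_nonneg _ _ _)) (Real.sqrt_nonneg _)
      · filter_upwards [hle, H.mainVar_pos] with n h1 h2
        exact rateTwo_le (hM n) h2 h1
    -- With `τ = σ²`, `rateOne` is the expression in `homogeneity_three`.
    have h3 := (H.homogeneity_three.add h2).const_mul (rateConst m (max C 0))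
    rw [add_zero, mul_zero] at h3
    exact h3
  have hmain := tendsto_integral_abs_sum_sq_sub_one (P := P)
    (ι := fun n => Fin (N n) × Fin (N n))
    (A := fun n t ω => κ n * hOne (P n) (X n) (a n) (h n) t.1 (X n t.2 ω))
    (D := fun n t ω => κ n * bootOne (a n) (h n) (fun k => X n k ω) t.1 t.2)
    (G := fun n t ω => κ n * offOne (P n) (X n) (a n) (h n) t.1 t.2 (X n t.2 ω))
    (by filter_upwards [hSB] with n hn t using (hn.memLp_hOne' t.1 t.2).const_mul _)
    (by filter_upwards [hSB] with n hn t using (hn.memLp_bootOne t.1 t.2).const_mul _)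
    (by filter_upwards [hSB] with n hn t using (hn.memLp_offOne t.1 t.2).const_mul _)
    (by
      filter_upwards [hSB] with n hn
      simp only [mul_pow, ← Finset.mul_sum, Fintype.sum_prod_type_right]
      exact hn.variance_sum_offOne_sq_le.1.const_mul _)
    (by
      refine cast (congrArg (fun Y => TendstoInProb P Y 1) ?_) H.homogeneity_one
      ext n ω
      simp only [mul_pow, ← Finset.mul_sum, Fintype.sum_prod_type, hκ2, div_pow,
        ← Finset.sum_div]
      rw [show √(uVar (P n) (X n) (a n) (h n)) ^ 2 = τ n from Real.sq_sqrt (hτ0 n), mul_inv,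
        div_eq_mul_inv, mul_inv]
      ring)
    (by
      refine tendsto_of_tendsto_of_tendsto_of_le_of_le' tendsto_const_nhds hrate
        (.of_forall fun n => Finset.sum_nonneg fun t _ => integral_nonneg fun ω => sq_nonneg _) ?_
      filter_upwards [hSB, hNm, hpos] with n hn hnm hp
      simp only [← mul_sub, mul_pow, integral_const_mul, ← Finset.mul_sum,
        Fintype.sum_prod_type, hκ2]
      exact (hn.rate_bounds hm hnm hp).1)
    (by
      refine tendsto_of_tendsto_of_tendsto_of_le_of_le' tendsto_const_nhds hrate
        (.of_forall fun n => Finset.sum_nonneg fun t _ => integral_nonneg fun ω => sq_nonneg _) ?_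
      filter_upwards [hSB, hNm, hpos] with n hn hnm hp
      simp only [← mul_sub, mul_pow, integral_const_mul, ← Finset.mul_sum,
        Fintype.sum_prod_type, hκ2]
      exact (hn.rate_bounds hm hnm hp).2.1)
    (by
      -- The interpolation bounds the cube of the weight sum, so the cube of the variance is shown
      -- to vanish.
      refine tendsto_zero_of_pow_three (fun n => variance_nonneg _ _) ?_
      have hinv : Tendsto (fun n => (N n : ℝ)⁻¹) atTop (𝓝 0) :=
        tendsto_inv_atTop_zero.comp (tendsto_natCast_atTop_atTop.comp hN)
      have hlim := (hinv.mul (hr3.pow 4)).const_mul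
        (16 ^ 3 * ((m : ℝ) ^ 3 * (2 ^ (m - 1) * m) ^ 3) ^ 4)
      rw [zero_mul, mul_zero] at hlim
      refine tendsto_of_tendsto_of_tendsto_of_le_of_le' tendsto_const_nhds hlim
        (.of_forall fun n => pow_nonneg (variance_nonneg _ _) 3) ?_
      filter_upwards [hSB, hNm, hpos, hle, H.mainVar_pos] with n hn hnm hp h1 h2
      simp only [mul_pow (κ n), ← Finset.mul_sum, Fintype.sum_prod_type_right, hκ2]
      refine (hn.variance_rate hm hnm hp).trans ?_
      gcongr
      exact varianceRate_le (hM n) h2 h1)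
  have hsum := hmain.add hrate
  rw [add_zero] at hsum
  refine tendsto_of_tendsto_of_tendsto_of_le_of_le' tendsto_const_nhds hsum
    (.of_forall fun n => integral_nonneg fun ω => abs_nonneg _) ?_
  filter_upwards [hSB, hNm, hpos] with n hn hnm hp
  exact hn.integral_abs_bootVar_div_sub_one_le hm hnm hp

end BootstrapConditions

end Consistency

/-! ### Averaging over blocks -/

section Blocks

/-- Choose at each stage an index that violates the property whenever there is one; the hypothesis
for this choice rules out violations eventually. -/
theorem eventually_forall_le_of_choice {K : ℕ → ℕ} {p : ℕ → ℕ → Prop}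
    (hp : ∀ i : ℕ → ℕ, (∀ n, i n ≤ K n) → ∀ᶠ n in atTop, p n (i n)) :
    ∀ᶠ n in atTop, ∀ j ≤ K n, p n j := by
  classical
  have hex : ∀ n, ∃ i, i ≤ K n ∧ (p n i → ∀ j ≤ K n, p n j) := by
    intro n
    by_cases hall : ∀ j ≤ K n, p n j
    · exact ⟨0, Nat.zero_le _, fun _ => hall⟩
    · push Not at hall
      obtain ⟨j, hj, hjp⟩ := hall
      exact ⟨j, hj, fun h => absurd h hjp⟩
  choose i hi hip using hex
  filter_upwards [hp i hi] with n hn using hip n hn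

theorem tendsto_average_of_choice {K : ℕ → ℕ} {F : ℕ → ℕ → ℝ} (hF : ∀ n j, 0 ≤ F n j)
    (hlim : ∀ i : ℕ → ℕ, (∀ n, i n ≤ K n) → Tendsto (fun n => F n (i n)) atTop (𝓝 0)) :
    Tendsto (fun n => ((K n + 1 : ℕ) : ℝ)⁻¹ * ∑ j ∈ Finset.range (K n + 1), F n j)
      atTop (𝓝 0) := by
  rw [tendsto_order]
  refine ⟨fun ε hε => .of_forall fun n => hε.trans_le
    (mul_nonneg (by positivity) (Finset.sum_nonneg fun j _ => hF n j)), fun ε hε => ?_⟩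
  filter_upwards [eventually_forall_le_of_choice (p := fun n j => F n j < ε / 2) fun i hi =>
    (hlim i hi).eventually_lt_const (half_pos hε)] with n hn
  have hsum : ∑ j ∈ Finset.range (K n + 1), F n j ≤ (K n + 1 : ℕ) * (ε / 2) := by
    refine (Finset.sum_le_card_nsmul _ _ (ε / 2) fun j hj =>
      (hn j (Nat.lt_succ_iff.1 (Finset.mem_range.1 hj))).le).trans_eq ?_
    rw [Finset.card_range, nsmul_eq_mul]
  calc _ ≤ ((K n + 1 : ℕ) : ℝ)⁻¹ * ((K n + 1 : ℕ) * (ε / 2)) := by gcongr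
    _ = ε / 2 := by field_simp
    _ < ε := half_lt_self hε

variable {Ω : ℕ → Type*} [∀ n, MeasurableSpace (Ω n)] {P : ∀ n, Measure (Ω n)}
  [∀ n, IsProbabilityMeasure (P n)]

theorem tendsto_integral_abs_of_eq_mul {Y Z : ∀ n, Ω n → ℝ} {ρ : ℕ → ℝ}
    (hρ : Tendsto ρ atTop (𝓝 1)) (hY : ∀ᶠ n in atTop, ∀ ω, Y n ω = ρ n * Z n ω)
    (hZ : ∀ᶠ n in atTop, Integrable (Z n) (P n))
    (hlim : Tendsto (fun n => ∫ ω, |Z n ω - 1| ∂(P n)) atTop (𝓝 0)) :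
    Tendsto (fun n => ∫ ω, |Y n ω - 1| ∂(P n)) atTop (𝓝 0) := by
  have hb : Tendsto (fun n => |ρ n| * ∫ ω, |Z n ω - 1| ∂(P n) + |ρ n - 1|) atTop (𝓝 0) := by
    simpa using (hρ.abs.mul hlim).add (hρ.sub_const 1).abs
  refine tendsto_of_tendsto_of_tendsto_of_le_of_le' tendsto_const_nhds hb
    (.of_forall fun n => integral_nonneg fun ω => abs_nonneg _) ?_
  filter_upwards [hY, hZ] with n h1 h2
  have hi : Integrable (fun ω => |ρ n| * |Z n ω - 1|) (P n) :=
    (h2.sub (integrable_const 1)).abs.const_mul _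
  calc ∫ ω, |Y n ω - 1| ∂(P n) ≤ ∫ ω, (|ρ n| * |Z n ω - 1| + |ρ n - 1|) ∂(P n) := by
        refine integral_mono_of_nonneg (.of_forall fun ω => abs_nonneg _)
          (hi.add (integrable_const _)) (.of_forall fun ω => ?_)
        simp only [h1 ω]
        rw [← abs_mul, show ρ n * Z n ω - 1 = ρ n * (Z n ω - 1) + (ρ n - 1) by ring]
        exact abs_add_le _ _
    _ = _ := by
        rw [integral_add hi (integrable_const _), integral_const_mul]
        simp

/-- The average of `Z - 1` has `L¹` norm at most the average of the `L¹` norms, and these are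
uniformly small over `j`. -/
theorem tendsto_integral_abs_average {K : ℕ → ℕ} {Z : ∀ n, ℕ → Ω n → ℝ}
    (hZ : ∀ᶠ n in atTop, ∀ j ≤ K n, Integrable (Z n j) (P n))
    (hlim : ∀ i : ℕ → ℕ, (∀ n, i n ≤ K n) →
      Tendsto (fun n => ∫ ω, |Z n (i n) ω - 1| ∂(P n)) atTop (𝓝 0)) :
    Tendsto (fun n => ∫ ω, |((K n + 1 : ℕ) : ℝ)⁻¹ * (∑ j ∈ Finset.range (K n + 1), Z n j ω) - 1|
      ∂(P n)) atTop (𝓝 0) := by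
  refine tendsto_of_tendsto_of_tendsto_of_le_of_le' tendsto_const_nhds
    (tendsto_average_of_choice (F := fun n j => ∫ ω, |Z n j ω - 1| ∂(P n))
      (fun n j => integral_nonneg fun ω => abs_nonneg _) hlim)
    (.of_forall fun n => integral_nonneg fun ω => abs_nonneg _) ?_
  filter_upwards [hZ] with n hn
  have hi : ∀ j ∈ Finset.range (K n + 1), Integrable (fun ω => |Z n j ω - 1|) (P n) :=
    fun j hj => ((hn j (Nat.lt_succ_iff.1 (Finset.mem_range.1 hj))).sub
      (integrable_const 1)).abs
  rw [← integral_finsetSum _ hi, ← integral_const_mul]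
  refine integral_mono_of_nonneg (.of_forall fun ω => abs_nonneg _)
    ((integrable_finsetSum _ hi).const_mul _) (.of_forall fun ω => ?_)
  have hK : ((K n + 1 : ℕ) : ℝ) ≠ 0 := by positivity
  have e : ((K n + 1 : ℕ) : ℝ)⁻¹ * (∑ j ∈ Finset.range (K n + 1), Z n j ω) - 1 =
      ((K n + 1 : ℕ) : ℝ)⁻¹ * ∑ j ∈ Finset.range (K n + 1), (Z n j ω - 1) := by
    rw [Finset.sum_sub_distrib, Finset.sum_const, Finset.card_range, nsmul_eq_mul, mul_one,
      mul_sub, inv_mul_cancel₀ hK]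
  simp only [e]
  rw [abs_mul, abs_of_nonneg (by positivity)]
  exact mul_le_mul_of_nonneg_left (Finset.abs_sum_le_sum_abs _ _) (by positivity)

variable {𝓧 : Type*} [MeasurableSpace 𝓧]

omit [∀ n, IsProbabilityMeasure (P n)] in
theorem iIndepFun_block {X : ∀ n, ℕ → Ω n → 𝓧} (n : ℕ)
    (hind : iIndepFun (fun j : Fin n => X n j) (P n)) {b i : ℕ} (hi : i + b ≤ n) :
    iIndepFun (fun (k : Fin b) ω => block b i (fun j => X n j ω) k) (P n) :=
  hind.precomp (g := fun k : Fin b => (⟨i + k, by omega⟩ : Fin n)) fun k l hkl => by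
    have := Fin.mk.inj_iff.1 hkl
    ext
    omega

end Blocks

end WeightedU

theorem mainTheorem5 {𝓧 : Type*} [MeasurableSpace 𝓧] {Ω : ℕ → Type*}
    [∀ n, MeasurableSpace (Ω n)] (P : ∀ n, Measure (Ω n)) [∀ n, IsProbabilityMeasure (P n)]
    (X : ∀ n, ℕ → Ω n → 𝓧)
    (hX_meas : ∀ n, ∀ j < n, Measurable (X n j))
    (hX_indep : ∀ n, iIndepFun (fun j : Fin n => X n j) (P n))
    (m : ℕ) (hm : 1 ≤ m)
    (b : ℕ → ℕ) (hb_le : ∀ n, b n ≤ n) (hb : Tendsto b atTop atTop)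
    (a : ∀ n, (Fin m → Fin n) → ℝ) (h : ℕ → (Fin m → 𝓧) → ℝ) (hh : ∀ n, Measurable (h n))
    (a' : ∀ n, (Fin m → Fin (b n)) → ℝ) (h' : ℕ → (Fin m → 𝓧) → ℝ)
    (hh' : ∀ n, Measurable (h' n))
    (c : ℕ → ℝ) (hc : ∀ n, c n ≠ 0)
    (s : ℕ → ℝ) (ζ : ℕ → ℝ) (hζ : ∀ n, 0 < ζ n)
    (h_cond : ∀ i : ℕ → ℕ, (∀ n, i n + b n ≤ n) →
      WeightedU.BootstrapConditions P b
        (fun n k ω => WeightedU.block (b n) (i n) (fun j => X n j ω) k) a' h')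
    (h_var : ∀ i : ℕ → ℕ, (∀ n, i n + b n ≤ n) →
      (fun n => WeightedU.uVar (P n)
        (fun k ω => WeightedU.block (b n) (i n) (fun j => X n j ω) k) (a' n) (h' n))
        ~[atTop] s)
    (h_ratio : (fun n => s n / WeightedU.uVar (P n) (fun k : Fin n => X n k) (a n) (h n))
      ~[atTop] ζ) :
    ∃ R : ∀ n, Ω n → ℝ, WeightedU.TendstoInProb P R 0 ∧
      ∀ᶠ n in atTop, ∀ ω : Ω n,
        (WeightedU.uVar (P n) (fun k : Fin n => X n k) (a n) (h n))⁻¹ *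
            WeightedU.movingBlockVar n (b n) (c n) (a' n) (h' n) (fun j => X n j ω) -
          variance (fun ω' => (√(WeightedU.uVar (P n) (fun k : Fin n => X n k) (a n) (h n)))⁻¹ *
            WeightedU.uStat (a n) (h n) (fun k => X n k ω')) (P n) =
        ζ n / c n * (1 + R n ω) - 1 := by
  -- consistency along every choice of blocks
  have hblock : ∀ i : ℕ → ℕ, (∀ n, i n ≤ n - b n) →
      (∀ᶠ n in atTop, 0 < s n) ∧
      (∀ᶠ n in atTop, Integrable (fun ω => WeightedU.bootVar (a' n) (h' n)
        (WeightedU.block (b n) (i n) fun j => X n j ω) / s n) (P n)) ∧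
      Tendsto (fun n => ∫ ω, |WeightedU.bootVar (a' n) (h' n)
        (WeightedU.block (b n) (i n) fun j => X n j ω) / s n - 1| ∂(P n)) atTop (𝓝 0) := by
    intro i hi'
    have hi : ∀ n, i n + b n ≤ n := fun n => by have := hi' n; have := hb_le n; omega
    obtain ⟨hpos, hint, hlim⟩ := (h_cond i hi).tendsto_integral_abs_bootVar hm hb
      (fun n k => hX_meas n _ (by have := hi n; omega))
      (fun n => WeightedU.iIndepFun_block n (hX_indep n) (hi n)) hh'
    obtain ⟨ρ, hρ, heq⟩ := (h_var i hi).exists_eq_mul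
    have hs : ∀ᶠ n in atTop, 0 < s n := by
      filter_upwards [hpos, heq, hρ.eventually_const_lt zero_lt_one] with n h1 h2 h3
      rw [h2] at h1
      exact pos_of_mul_pos_right h1 h3.le
    refine ⟨hs, by filter_upwards [hint] with n hn using hn.div_const _, ?_⟩
    refine WeightedU.tendsto_integral_abs_of_eq_mul hρ ?_ ?_ hlim
    · filter_upwards [hpos, heq, hs] with n h1 h2 h3 ω
      rw [h2] at h1 ⊢
      have : ρ n ≠ 0 := left_ne_zero_of_mul h1.ne'
      simp only [Pi.mul_apply]
      field_simp
    · filter_upwards [hint] with n hn using hn.div_const _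
  have hint := WeightedU.eventually_forall_le_of_choice (p := fun n j => Integrable (fun ω =>
    WeightedU.bootVar (a' n) (h' n) (WeightedU.block (b n) j fun l => X n l ω) / s n) (P n))
    fun i hi => (hblock i hi).2.1
  have hs := (hblock (fun _ => 0) fun n => Nat.zero_le _).1
  have hlim := WeightedU.tendsto_integral_abs_average (Z := fun n j ω =>
    WeightedU.bootVar (a' n) (h' n) (WeightedU.block (b n) j fun l => X n l ω) / s n) hint fun i hi => (hblock i hi).2.2
  obtain ⟨ρ, hρ, heq⟩ := h_ratio.exists_eq_mul
  set τ : ℕ → ℝ := fun n => WeightedU.uVar (P n) (fun k : Fin n => X n k) (a n) (h n) with hτ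
  -- Since division by zero gives zero, a nonzero ratio forces the variance to be nonzero.
  have hτ0 : ∀ᶠ n in atTop, 0 < τ n := by
    filter_upwards [heq, hρ.eventually_const_lt zero_lt_one] with n h1 h2
    have hne : s n / τ n ≠ 0 := by
      rw [h1]
      exact (mul_pos h2 (hζ n)).ne'
    exact lt_of_le_of_ne (variance_nonneg _ _) (div_ne_zero_iff.1 hne).2.symm
  have hZ : ∀ᶠ n in atTop, Integrable (fun ω => ((n - b n + 1 : ℕ) : ℝ)⁻¹ *
      ∑ j ∈ Finset.range (n - b n + 1), WeightedU.bootVar (a' n) (h' n)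
        (WeightedU.block (b n) j fun l => X n l ω) / s n) (P n) := by
    filter_upwards [hint] with n hn
    exact (integrable_finsetSum _ fun j hj =>
      hn j (Nat.lt_succ_iff.1 (Finset.mem_range.1 hj))).const_mul _
  -- The scale `c n` cancels whatever its sign; the remaining deterministic factor is `ρ n`, which
  -- tends to `1`.
  have hY : ∀ᶠ n in atTop, ∀ ω, c n / ζ n * ((τ n)⁻¹ *
      WeightedU.movingBlockVar n (b n) (c n) (a' n) (h' n) fun j => X n j ω) =
      ρ n * (((n - b n + 1 : ℕ) : ℝ)⁻¹ *
      ∑ j ∈ Finset.range (n - b n + 1), WeightedU.bootVar (a' n) (h' n)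
        (WeightedU.block (b n) j fun l => X n l ω) / s n) := by
    filter_upwards [heq, hs, hτ0] with n h1 h2 h3 ω
    have hρn : ρ n = s n / τ n / ζ n := by
      rw [h1, Pi.mul_apply, mul_div_cancel_right₀ _ (hζ n).ne']
    have hcast : ((n - b n + 1 : ℕ) : ℝ) = (n : ℝ) - b n + 1 := by
      push_cast [Nat.cast_sub (hb_le n)]
      ring
    have hK : ((n - b n + 1 : ℕ) : ℝ) ≠ 0 := by positivity
    rw [WeightedU.movingBlockVar, ← hcast, ← Finset.sum_div, hρn]
    have := hc n
    have := (hζ n).ne'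
    field_simp
  have hYlim := WeightedU.tendsto_integral_abs_of_eq_mul hρ hY hZ hlim
  -- The required identity determines `R` once the variance of the standardized statistic equals
  -- `1`; its `L¹` norm tends to `0` by `hYlim`.
  refine ⟨fun n ω => c n / ζ n * ((τ n)⁻¹ *
    WeightedU.movingBlockVar n (b n) (c n) (a' n) (h' n) fun j => X n j ω) - 1,
    WeightedU.tendstoInProb_of_integral ?_ (by simpa only [sub_zero] using hYlim), ?_⟩
  · filter_upwards [hY, hZ] with n h1 h2
    simp only [sub_zero, h1]
    exact ((h2.const_mul _).sub (integrable_const _)).abs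
  · filter_upwards [hτ0] with n hn ω
    have hvar : variance (fun ω' => (√(τ n))⁻¹ *
        WeightedU.uStat (a n) (h n) (fun k => X n k ω')) (P n) = 1 := by
      rw [variance_const_mul, inv_pow, Real.sq_sqrt hn.le]
      exact inv_mul_cancel₀ hn.ne'
    rw [hvar]
    have := hc n
    have := (hζ n).ne'
    have e : ζ n / c n * (1 + (c n / ζ n * ((τ n)⁻¹ * WeightedU.movingBlockVar n (b n) (c n)
        (a' n) (h' n) fun j => X n j ω) - 1)) = (τ n)⁻¹ * WeightedU.movingBlockVar n (b n) (c n)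
        (a' n) (h' n) fun j => X n j ω := by
      field_simp
      ring
    rw [e]
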